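/- Let $d,k\ge 1$ be integers and $\alpha>d$. Let $f:\mathbb{R}^d\to[0,\infty)$ be a spherically symmetric probability density such that $f(tr\theta)/f(t\theta)\to r^{-\alpha}$ as $t\to\infty$ for all unit vectors $\theta$ and all $r>0$; write $f(r):=f(r\theta)$ for $r\ge 0$. For $n\ge1$ let $\mathcal P_n$ be a Poisson point process on $\mathbb{R}^d$ with intensity $nf$ (regarded as a random finite set). Let $m=m(n)$ be positive integers with $m(n)\to\infty$ and $m(n)/n\to0$. Let $h_k:(\mathbb{R}^d)^k\to\{0,1\}$ be measurable, invariant under permutations of its arguments and under translations, and zero on tuples of diameter larger than some constant $L\in(0,\infty)$, with $h_1\equiv1$. Let $s_{d-1}$ be the surface area of the unit sphere of $\mathbb{R}^d$, put $$C_k=\Big(\frac{s_{d-1}}{k!}\int_{(\mathbb{R}^d)^{k-1}}h_k(0,z_1,\dots,z_{k-1})\,dz\Big)^{1/k}$$ and assume $C_k>0$. Let $R_k:[0,\infty)\to[0,\infty)$ be an increasing function with $R_k(t)\to\infty$ and $t^kR_k(t)^df(R_k(t))^k\to\alpha k-d$ as $t\to\infty$. Let $E_k=([-\infty,\infty]^d\setminus\{0\})^k$,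 and let $M_+(E_k)$ be the space of nonnegative Radon measures on $E_k$ with the vague topology. For $r>0$ let $$\nu^{(r)}_{n}=\frac1{k!}\sum_{y}h_k(y)\,\delta_{y/r},$$ the sum being over all $k$-tuples $y=(y_1,\dots,y_k)$ of pairwise distinct points of $\mathcal P_n$ (a term for which $y/r\notin E_k$ is omitted). For $j\ge 1$ let $U_k(j)$ be the $j$-th largest of the values $h_k(\mathcal Y)\min_{y\in\mathcal Y}|y|$, counted with multiplicity, over the $k$-point subsets $\mathcal Y\subset\mathcal P_n$ ($U_k(j)=0$ if there are fewer than $j$ such subsets). Put $\nu_{k,n}=\nu_n^{(R_k(C_kn/m))}$ and $\hat\nu_{k,n}=\nu_n^{(U_k(m^k))}$, with $\hat\nu_{k,n}=0$ if $U_k(m^k)=0$. (Here $\nu_{k,n}$ and the ratio in (ii) are considered for $n$ so large that $R_k(C_kn/m)>0$.) Let $\mu_k\in M_+(E_k)$ be the measure with $$\mu_k(\phi)=\frac{\alpha k-d}{s_{d-1}}\int_{\mathbb{R}^d}\phi(x,\dots,x)\,|x|^{-\alpha k}\,dx$$ for every nonnegative continuous function $\phi$ with compact support in $E_k$. Then,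 as $n\to\infty$: (i) $m^{-k}\nu_{k,n}\to\mu_k$ in probability in $M_+(E_k)$; (ii) $U_k(m^k)/R_k(C_kn/m)\to1$ in probability, and $m^{-k}\hat\nu_{k,n}\to\mu_k$ in probability in $M_+(E_k)$. -/

import Mathlib

open MeasureTheory ProbabilityTheory Filter Topology Set
open scoped ENNReal NNReal CompactlySupported

namespace LayeredHill

noncomputable section

/-! ### Convergence in probability in the space of Radon measures -/

/-- `M_+(X)`: the nonnegative Borel measures on `X` that are finite on compact sets. On a locally
compact, second countable Hausdorff space these are exactly the nonnegative Radon measures. -/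
def RadonMeasure (X : Type*) [TopologicalSpace X] [MeasurableSpace X] : Type _ :=
  {μ : Measure X // IsFiniteMeasureOnCompacts μ}

/-- The vague topology on `M_+(X)`: the coarsest topology for which `μ ↦ ∫ φ dμ` is continuous
for every nonnegative continuous function `φ` with compact support. -/
instance (X : Type*) [TopologicalSpace X] [MeasurableSpace X] :
    TopologicalSpace (RadonMeasure X) :=
  TopologicalSpace.induced
    (fun (μ : RadonMeasure X) (φ : C_c(X, ℝ≥0)) => ∫ x, (φ x : ℝ) ∂μ.1) Pi.topologicalSpace

instance (X : Type*) [TopologicalSpace X] [MeasurableSpace X] : Zero (RadonMeasure X) :=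
  ⟨⟨0, inferInstance⟩⟩

/-- Multiplication of a Radon measure by a finite nonnegative constant. -/
instance (X : Type*) [TopologicalSpace X] [MeasurableSpace X] : SMul ℝ≥0 (RadonMeasure X) :=
  ⟨fun c μ => ⟨(c : ℝ≥0∞) • μ.1, have := μ.2; IsFiniteMeasureOnCompacts.smul μ.1
    ENNReal.coe_ne_top⟩⟩

/-- Convergence in probability of random elements of a topological space to a deterministic
limit: the probability of lying outside any given neighbourhood of the limit tends to `0`. For a
metrizable topology this is convergence in probability for any compatible metric. -/
def TendstoInProbability {Ω X : Type*} [MeasurableSpace Ω] [TopologicalSpace X] (P : Measure Ω)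
    (Y : ℕ → Ω → X) (x : X) : Prop :=
  ∀ U ∈ 𝓝 x, Tendsto (fun n => P {ω | Y n ω ∉ U}) atTop (𝓝 0)

/-! ### The state space -/

/-- `ℝ^d` with the Euclidean norm. -/
abbrev Rd (d : ℕ) : Type := EuclideanSpace ℝ (Fin d)

/-- The compactified space `[-∞, ∞]^d` with the origin removed. -/
abbrev PuncturedExt (d : ℕ) : Type := ↥({0}ᶜ : Set (Fin d → EReal))

/-- The space `E_k`, the `k`-fold product of the punctured compactified space. -/
abbrev ExtSpace (d k : ℕ) : Type := Fin k → PuncturedExt d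

/-- `ℝ^d` with the origin removed. -/
abbrev PuncturedRd (d : ℕ) : Type := ↥({0}ᶜ : Set (Rd d))

/-- The inclusion of `ℝ^d` into `[-∞, ∞]^d`. -/
def toExt {d : ℕ} (x : Rd d) : Fin d → EReal := fun j => ((x j : ℝ) : EReal)

theorem toExt_ne_zero {d : ℕ} {x : Rd d} (hx : x ≠ 0) : toExt x ≠ 0 := by
  intro h
  apply hx
  ext j
  have := congrFun h j
  simpa [toExt] using this

theorem continuous_toExt {d : ℕ} : Continuous (toExt : Rd d → Fin d → EReal) := by
  unfold toExt
  refine continuous_pi fun j => continuous_coe_real_ereal.comp ?_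
  fun_prop

/-- The inclusion of `ℝ^d \ {0}` into `[-∞, ∞]^d \ {0}`. -/
def toPunctured {d : ℕ} (x : PuncturedRd d) : PuncturedExt d :=
  ⟨toExt x.1, toExt_ne_zero x.2⟩

theorem continuous_toPunctured {d : ℕ} :
    Continuous (toPunctured : PuncturedRd d → PuncturedExt d) :=
  (continuous_toExt.comp continuous_subtype_val).subtype_mk _

/-- The diagonal map `x ↦ (x, …, x)` from `ℝ^d \ {0}` to `E_k`. -/
def diag {d : ℕ} (k : ℕ) (x : PuncturedRd d) : ExtSpace d k := fun _ => toPunctured x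

theorem continuous_diag {d k : ℕ} : Continuous (diag (d := d) k) :=
  continuous_pi fun _ => continuous_toPunctured

open scoped Classical in
/-- The Dirac measure `δ_x` on `E_k` at `x = (x_1, …, x_k) ∈ (ℝ^d)^k`; it is the zero measure if
some `x_i` is the origin, since then `x` is not a point of `E_k`. -/
def diracAt {d k : ℕ} (x : Fin k → Rd d) : Measure (ExtSpace d k) :=
  if hx : ∀ i, x i ≠ 0 then Measure.dirac (fun i => toPunctured ⟨x i, hx i⟩) else 0

instance {d k : ℕ} (x : Fin k → Rd d) : IsFiniteMeasure (diracAt x) := by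
  unfold diracAt
  split_ifs <;> infer_instance

/-! ### The density, the Poisson process, the geometric constraint and the radius -/

/-- `f` is a spherically symmetric probability density on `ℝ^d` whose tail is regularly varying
with exponent `α`. -/
structure IsRadialRVDensity (d : ℕ) (α : ℝ) (f : Rd d → ℝ) : Prop where
  measurable : Measurable f
  nonneg : ∀ x, 0 ≤ f x
  lintegral_eq_one : ∫⁻ x, ENNReal.ofReal (f x) = 1
  radial : ∀ x y, ‖x‖ = ‖y‖ → f x = f y
  regularlyVarying : ∀ θ : Rd d, ‖θ‖ = 1 → ∀ r : ℝ, 0 < r →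
    Tendsto (fun t : ℝ => f ((t * r) • θ) / f (t • θ)) atTop (𝓝 (r ^ (-α)))

/-- The number of points of the finite set `N` in `A`. -/
def count {X : Type*} (N : Finset X) (A : Set X) : ℕ := ((N : Set X) ∩ A).ncard

/-- `N` is a Poisson point process with finite intensity measure `Λ`, realized as a random finite
set of points: the numbers of points in measurable sets are Poisson random variables with means
given by `Λ`, and they are independent for disjoint sets. -/
structure IsPoissonProcess {Ω X : Type*} [MeasurableSpace Ω] [MeasurableSpace X]
    (P : Measure Ω) (Λ : Measure X) (N : Ω → Finset X) : Prop where
  isFiniteMeasure : IsFiniteMeasure Λ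
  measurable_count : ∀ A, MeasurableSet A → Measurable fun ω => count (N ω) A
  map_count : ∀ A, MeasurableSet A →
    P.map (fun ω => count (N ω) A) = poissonMeasure (Λ A).toNNReal
  indep : ∀ (s : ℕ) (A : Fin s → Set X), (∀ i, MeasurableSet (A i)) →
    Pairwise (fun i j => Disjoint (A i) (A j)) → iIndepFun (fun i ω => count (N ω) (A i)) P

/-- `h = h_k` is a geometric constraint: a measurable indicator function on `(ℝ^d)^k` that is
invariant under permutations and translations and vanishes on tuples of diameter larger than some
constant `L`; for `k = 1` it is identically `1`. -/
structure IsGeometricConstraint (d k : ℕ) (h : (Fin k → Rd d) → ℝ) : Prop where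
  measurable : Measurable h
  zero_or_one : ∀ y, h y = 0 ∨ h y = 1
  eq_one : k = 1 → ∀ y, h y = 1
  perm : ∀ (σ : Equiv.Perm (Fin k)) (y : Fin k → Rd d), h (y ∘ σ) = h y
  translation : ∀ (x : Rd d) (y : Fin k → Rd d), h (fun i => x + y i) = h y
  diam : ∃ L : ℝ, 0 < L ∧ ∀ y : Fin k → Rd d, L < Metric.diam (Set.range y) → h y = 0

/-- The surface area `s_{d-1}` of the unit sphere of `ℝ^d`. -/
def sphereArea (d : ℕ) : ℝ := (volume : Measure (Rd d)).toSphere.real Set.univ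

/-- The constant
`C_k = (s_{d-1} / k! * ∫_{(ℝ^d)^{k-1}} h_k(0, z_1, …, z_{k-1}) dz)^{1/k}` (for `k ≥ 1`). -/
def layerConst {d : ℕ} : (k : ℕ) → ((Fin k → Rd d) → ℝ) → ℝ
  | 0, _ => 0
  | j + 1, h =>
    (sphereArea d / (j + 1).factorial * ∫ z : Fin j → Rd d, h (Fin.cons 0 z)) ^
      (1 / ((j + 1 : ℕ) : ℝ))

/-- `R = R_k : [0, ∞) → [0, ∞)` is an increasing function that grows to infinity and satisfies
`t^k R(t)^d f(R(t))^k → α k - d` as `t → ∞`, where `f(r) = f(r θ)` for any unit vector `θ`. -/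
structure IsRadius (d k : ℕ) (α : ℝ) (f : Rd d → ℝ) (R : ℝ → ℝ) : Prop where
  nonneg : ∀ t, 0 ≤ t → 0 ≤ R t
  monotone : MonotoneOn R (Set.Ici 0)
  tendsto_atTop : Tendsto R atTop atTop
  asymptotic : ∀ θ : Rd d, ‖θ‖ = 1 →
    Tendsto (fun t : ℝ => t ^ k * R t ^ d * f (R t • θ) ^ k) atTop (𝓝 (α * k - d))

/-! ### Layered tail empirical measures and order statistics -/

open scoped Classical in
/-- The `k`-tuples of pairwise distinct points of `N`. -/
def distinctTuples {d : ℕ} (k : ℕ) (N : Finset (Rd d)) : Finset (Fin k → Rd d) :=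
  (Fintype.piFinset fun _ => N).filter Function.Injective

/-- The measure `(1/k!) ∑ h(y) δ_{y/r}` on `E_k`, the sum being over the `k`-tuples `y` of pairwise
distinct points of `N`. -/
def layeredMeasure {d k : ℕ} (h : (Fin k → Rd d) → ℝ) (N : Finset (Rd d)) (r : ℝ) :
    RadonMeasure (ExtSpace d k) :=
  ⟨ENNReal.ofReal (1 / (k.factorial : ℝ)) •
      ∑ y ∈ distinctTuples k N, ENNReal.ofReal (h y) • diracAt (r⁻¹ • y), by
    have h1 : ∀ y : Fin k → Rd d, IsFiniteMeasure (ENNReal.ofReal (h y) • diracAt (r⁻¹ • y)) :=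
      fun y => Measure.smul_finite _ ENNReal.ofReal_ne_top
    have h2 : IsFiniteMeasure
        (∑ y ∈ distinctTuples k N, ENNReal.ofReal (h y) • diracAt (r⁻¹ • y)) :=
      ⟨by
        rw [Measure.finsetSum_apply]
        exact ENNReal.sum_lt_top.2 fun y _ => (h1 y).measure_univ_lt_top⟩
    have h3 := Measure.smul_finite
      (∑ y ∈ distinctTuples k N, ENNReal.ofReal (h y) • diracAt (r⁻¹ • y))
      (ENNReal.ofReal_ne_top (r := 1 / (k.factorial : ℝ)))
    infer_instance⟩

open scoped Classical in
/-- The value `h(Y) min(Y)` for a `k`-point set `Y = {y_1, …, y_k}`, where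
`min(Y) = min_i |y_i|`; it does not depend on the enumeration of `Y` if `h` is permutation
invariant. -/
def layerValue {d k : ℕ} (h : (Fin k → Rd d) → ℝ) (Y : Finset (Rd d)) : ℝ :=
  if hY : Y.card = k then
    h (fun i => ((Y.equivFinOfCardEq hY).symm i : Rd d)) *
      ⨅ i, ‖((Y.equivFinOfCardEq hY).symm i : Rd d)‖
  else 0

/-- The `j`-th largest order statistic `U_k(j)`, `j ≥ 1`, among the values `h(Y) min(Y)`, with
multiplicity, of the `k`-point subsets `Y` of `N`; it is `0` if there are fewer than `j` such
subsets. -/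
def orderStat {d k : ℕ} (h : (Fin k → Rd d) → ℝ) (N : Finset (Rd d)) (j : ℕ) : ℝ :=
  (((N.powersetCard k).val.map (layerValue h)).sort (· ≥ ·)).getD (j - 1) 0

open scoped Classical in
/-- The layered tail empirical measure with the radius replaced by the order statistic
`U_k(j)`; it is the zero measure if `U_k(j) = 0`. -/
def estimatedMeasure {d k : ℕ} (h : (Fin k → Rd d) → ℝ) (N : Finset (Rd d)) (j : ℕ) :
    RadonMeasure (ExtSpace d k) :=
  if orderStat h N j = 0 then 0 else layeredMeasure h N (orderStat h N j)

/-! ### The limit measure -/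

theorem exists_pos_of_isCompact {d k : ℕ} (hk : 1 ≤ k) {K : Set (ExtSpace d k)}
    (hK : IsCompact K) :
    ∃ δ : ℝ, 0 < δ ∧ ∀ x : PuncturedRd d, diag k x ∈ K → δ ≤ ‖x.1‖ := by
  let p : ExtSpace d k → Fin d → EReal := fun y => (y ⟨0, hk⟩).1
  have hp : Continuous p := by fun_prop
  have hopen : IsOpen (toExt (d := d) ⁻¹' (p '' K)ᶜ) :=
    (hK.image hp).isClosed.isOpen_compl.preimage continuous_toExt
  have h0 : (0 : Rd d) ∈ toExt (d := d) ⁻¹' (p '' K)ᶜ := by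
    rintro ⟨y, -, hy⟩
    apply (y ⟨0, hk⟩).2
    rw [show (y ⟨0, hk⟩).1 = toExt 0 from hy]
    ext j
    simp [toExt]
  obtain ⟨δ, hδ, hball⟩ := Metric.isOpen_iff.1 hopen 0 h0
  refine ⟨δ, hδ, fun x hx => ?_⟩
  by_contra! hlt
  exact hball (by simpa using hlt) ⟨diag k x, hx, rfl⟩

theorem lintegral_rpow_norm_lt_top {d : ℕ} {p δ : ℝ} (hp : (d : ℝ) < p) (hδ : 0 < δ) :
    ∫⁻ x in {x : Rd d | δ ≤ ‖x‖}, ENNReal.ofReal (‖x‖ ^ (-p)) < ∞ := by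
  have hp0 : 0 < p := lt_of_le_of_lt (Nat.cast_nonneg d) hp
  have hint : Integrable (fun x : Rd d => ((1 + δ⁻¹) ^ p) * (1 + ‖x‖) ^ (-p)) :=
    (integrable_one_add_norm (by simpa using hp)).const_mul _
  refine lt_of_le_of_lt ?_ hint.lintegral_lt_top
  refine le_trans (setLIntegral_mono' (measurableSet_le measurable_const measurable_norm)
    fun x hx => ENNReal.ofReal_le_ofReal ?_) (setLIntegral_le_lintegral _ _)
  have hx' : δ ≤ ‖x‖ := hx
  have hxpos : 0 < ‖x‖ := lt_of_lt_of_le hδ hx'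
  have hle : 1 + ‖x‖ ≤ (1 + δ⁻¹) * ‖x‖ := by
    have : 1 ≤ δ⁻¹ * ‖x‖ := by
      rw [inv_mul_eq_div, le_div_iff₀ hδ]; simpa using hx'
    linarith
  have h1 : (1 + ‖x‖) ^ p ≤ (1 + δ⁻¹) ^ p * ‖x‖ ^ p := by
    rw [← Real.mul_rpow (by positivity) (by positivity)]
    exact Real.rpow_le_rpow (by positivity) hle hp0.le
  rw [Real.rpow_neg hxpos.le, Real.rpow_neg (by positivity), ← div_eq_mul_inv,
    le_div_iff₀ (by positivity), inv_mul_le_iff₀ (by positivity)]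
  linarith

/-- The measure `((α k - d) / s_{d-1}) ∫_{ℝ^d} 1{(x, …, x) ∈ · } |x|^{-α k} dx` on `E_k`. -/
def limitMeasureAux (d k : ℕ) (α : ℝ) : Measure (ExtSpace d k) :=
  ENNReal.ofReal ((α * k - d) / sphereArea d) •
    (((volume : Measure (Rd d)).comap (Subtype.val : PuncturedRd d → Rd d)).withDensity
      fun x => ENNReal.ofReal (‖x.1‖ ^ (-(α * k)))).map (diag k)

theorem measurable_density (d k : ℕ) (α : ℝ) : Measurable
    fun x : PuncturedRd d => ENNReal.ofReal (‖x.1‖ ^ (-(α * k))) := by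
  fun_prop

theorem isFiniteMeasureOnCompacts_limitMeasureAux {d k : ℕ} {α : ℝ} (hk : 1 ≤ k)
    (hα : (d : ℝ) < α) : IsFiniteMeasureOnCompacts (limitMeasureAux d k α) := by
  have hp : (d : ℝ) < α * k := by
    have h1 : (1 : ℝ) ≤ k := by exact_mod_cast hk
    have h0 : (0 : ℝ) ≤ d := Nat.cast_nonneg d
    nlinarith
  refine ⟨fun K hK => ?_⟩
  obtain ⟨δ, hδ, hKδ⟩ := exists_pos_of_isCompact hk hK
  have hKm : MeasurableSet K := hK.isClosed.measurableSet
  rw [limitMeasureAux, Measure.smul_apply, smul_eq_mul,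
    Measure.map_apply continuous_diag.measurable hKm,
    withDensity_apply _ (continuous_diag.measurable hKm)]
  refine ENNReal.mul_lt_top ENNReal.ofReal_lt_top ?_
  let S : Set (Rd d) := {x | δ ≤ ‖x‖}
  have hS : MeasurableSet S := measurableSet_le measurable_const measurable_norm
  calc ∫⁻ x in diag k ⁻¹' K, ENNReal.ofReal (‖x.1‖ ^ (-(α * k)))
          ∂((volume : Measure (Rd d)).comap (Subtype.val : PuncturedRd d → Rd d))
      ≤ ∫⁻ x in (Subtype.val : PuncturedRd d → Rd d) ⁻¹' S,
          ENNReal.ofReal (‖x.1‖ ^ (-(α * k))) ∂((volume : Measure (Rd d)).comap Subtype.val) :=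
        lintegral_mono_set fun x hx => hKδ x hx
    _ = ∫⁻ x : PuncturedRd d, S.indicator (fun x => ENNReal.ofReal (‖x‖ ^ (-(α * k)))) x.1
          ∂((volume : Measure (Rd d)).comap Subtype.val) := by
        rw [← lintegral_indicator (hS.preimage measurable_subtype_coe)]
        rfl
    _ = ∫⁻ x in ({0}ᶜ : Set (Rd d)), S.indicator (fun x => ENNReal.ofReal (‖x‖ ^ (-(α * k)))) x :=
        lintegral_subtype_comap (measurableSet_singleton 0).compl _
    _ ≤ ∫⁻ x, S.indicator (fun x => ENNReal.ofReal (‖x‖ ^ (-(α * k)))) x :=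
        setLIntegral_le_lintegral _ _
    _ = ∫⁻ x in S, ENNReal.ofReal (‖x‖ ^ (-(α * k))) := lintegral_indicator hS _
    _ < ∞ := lintegral_rpow_norm_lt_top hp hδ

/-- The limit measure `μ_k ∈ M_+(E_k)`. -/
def limitMeasure {d k : ℕ} {α : ℝ} (hk : 1 ≤ k) (hα : (d : ℝ) < α) :
    RadonMeasure (ExtSpace d k) :=
  ⟨limitMeasureAux d k α, isFiniteMeasureOnCompacts_limitMeasureAux hk hα⟩

/-- The relation that characterizes the limit measure:
`μ_k(φ) = ((α k - d) / s_{d-1}) ∫ φ(x, …, x) |x|^{-α k} dx`. -/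
theorem integral_limitMeasure {d k : ℕ} {α : ℝ} (hk : 1 ≤ k) (hα : (d : ℝ) < α)
    (φ : C_c(ExtSpace d k, ℝ≥0)) :
    ∫ y, (φ y : ℝ) ∂(limitMeasure hk hα).1 =
      (α * k - d) / sphereArea d *
        ∫ x : PuncturedRd d, (φ (diag k x) : ℝ) * ‖x.1‖ ^ (-(α * k))
          ∂((volume : Measure (Rd d)).comap Subtype.val) := by
  have hpos : 0 ≤ (α * k - d) / sphereArea d := by
    have h1 : (1 : ℝ) ≤ k := by exact_mod_cast hk
    have h0 : (0 : ℝ) ≤ d := Nat.cast_nonneg d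
    refine div_nonneg (by nlinarith) measureReal_nonneg
  have hφ : Continuous fun y : ExtSpace d k => (φ y : ℝ) :=
    NNReal.continuous_coe.comp φ.continuous
  change ∫ y, (φ y : ℝ) ∂(limitMeasureAux d k α) = _
  rw [limitMeasureAux, integral_smul_measure, ENNReal.toReal_ofReal hpos,
    integral_map continuous_diag.measurable.aemeasurable hφ.aestronglyMeasurable,
    integral_withDensity_eq_integral_toReal_smul (measurable_density d k α) (by simp), smul_eq_mul]
  congr 2
  ext x
  rw [ENNReal.toReal_ofReal (Real.rpow_nonneg (norm_nonneg _) _), smul_eq_mul, mul_comm]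

end

end LayeredHill

open LayeredHill

/-!
# Consistency of the layered Hill estimator

Write `y = (y₁, …, y_k)` for tuples of distinct points of the Poisson process with intensity `n f`,
and fix a bounded function `φ` of the tuple that is supported on tuples staying away from the
origin. Everything rests on a law of large numbers for the *cluster sum*
`∑ h(y) φ(y / r)` with `r = R(C n / m)`, divided by `k! m ^ k`.

*Mean.* By the Campbell formula (`IsPoissonProcess.lintegral_sum_injTuples`), which follows from
the independence of the counts on disjoint sets, the mean of the cluster sum is
`n ^ k ∫ h(y) φ(y / r) ∏ f(yᵢ) dy`. The kernel `h` keeps the points within a fixed distance of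
each other, while `r → ∞`; after the substitution `y = (r x, r x + z₁, …)` regular variation of `f`
gives pointwise convergence of the integrand, divided by `f(r) ^ k`, to
`h(0, z) φ(x, …, x) ‖x‖ ^ (-α k)`, and Potter's bound dominates it
(`tendsto_lintegral_cluster`). The defining property of `R` and of the constant `C` turns the
factor `n ^ k r ^ d f(r) ^ k` into a constant multiple of `m ^ k`
(`tendstoInMeasure_layerSum`).

*Variance.* The square of a cluster sum is a sum over pairs of tuples. Pairs without a common point
have mean at most the square of the mean. A pair with a common point lies in a cluster of bounded
diameter, and such pairs can be counted in terms of tuples of `k` and of `2 k` points that are all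
near the first one (`card_overlap_le`, `IsPoissonProcess.lintegral_sq_le`). By the same first-moment
asymptotics the means of these two counts are of order `m ^ k` and `m ^ (2 k) r ^ (-d)`
respectively, hence negligible after division by `m ^ (2 k)`. Chebyshev's inequality finishes the
proof of `tendstoInMeasure_clusterSum`. Since the vague topology is generated by integrals of test
functions, the convergence of `m ^ (-k) ν` follows (`tendstoInProbability_of_forall_integral`).

*Order statistic.* The event `a r ≤ U(m ^ k)` says that at least `m ^ k` of the `k`-point subsets
have all their points at distance `≥ a r` from the origin and `h = 1`. The indicator of
`min ‖yᵢ‖ ≥ a` is an admissible `φ`, since its discontinuities meet the diagonal in a null set, and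
its limit is `a ^ (d - α k)`, which is strictly decreasing in `a` and equals `1` at `a = 1`. Hence
`U(m ^ k) / r → 1`.

*Estimated scale.* On the event that `U / r` is close to `1`, replacing `r` by `U` changes
`φ(y / r)` by at most the oscillation of `φ` under rescaling by factors close to `1`. That
oscillation is again an admissible function and its limit integral tends to zero
(`tendsto_limitFunctional_oscillation`), so the law of large numbers at the deterministic scale
transfers to the random one.
-/

namespace LayeredHill

/-! ### Regularly varying functions -/

/-- The uniform convergence theorem for slowly varying functions, in additive form. If it failed
along `x n → ∞`, `u n ∈ [0, 1]`, then the shifts `v ∈ [0, 2]` that are harmless at `x n` and those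
that are harmless at `x n + u n` would both have measure close to `2`; after translation by `u n`
both sets lie in `[0, 3]`, so they meet, which bounds `g (x n + u n) - g (x n)`. -/
theorem exists_forall_abs_increment_le {g : ℝ → ℝ} (hg : Measurable g)
    (h : ∀ u, Tendsto (fun x => g (x + u) - g x) atTop (𝓝 0)) {ε : ℝ} (hε : 0 < ε) :
    ∃ X, ∀ x, X ≤ x → ∀ u ∈ Icc (0 : ℝ) 1, |g (x + u) - g x| ≤ ε := by
  by_contra! hcon
  choose x hx u hu hxu using fun n : ℕ => hcon n
  have hxtop : Tendsto x atTop atTop :=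
    tendsto_atTop_mono hx tendsto_natCast_atTop_atTop
  have key : ∀ y : ℕ → ℝ, Tendsto y atTop atTop →
      ∀ᶠ n in atTop, ENNReal.ofReal (3 / 2) <
        volume {v ∈ Icc (0 : ℝ) 2 | ∀ j, n ≤ j → |g (y j + v) - g (y j)| < ε / 2} := by
    intro y hy
    have hmono : Monotone fun n : ℕ =>
        {v ∈ Icc (0 : ℝ) 2 | ∀ j, n ≤ j → |g (y j + v) - g (y j)| < ε / 2} :=
      fun a b hab v hv => ⟨hv.1, fun j hj => hv.2 j (hab.trans hj)⟩
    have hU : ⋃ n : ℕ, {v ∈ Icc (0 : ℝ) 2 | ∀ j, n ≤ j → |g (y j + v) - g (y j)| < ε / 2} =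
        Icc (0 : ℝ) 2 := by
      refine subset_antisymm (iUnion_subset fun n v hv => hv.1) fun v hv => ?_
      have h1 : ∀ᶠ j in atTop, |g (y j + v) - g (y j)| < ε / 2 := by
        have := ((h v).comp hy).abs
        rw [abs_zero] at this
        exact this.eventually_lt_const (by positivity)
      obtain ⟨n, hn⟩ := eventually_atTop.1 h1
      exact mem_iUnion.2 ⟨n, hv, hn⟩
    have := tendsto_measure_iUnion_atTop (μ := (volume : Measure ℝ)) hmono
    rw [hU, Real.volume_Icc] at this
    exact this.eventually_const_lt (by
      rw [ENNReal.ofReal_lt_ofReal_iff] <;> norm_num)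
  have hyu : Tendsto (fun n => x n + u n) atTop atTop :=
    tendsto_atTop_mono (fun n => le_add_of_nonneg_right (hu n).1) hxtop
  obtain ⟨n, hU, hV⟩ := ((key x hxtop).and (key _ hyu)).exists
  set U := {v ∈ Icc (0 : ℝ) 2 | ∀ j, n ≤ j → |g (x j + v) - g (x j)| < ε / 2} with hUdef
  set V := {v ∈ Icc (0 : ℝ) 2 |
    ∀ j, n ≤ j → |g (x j + u j + v) - g (x j + u j)| < ε / 2} with hVdef
  have hVm : MeasurableSet V := by
    have hV' : V = Icc (0 : ℝ) 2 ∩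
        ⋂ j, ⋂ (_ : n ≤ j), {v | |g (x j + u j + v) - g (x j + u j)| < ε / 2} := by
      ext v
      simp [hVdef]
    rw [hV']
    exact measurableSet_Icc.inter <| MeasurableSet.iInter fun j => MeasurableSet.iInter fun _ =>
      measurableSet_lt (((hg.comp (measurable_const_add _)).sub_const _).abs) measurable_const
  have hW : volume ((fun v => v + -u n) ⁻¹' V) = volume V :=
    measure_preimage_add_right _ _ _
  have hWm : MeasurableSet ((fun v => v + -u n) ⁻¹' V) := hVm.preimage (measurable_add_const _)
  have hne : (U ∩ (fun v => v + -u n) ⁻¹' V).Nonempty := by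
    by_contra hne
    rw [not_nonempty_iff_eq_empty, ← disjoint_iff_inter_eq_empty] at hne
    have h1 : U ∪ (fun v => v + -u n) ⁻¹' V ⊆ Icc (0 : ℝ) 3 := by
      rintro v (hv | hv)
      · exact ⟨hv.1.1, hv.1.2.trans (by norm_num)⟩
      · have h2 := hv.1
        have h3 := hu n
        simp only [mem_Icc] at h2 h3 ⊢
        constructor <;> linarith
    have h2 := measure_mono (μ := volume) h1
    rw [measure_union hne hWm, hW, Real.volume_Icc] at h2
    have h3 := (ENNReal.add_lt_add hU hV).trans_le h2
    rw [← ENNReal.ofReal_add (by norm_num) (by norm_num),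
      ENNReal.ofReal_lt_ofReal_iff (by norm_num)] at h3
    norm_num at h3
  obtain ⟨v, hv1, hv2⟩ := hne
  have h1 := hv1.2 n le_rfl
  have h2 := hv2.2 n le_rfl
  have h3 : x n + u n + (v + -u n) = x n + v := by ring
  rw [h3] at h2
  have h4 := hxu n
  rw [abs_lt] at h1 h2
  rw [lt_abs] at h4
  rcases h4 with h4 | h4 <;> linarith

/-- Iterating the uniform convergence theorem over unit steps. -/
theorem exists_forall_abs_sub_le {g : ℝ → ℝ} (hg : Measurable g)
    (h : ∀ u, Tendsto (fun x => g (x + u) - g x) atTop (𝓝 0)) {ε : ℝ} (hε : 0 < ε) :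
    ∃ X, ∀ x y, X ≤ x → X ≤ y → |g y - g x| ≤ ε * (|y - x| + 1) := by
  obtain ⟨X, hX⟩ := exists_forall_abs_increment_le hg h hε
  have key : ∀ n : ℕ, ∀ x u : ℝ, X ≤ x → 0 ≤ u → u ≤ n → |g (x + u) - g x| ≤ ε * (u + 1) := by
    intro n
    induction n with
    | zero =>
      intro x u hx h0 h1
      have : u = 0 := le_antisymm (by simpa using h1) h0
      subst this
      simp [hε.le]
    | succ n ih =>
      intro x u hx h0 h1
      by_cases hu : u ≤ 1
      · refine (hX x hx u ⟨h0, hu⟩).trans ?_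
        nlinarith
      · push Not at hu
        have h2 := ih (x + 1) (u - 1) (by linarith) (by linarith) (by push_cast at h1; linarith)
        have h3 := hX x hx 1 ⟨by norm_num, le_rfl⟩
        rw [show x + 1 + (u - 1) = x + u by ring] at h2
        calc |g (x + u) - g x| ≤ |g (x + u) - g (x + 1)| + |g (x + 1) - g x| := abs_sub_le _ _ _
          _ ≤ ε * (u - 1 + 1) + ε := add_le_add h2 h3
          _ = ε * (u + 1) := by ring
  refine ⟨X, fun x y hx hy => ?_⟩
  rcases le_total x y with hxy | hxy
  · obtain ⟨n, hn⟩ := exists_nat_ge (y - x)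
    have := key n x (y - x) hx (by linarith) hn
    rw [abs_of_nonneg (by linarith : 0 ≤ y - x)]
    simpa using this
  · obtain ⟨n, hn⟩ := exists_nat_ge (x - y)
    have := key n y (x - y) hy (by linarith) hn
    rw [abs_sub_comm (g y), abs_sub_comm y x, abs_of_nonneg (by linarith : 0 ≤ x - y)]
    simpa using this

/-- A nonnegative measurable function on the half-line that is regularly varying at infinity with
index `-α`. -/
structure IsRegularlyVarying (α : ℝ) (F : ℝ → ℝ) : Prop where
  measurable : Measurable F
  nonneg : ∀ t, 0 ≤ F t
  tendsto : ∀ r : ℝ, 0 < r → Tendsto (fun t => F (t * r) / F t) atTop (𝓝 (r ^ (-α)))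

namespace IsRegularlyVarying

variable {α : ℝ} {F : ℝ → ℝ}

theorem eventually_pos (hF : IsRegularlyVarying α F) : ∀ᶠ t in atTop, 0 < F t := by
  have h := hF.tendsto 1 one_pos
  rw [Real.one_rpow] at h
  filter_upwards [h.eventually_const_lt one_pos] with t ht
  refine (hF.nonneg t).lt_of_ne fun h0 => ?_
  simp [← h0] at ht

/-- The Potter bounds, in logarithmic form. -/
theorem exists_abs_log_le (hF : IsRegularlyVarying α F) {ε : ℝ} (hε : 0 < ε) :
    ∃ X, 0 < X ∧ ∀ r s, X ≤ r → X ≤ s → 0 < F r ∧ 0 < F s ∧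
      |Real.log (F s / F r) + α * Real.log (s / r)| ≤ ε * (|Real.log (s / r)| + 1) := by
  let g : ℝ → ℝ := fun x => Real.log (F (Real.exp x)) + α * x
  have hg : Measurable g :=
    (Real.measurable_log.comp (hF.measurable.comp Real.measurable_exp)).add
      (measurable_id.const_mul α)
  have hlim : ∀ u, Tendsto (fun x => g (x + u) - g x) atTop (𝓝 0) := by
    intro u
    have h1 := ((hF.tendsto (Real.exp u) (Real.exp_pos u)).comp Real.tendsto_exp_atTop).log
      (by positivity)
    have h2 := h1.add_const (α * u)
    rw [Real.log_rpow (Real.exp_pos u), Real.log_exp, neg_mul, neg_add_cancel] at h2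
    refine h2.congr' ?_
    have hu : Tendsto (fun x : ℝ => Real.exp (x + u)) atTop atTop :=
      Real.tendsto_exp_atTop.comp (tendsto_atTop_add_const_right _ u tendsto_id)
    filter_upwards [Real.tendsto_exp_atTop.eventually hF.eventually_pos,
      hu.eventually hF.eventually_pos] with x hx hxu
    simp only [g, Function.comp]
    rw [← Real.exp_add, Real.log_div hxu.ne' hx.ne']
    ring
  obtain ⟨X, hX⟩ := exists_forall_abs_sub_le hg hlim hε
  obtain ⟨Y, hY⟩ := eventually_atTop.1 hF.eventually_pos
  refine ⟨max (Real.exp X) Y, lt_max_of_lt_left (Real.exp_pos X), fun r s hr hs => ?_⟩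
  have hr0 : 0 < r := (Real.exp_pos X).trans_le ((le_max_left _ _).trans hr)
  have hs0 : 0 < s := (Real.exp_pos X).trans_le ((le_max_left _ _).trans hs)
  have hFr := hY r ((le_max_right _ _).trans hr)
  have hFs := hY s ((le_max_right _ _).trans hs)
  refine ⟨hFr, hFs, ?_⟩
  have h := hX (Real.log r) (Real.log s)
    ((Real.le_log_iff_exp_le hr0).2 ((le_max_left _ _).trans hr))
    ((Real.le_log_iff_exp_le hs0).2 ((le_max_left _ _).trans hs))
  simp only [g, Real.exp_log hr0, Real.exp_log hs0] at h
  rw [Real.log_div hFs.ne' hFr.ne', Real.log_div hs0.ne' hr0.ne']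
  convert h using 2
  ring

/-- The convergence `F (t r) / F t → r ^ (-α)` is locally uniform in `r`. -/
theorem tendsto_div (hF : IsRegularlyVarying α F) {s : ℝ → ℝ} {u : ℝ} (hu : 0 < u)
    (hs : Tendsto (fun r => s r / r) atTop (𝓝 u)) :
    Tendsto (fun r => F (s r) / F r) atTop (𝓝 (u ^ (-α))) := by
  have hs_top : Tendsto s atTop atTop := by
    refine (hs.pos_mul_atTop hu tendsto_id).congr' ?_
    filter_upwards [eventually_gt_atTop (0 : ℝ)] with r hr
    exact div_mul_cancel₀ _ hr.ne'
  have hlog : Tendsto (fun r => Real.log (s r / r)) atTop (𝓝 (Real.log u)) := hs.log hu.ne'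
  have h0 : Tendsto (fun r => Real.log (F (s r) / F r) + α * Real.log (s r / r)) atTop (𝓝 0) := by
    rw [Metric.tendsto_nhds]
    intro η hη
    set c := |Real.log u| + 2 with hc
    have hc0 : 0 < c := by positivity
    obtain ⟨X, hX0, hX⟩ := hF.exists_abs_log_le (ε := η / (2 * c)) (by positivity)
    filter_upwards [eventually_ge_atTop X, hs_top.eventually_ge_atTop X,
      hlog.abs.eventually_lt_const (show |Real.log u| < |Real.log u| + 1 by linarith)]
      with r hr hsr hl
    rw [Real.dist_eq, sub_zero]
    calc _ ≤ η / (2 * c) * (|Real.log (s r / r)| + 1) := (hX r (s r) hr hsr).2.2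
      _ ≤ η / (2 * c) * c := by gcongr; linarith
      _ = η / 2 := by field_simp
      _ < η := by linarith
  have h1 := h0.sub (hlog.const_mul α)
  have h2 := (Real.continuous_exp.tendsto _).comp h1
  have h3 : Real.exp (0 - α * Real.log u) = u ^ (-α) := by
    rw [Real.rpow_def_of_pos hu]; congr 1; ring
  rw [h3] at h2
  refine h2.congr' ?_
  filter_upwards [hF.eventually_pos, hs_top.eventually hF.eventually_pos] with r hr hsr
  simp only [Function.comp, add_sub_cancel_right]
  exact Real.exp_log (div_pos hsr hr)

/-- Upper Potter bound with any exponent smaller than `α`. -/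
theorem exists_div_le (hF : IsRegularlyVarying α F) {p δ : ℝ} (hp : p < α) (hδ : 0 < δ) :
    ∃ K X, 0 < K ∧ 0 < X ∧ ∀ r s, X ≤ r → δ * r ≤ s → F s / F r ≤ K * (s / r) ^ (-p) := by
  obtain ⟨X, hX0, hX⟩ := hF.exists_abs_log_le (ε := α - p) (by linarith)
  refine ⟨Real.exp ((α - p) * (2 * |Real.log δ| + 1)), max X (X / δ), Real.exp_pos _,
    lt_max_of_lt_left hX0, fun r s hr hs => ?_⟩
  have hrX : X ≤ r := (le_max_left _ _).trans hr
  have hr0 : 0 < r := hX0.trans_le hrX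
  have hsX : X ≤ s := by
    have := (div_le_iff₀ hδ).1 ((le_max_right _ _).trans hr)
    linarith
  have hw : δ ≤ s / r := by rwa [le_div_iff₀ hr0]
  have hw0 : 0 < s / r := hδ.trans_le hw
  obtain ⟨h1, h2, h3⟩ := hX r s hrX hsX
  have h4 : |Real.log (s / r)| ≤ Real.log (s / r) + 2 * |Real.log δ| := by
    have h5 : Real.log δ ≤ Real.log (s / r) := Real.log_le_log hδ hw
    have h6 := neg_abs_le (Real.log δ)
    rw [abs_le]
    constructor <;> linarith [abs_nonneg (Real.log δ)]
  have h5 : Real.log (F s / F r) ≤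
      (α - p) * (2 * |Real.log δ| + 1) + Real.log (s / r) * (-p) := by
    have h6 := (abs_le.1 h3).2
    have h7 : (α - p) * (|Real.log (s / r)| + 1) ≤
        (α - p) * (Real.log (s / r) + 2 * |Real.log δ| + 1) := by
      gcongr
    linarith
  rw [Real.rpow_def_of_pos hw0, ← Real.exp_add, ← Real.log_le_iff_le_exp (div_pos h2 h1)]
  exact h5

end IsRegularlyVarying

/-! ### Factorial moment measures of a Poisson process -/

open scoped Classical in
/-- The tuples of pairwise distinct points of `N`, indexed by an arbitrary finite type. -/
noncomputable def injTuples (ι : Type*) [Fintype ι] {X : Type*} (N : Finset X) : Finset (ι → X) :=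
  (Fintype.piFinset fun _ => N).filter Function.Injective

theorem mem_injTuples {ι X : Type*} [Fintype ι] {N : Finset X} {y : ι → X} :
    y ∈ injTuples ι N ↔ (∀ i, y i ∈ N) ∧ Function.Injective y := by
  classical
  simp [injTuples, Fintype.mem_piFinset]

theorem lintegral_natCast_poissonMeasure (r : ℝ≥0) :
    ∫⁻ n, (n : ℝ≥0∞) ∂(poissonMeasure r) = r := by
  have h1 : ∀ n : ℕ, ENNReal.ofReal (Real.exp (-r) * r ^ (n + 1) / (n + 1).factorial) *
      ((n + 1 : ℕ) : ℝ≥0∞) = r * ENNReal.ofReal (Real.exp (-r) * r ^ n / n.factorial) := by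
    intro n
    rw [← ENNReal.ofReal_natCast (n + 1), ← ENNReal.ofReal_mul (by positivity),
      ← ENNReal.ofReal_coe_nnreal, ← ENNReal.ofReal_mul (by positivity)]
    congr 1
    rw [Nat.factorial_succ]
    push_cast
    field_simp
    ring
  have h2 : ∑' n : ℕ, ENNReal.ofReal (Real.exp (-r) * r ^ n / n.factorial) = 1 := by
    rw [← ENNReal.ofReal_tsum_of_nonneg (fun n => by positivity)
      (hasSum_one_poissonMeasure r).summable, (hasSum_one_poissonMeasure r).tsum_eq,
      ENNReal.ofReal_one]
  rw [poissonMeasure, lintegral_sum_measure]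
  simp only [lintegral_smul_measure, lintegral_dirac, smul_eq_mul]
  rw [tsum_eq_zero_add' ENNReal.summable]
  simp_rw [h1]
  rw [ENNReal.tsum_mul_left, h2]
  simp

theorem sum_injTuples_indicator_pi {ι X : Type*} [Fintype ι] (M : Finset X) {A : ι → Set X}
    (hA : Pairwise fun i j => Disjoint (A i) (A j)) :
    ∑ y ∈ injTuples ι M, (univ.pi A).indicator (1 : (ι → X) → ℝ≥0∞) y =
      ∏ i, (count M (A i) : ℝ≥0∞) := by
  classical
  have h1 : (injTuples ι M).filter (· ∈ univ.pi A) =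
      Fintype.piFinset fun i => M.filter (· ∈ A i) := by
    ext y
    simp only [Finset.mem_filter, mem_injTuples, Fintype.mem_piFinset, mem_univ_pi]
    constructor
    · exact fun h i => ⟨h.1.1 i, h.2 i⟩
    · refine fun h => ⟨⟨fun i => (h i).1, fun i j hij => ?_⟩, fun i => (h i).2⟩
      by_contra hne
      exact Set.disjoint_left.1 (hA hne) (h i).2 (hij ▸ (h j).2)
  have h2 : ∀ i, count M (A i) = (M.filter (· ∈ A i)).card := by
    intro i
    rw [count, ← Set.ncard_coe_finset]
    congr 1
    ext x
    simp
  simp only [Set.indicator_apply, Pi.one_apply]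
  rw [← Finset.sum_filter, h1, Finset.sum_const, Fintype.card_piFinset]
  simp [h2]

section Campbell

variable {Ω X : Type*} [MeasurableSpace Ω] [MeasurableSpace X] {P : Measure Ω} {Λ : Measure X}
  {N : Ω → Finset X}

theorem IsPoissonProcess.lintegral_count (hN : IsPoissonProcess P Λ N) {A : Set X}
    (hA : MeasurableSet A) : ∫⁻ ω, (count (N ω) A : ℝ≥0∞) ∂P = Λ A := by
  have := hN.isFiniteMeasure
  rw [← lintegral_map (f := fun n : ℕ => (n : ℝ≥0∞)) (by fun_prop) (hN.measurable_count A hA),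
    hN.map_count A hA, lintegral_natCast_poissonMeasure]
  exact ENNReal.coe_toNNReal (measure_ne_top _ _)

/-- Campbell's formula for the function `G` of tuples of distinct points, together with the
measurability of the sum. -/
def CampbellFormula (P : Measure Ω) (Λ : Measure X) (N : Ω → Finset X) {ι : Type*} [Fintype ι]
    (G : (ι → X) → ℝ≥0∞) : Prop :=
  (Measurable fun ω => ∑ y ∈ injTuples ι (N ω), G y) ∧
    ∫⁻ ω, ∑ y ∈ injTuples ι (N ω), G y ∂P = ∫⁻ y, G y ∂(Measure.pi fun _ => Λ)

variable {ι : Type*} [Fintype ι]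

theorem CampbellFormula.zero : CampbellFormula P Λ N (fun _ : ι → X => 0) := by
  simp [CampbellFormula]

theorem CampbellFormula.tsum {G : ℕ → (ι → X) → ℝ≥0∞} (hG : ∀ n, Measurable (G n))
    (h : ∀ n, CampbellFormula P Λ N (G n)) : CampbellFormula P Λ N fun y => ∑' n, G n y := by
  have h1 : ∀ ω, ∑ y ∈ injTuples ι (N ω), ∑' n, G n y =
      ∑' n, ∑ y ∈ injTuples ι (N ω), G n y := fun ω =>
    (Summable.tsum_finsetSum fun _ _ => ENNReal.summable).symm
  constructor
  · simp_rw [h1]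
    exact Measurable.tsum fun n => (h n).1
  · simp_rw [h1]
    rw [lintegral_tsum fun n => (h n).1.aemeasurable, lintegral_tsum fun n => (hG n).aemeasurable]
    simp_rw [fun n => (h n).2]

/-- Campbell's formula on rectangles with pairwise disjoint sides: it is the independence of the
numbers of points in the sides. -/
theorem IsPoissonProcess.campbellFormula_pi (hN : IsPoissonProcess P Λ N) {A : ι → Set X}
    (hAm : ∀ i, MeasurableSet (A i)) (hA : Pairwise fun i j => Disjoint (A i) (A j)) :
    CampbellFormula P Λ N ((univ.pi A).indicator (1 : (ι → X) → ℝ≥0∞)) := by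
  have := hN.isFiniteMeasure
  have hm : ∀ i, Measurable fun ω => (count (N ω) (A i) : ℝ≥0∞) := fun i =>
    (measurable_of_countable (fun n : ℕ => (n : ℝ≥0∞))).comp (hN.measurable_count _ (hAm i))
  constructor
  · simp_rw [sum_injTuples_indicator_pi _ hA]
    exact Finset.measurable_fun_prod _ fun i _ => hm i
  · simp_rw [sum_injTuples_indicator_pi _ hA]
    have hind : iIndepFun (fun i ω => (count (N ω) (A i) : ℝ≥0∞)) P := by
      let e := Fintype.equivFin ι
      have h1 := hN.indep (Fintype.card ι) (fun i => A (e.symm i)) (fun i => hAm _)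
        fun i j hij => hA (e.symm.injective.ne hij)
      have h2 := h1.precomp e.injective
      simp only [Equiv.symm_apply_apply] at h2
      exact h2.comp (fun _ n => (n : ℝ≥0∞)) fun _ => measurable_of_countable _
    rw [lintegral_prod_eq_prod_lintegral_of_indepFun _ _ hind hm,
      lintegral_indicator_one (MeasurableSet.univ_pi hAm), Measure.pi_pi]
    exact Finset.prod_congr rfl fun i _ => hN.lintegral_count (hAm i)

theorem IsPoissonProcess.campbellFormula_inter_pi (hN : IsPoissonProcess P Λ N) {A : ι → Set X}
    (hAm : ∀ i, MeasurableSet (A i)) (hA : Pairwise fun i j => Disjoint (A i) (A j))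
    {B : Set (ι → X)} (hB : MeasurableSet B) :
    CampbellFormula P Λ N ((B ∩ univ.pi A).indicator (1 : (ι → X) → ℝ≥0∞)) := by
  have := hN.isFiniteMeasure
  have hR : MeasurableSet (univ.pi A) := MeasurableSet.univ_pi hAm
  refine MeasurableSpace.induction_on_inter
    (C := fun B _ => CampbellFormula P Λ N ((B ∩ univ.pi A).indicator (1 : (ι → X) → ℝ≥0∞)))
    generateFrom_pi.symm isPiSystem_pi ?_ ?_ ?_ ?_ B hB
  · simp only [empty_inter, indicator_empty]
    exact CampbellFormula.zero
  · rintro t ⟨s, hs, rfl⟩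
    rw [← pi_inter_distrib]
    exact hN.campbellFormula_pi (fun i => (hs i (mem_univ i)).inter (hAm i)) fun i j hij =>
      (hA hij).mono inter_subset_right inter_subset_right
  · intro t ht ih
    have h0 := hN.campbellFormula_pi hAm hA
    have hle : ∀ y, (t ∩ univ.pi A).indicator (1 : (ι → X) → ℝ≥0∞) y ≤
        (univ.pi A).indicator 1 y := fun y =>
      indicator_le_indicator_of_subset inter_subset_right (fun _ => zero_le) y
    have hsplit : ∀ y, (tᶜ ∩ univ.pi A).indicator (1 : (ι → X) → ℝ≥0∞) y +
        (t ∩ univ.pi A).indicator 1 y = (univ.pi A).indicator 1 y := by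
      intro y
      by_cases h1 : y ∈ t <;> by_cases h2 : y ∈ univ.pi A <;> simp [h1, h2]
    have hfin : ∀ ω, ∑ y ∈ injTuples ι (N ω), (t ∩ univ.pi A).indicator (1 : (ι → X) → ℝ≥0∞) y
        ≠ ∞ := fun ω => (ENNReal.sum_lt_top.2 fun y _ =>
          (indicator_le_self' (fun _ _ => zero_le) y).trans_lt ENNReal.one_lt_top).ne
    have h1 : ∀ ω, ∑ y ∈ injTuples ι (N ω), (tᶜ ∩ univ.pi A).indicator (1 : (ι → X) → ℝ≥0∞) y =
        ∑ y ∈ injTuples ι (N ω), (univ.pi A).indicator 1 y -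
          ∑ y ∈ injTuples ι (N ω), (t ∩ univ.pi A).indicator 1 y := by
      intro ω
      refine (ENNReal.sub_eq_of_eq_add (hfin ω) ?_).symm
      rw [← Finset.sum_add_distrib]
      exact Finset.sum_congr rfl fun y _ => (hsplit y).symm
    have hfin2 : ∫⁻ ω, ∑ y ∈ injTuples ι (N ω),
        (t ∩ univ.pi A).indicator (1 : (ι → X) → ℝ≥0∞) y ∂P ≠ ∞ := by
      rw [ih.2, lintegral_indicator_one (ht.inter hR)]
      exact measure_ne_top _ _
    constructor
    · simp_rw [h1]
      exact h0.1.sub ih.1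
    · simp_rw [h1]
      rw [lintegral_sub ih.1 hfin2 (ae_of_all _ fun ω => Finset.sum_le_sum fun y _ => hle y),
        h0.2, ih.2, lintegral_indicator_one hR, lintegral_indicator_one (ht.inter hR),
        lintegral_indicator_one (ht.compl.inter hR)]
      refine ENNReal.sub_eq_of_eq_add (measure_ne_top _ _) ?_
      rw [inter_comm tᶜ, inter_comm t, add_comm, ← sdiff_eq, measure_inter_add_sdiff _ ht]
  · intro s hd hs ih
    have h1 : ((⋃ n, s n) ∩ univ.pi A).indicator (1 : (ι → X) → ℝ≥0∞) =
        fun y => ∑' n, (s n ∩ univ.pi A).indicator 1 y := by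
      rw [iUnion_inter]
      exact indicator_iUnion_of_pairwise_disjoint (fun n => s n ∩ univ.pi A) (fun i j hij =>
        (hd hij).mono inter_subset_left inter_subset_left) 1
    rw [h1]
    exact CampbellFormula.tsum (fun n => measurable_one.indicator ((hs n).inter hR)) ih

/-- The injective tuples are covered by countably many rectangles with pairwise disjoint measurable
sides. -/
theorem exists_cover_injective (ι : Type*) [Fintype ι] (X : Type*) [MeasurableSpace X]
    [TopologicalSpace X] [SecondCountableTopology X] [T2Space X] [OpensMeasurableSpace X] :
    ∃ E : ℕ → Set (ι → X), (∀ n, MeasurableSet (E n)) ∧ {y | Function.Injective y} ⊆ ⋃ n, E n ∧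
      ∀ n, E n = ∅ ∨ ∃ A : ι → Set X, (∀ i, MeasurableSet (A i)) ∧
        (Pairwise fun i j => Disjoint (A i) (A j)) ∧ E n = univ.pi A := by
  let b := TopologicalSpace.countableBasis X
  have hb := TopologicalSpace.isBasis_countableBasis X
  have : Countable b := (TopologicalSpace.countable_countableBasis X).to_subtype
  let T : Set (Set (ι → X)) := insert ∅
    (range fun s : {s : ι → b // Pairwise fun i j => Disjoint (s i : Set X) (s j : Set X)} =>
      univ.pi fun i => (s.1 i : Set X))
  have hT : T.Countable := (countable_range _).insert _
  obtain ⟨E, hE⟩ := hT.exists_eq_range ⟨∅, mem_insert _ _⟩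
  have hE' : ∀ n, E n = ∅ ∨ ∃ A : ι → Set X, (∀ i, MeasurableSet (A i)) ∧
      (Pairwise fun i j => Disjoint (A i) (A j)) ∧ E n = univ.pi A := by
    intro n
    have hn : E n ∈ T := hE ▸ mem_range_self n
    rcases hn with hn | ⟨s, hs⟩
    · exact Or.inl hn
    · exact Or.inr ⟨fun i => s.1 i, fun i => (hb.isOpen (s.1 i).2).measurableSet, s.2, hs.symm⟩
  refine ⟨E, fun n => ?_, fun y hy => ?_, hE'⟩
  · rcases hE' n with h | ⟨A, hA, -, h⟩
    · rw [h]; exact MeasurableSet.empty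
    · rw [h]; exact MeasurableSet.univ_pi hA
  · obtain ⟨u, hu, hd⟩ := (finite_range y).t2_separation
    have h1 : ∀ i, ∃ v ∈ b, y i ∈ v ∧ v ⊆ u (y i) := fun i =>
      hb.exists_subset_of_mem_open (hu (y i)).1 (hu (y i)).2
    choose v hvb hyv hvu using h1
    have hs : Pairwise fun i j => Disjoint (v i) (v j) := fun i j hij =>
      (hd (mem_range_self i) (mem_range_self j) (hy.ne hij)).mono (hvu i) (hvu j)
    have hmem : (univ.pi v) ∈ range E := by
      rw [← hE]
      exact Or.inr ⟨⟨fun i => ⟨v i, hvb i⟩, hs⟩, rfl⟩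
    obtain ⟨n, hn⟩ := hmem
    exact mem_iUnion.2 ⟨n, hn ▸ fun i _ => hyv i⟩

/-- Campbell's formula: the factorial moment measures of a diffuse Poisson process are the powers
of its intensity. -/
theorem IsPoissonProcess.campbellFormula [TopologicalSpace X] [SecondCountableTopology X]
    [T2Space X] [OpensMeasurableSpace X] (hN : IsPoissonProcess P Λ N)
    (hΛ : ∀ᵐ y ∂(Measure.pi fun _ : ι => Λ), Function.Injective y) {G : (ι → X) → ℝ≥0∞}
    (hG : Measurable G) : CampbellFormula P Λ N G := by
  have := hN.isFiniteMeasure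
  obtain ⟨E, hEm, hEc, hE⟩ := exists_cover_injective ι X
  have hDm : ∀ n, MeasurableSet (disjointed E n) := fun n => MeasurableSet.disjointed hEm n
  have hind : ∀ B : Set (ι → X), MeasurableSet B →
      CampbellFormula P Λ N (B.indicator (1 : (ι → X) → ℝ≥0∞)) := by
    intro B hB
    have h1 : ∀ n, CampbellFormula P Λ N ((B ∩ disjointed E n).indicator
        (1 : (ι → X) → ℝ≥0∞)) := by
      intro n
      rcases hE n with h | ⟨A, hAm, hA, h⟩
      · have : disjointed E n = ∅ := subset_empty_iff.1 (h ▸ disjointed_subset E n)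
        rw [this, inter_empty, indicator_empty]
        exact CampbellFormula.zero
      · have h2 : B ∩ disjointed E n = B ∩ disjointed E n ∩ univ.pi A :=
          (inter_eq_left.2 (inter_subset_right.trans (h ▸ disjointed_subset E n))).symm
        rw [h2]
        exact hN.campbellFormula_inter_pi hAm hA (hB.inter (hDm n))
    have h2 := CampbellFormula.tsum (fun n => measurable_one.indicator (hB.inter (hDm n))) h1
    have h3 : ∀ y : ι → X, Function.Injective y → B.indicator (1 : (ι → X) → ℝ≥0∞) y =
        ∑' n, (B ∩ disjointed E n).indicator 1 y := by
      intro y hy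
      have h4 := congrFun (indicator_iUnion_of_pairwise_disjoint (fun n => B ∩ disjointed E n)
        (fun i j hij => (disjoint_disjointed E hij).mono inter_subset_right inter_subset_right)
        (1 : (ι → X) → ℝ≥0∞)) y
      rw [← h4, ← inter_iUnion, iUnion_disjointed]
      by_cases hyB : y ∈ B
      · rw [indicator_of_mem hyB, indicator_of_mem (show y ∈ B ∩ ⋃ n, E n from ⟨hyB, hEc hy⟩)]
      · rw [indicator_of_notMem hyB, indicator_of_notMem fun h => hyB h.1]
    have h4 : ∀ ω, ∑ y ∈ injTuples ι (N ω), B.indicator (1 : (ι → X) → ℝ≥0∞) y =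
        ∑ y ∈ injTuples ι (N ω), ∑' n, (B ∩ disjointed E n).indicator 1 y := fun ω =>
      Finset.sum_congr rfl fun y hy => h3 y (mem_injTuples.1 hy).2
    refine ⟨by simp_rw [h4]; exact h2.1, ?_⟩
    simp_rw [h4]
    rw [h2.2]
    exact lintegral_congr_ae (hΛ.mono fun y hy => (h3 y hy).symm)
  refine Measurable.ennreal_induction (motive := fun G => CampbellFormula P Λ N G) ?_ ?_ ?_ hG
  · intro c s hs
    have h1 : (s.indicator fun _ => c) = fun y : ι → X => c * s.indicator 1 y := by
      ext y
      by_cases hy : y ∈ s <;> simp [hy]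
    rw [h1]
    have hm : Measurable (s.indicator (1 : (ι → X) → ℝ≥0∞)) := measurable_one.indicator hs
    refine ⟨?_, ?_⟩
    · simp_rw [← Finset.mul_sum]
      exact (hind s hs).1.const_mul c
    · simp_rw [← Finset.mul_sum]
      rw [lintegral_const_mul _ (hind s hs).1, (hind s hs).2, lintegral_const_mul _ hm]
  · intro f g _ hf hg ihf ihg
    simp only [CampbellFormula, Pi.add_apply, Finset.sum_add_distrib]
    exact ⟨ihf.1.add ihg.1, by rw [lintegral_add_left ihf.1, lintegral_add_left hf, ihf.2, ihg.2]⟩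
  · intro f hf hmono ih
    have h1 : ∀ ω, ∑ y ∈ injTuples ι (N ω), ⨆ n, f n y = ⨆ n, ∑ y ∈ injTuples ι (N ω), f n y :=
      fun ω => ENNReal.finsetSum_iSup_of_monotone fun y i j hij => hmono hij y
    refine ⟨by simp_rw [h1]; exact Measurable.iSup fun n => (ih n).1, ?_⟩
    simp_rw [h1]
    rw [lintegral_iSup (fun n => (ih n).1) fun i j hij ω => Finset.sum_le_sum fun y _ =>
      hmono hij y, lintegral_iSup hf hmono]
    simp_rw [fun n => (ih n).2]

end Campbell

/-! ### Integrals of cluster functionals against the scaled density -/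

/-- A kernel on `(ℝ^d)^(j+1)` with values in `[0, 1]` that is translation invariant and vanishes
unless all the points are within a fixed distance of each other. -/
structure IsClusterKernel {d j : ℕ} (h : (Fin (j + 1) → Rd d) → ℝ) : Prop where
  measurable : Measurable h
  nonneg : ∀ y, 0 ≤ h y
  le_one : ∀ y, h y ≤ 1
  translation : ∀ (x : Rd d) (y : Fin (j + 1) → Rd d), h (fun i => x + y i) = h y
  dist_le : ∃ L, 0 < L ∧ ∀ y, h y ≠ 0 → ∀ i i', dist (y i) (y i') ≤ L

/-- A bounded nonnegative measurable function on `(ℝ^d)^ι` that vanishes as soon as one of the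
points is close to the origin, and is continuous at almost every point of the diagonal. These are
the functions against which the layered measures are tested; they contain the restrictions of the
compactly supported functions on `E_k` as well as the indicators of `{min |y_i| ≥ a}`. -/
structure IsTestFunction {d : ℕ} {ι : Type*} (φ : (ι → Rd d) → ℝ) : Prop where
  measurable : Measurable φ
  nonneg : ∀ y, 0 ≤ φ y
  bounded : ∃ B, ∀ y, φ y ≤ B
  eq_zero : ∃ δ, 0 < δ ∧ ∀ y i, ‖y i‖ < δ → φ y = 0
  continuousAt : ∀ᵐ x : Rd d, ContinuousAt φ fun _ => x

/-- The substitution `y = r x + (0, z_1, …, z_j)`. -/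
theorem lintegral_eq_mul_lintegral_shift {d j : ℕ} {G : (Fin (j + 1) → Rd d) → ℝ≥0∞}
    (hG : Measurable G) {r : ℝ} (hr : 0 < r) :
    ∫⁻ y, G y = ENNReal.ofReal (r ^ d) *
      ∫⁻ p : Rd d × (Fin j → Rd d),
        G fun i => r • p.1 + (Fin.cons 0 p.2 : Fin (j + 1) → Rd d) i := by
  have hcons : ∀ (x : Rd d) (z : Fin j → Rd d),
      (Fin.cons x (fun i => x + z i) : Fin (j + 1) → Rd d) =
        fun i => x + (Fin.cons 0 z : Fin (j + 1) → Rd d) i := by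
    intro x z
    ext1 i
    refine Fin.cases ?_ (fun i => ?_) i <;> simp
  have hm : Measurable fun p : Rd d × (Fin j → Rd d) =>
      (Fin.cons p.1 p.2 : Fin (j + 1) → Rd d) := by
    refine measurable_pi_lambda _ fun i => ?_
    refine Fin.cases ?_ (fun i => ?_) i
    · simpa using measurable_fst
    · change Measurable fun p : Rd d × (Fin j → Rd d) => p.2 i
      fun_prop
  have hm2 : Measurable fun p : Rd d × (Fin j → Rd d) =>
      fun i => p.1 + (Fin.cons 0 p.2 : Fin (j + 1) → Rd d) i := by
    refine measurable_pi_lambda _ fun i => ?_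
    refine Fin.cases ?_ (fun i => ?_) i
    · simpa using measurable_fst
    · change Measurable fun p : Rd d × (Fin j → Rd d) => p.1 + p.2 i
      fun_prop
  have h1 : ∫⁻ y, G y = ∫⁻ p : Rd d × (Fin j → Rd d), G (Fin.cons p.1 p.2) := by
    have hp := (volume_preserving_piFinSuccAbove (fun _ : Fin (j + 1) => Rd d) 0).symm
    rw [← hp.lintegral_comp hG]
    refine lintegral_congr fun p => ?_
    congr 1
    simp [MeasurableEquiv.piFinSuccAbove, Fin.insertNthEquiv]
  have h2 : ∫⁻ p : Rd d × (Fin j → Rd d), G (Fin.cons p.1 p.2) =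
      ∫⁻ x : Rd d, ∫⁻ z : Fin j → Rd d,
        G fun i => x + (Fin.cons 0 z : Fin (j + 1) → Rd d) i := by
    rw [Measure.volume_eq_prod, lintegral_prod (fun p : Rd d × (Fin j → Rd d) =>
      G (Fin.cons p.1 p.2)) (hG.comp hm).aemeasurable]
    refine lintegral_congr fun x => ?_
    rw [← lintegral_add_left_eq_self (fun z : Fin j → Rd d => G (Fin.cons x z)) (fun _ => x)]
    refine lintegral_congr fun z => ?_
    rw [← hcons]
    rfl
  have hm3 : Measurable fun x : Rd d => ∫⁻ z : Fin j → Rd d,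
        G fun i => x + (Fin.cons 0 z : Fin (j + 1) → Rd d) i :=
    (hG.comp hm2).lintegral_prod_right'
  have hm4 : Measurable fun p : Rd d × (Fin j → Rd d) =>
      G fun i => r • p.1 + (Fin.cons 0 p.2 : Fin (j + 1) → Rd d) i :=
    (hG.comp hm2).comp ((measurable_fst.const_smul r).prodMk measurable_snd)
  rw [h1, h2, Measure.volume_eq_prod, lintegral_prod _ hm4.aemeasurable]
  have h3 := lintegral_map hm3 (measurable_const_smul (α := Rd d) r) (μ := volume)
  rw [Measure.map_addHaar_smul _ hr.ne', lintegral_smul_measure, finrank_euclideanSpace_fin,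
    abs_of_pos (by positivity), smul_eq_mul] at h3
  rw [← h3, ← mul_assoc, ← ENNReal.ofReal_mul (by positivity),
    mul_inv_cancel₀ (by positivity), ENNReal.ofReal_one, one_mul]

/-- The integral of a cluster functional against the product of the densities, after scaling by
`r`, concentrates on the diagonal: all the points of a cluster are within bounded distance of each
other, so that regular variation gives each of them the same density `|x|^{-α} F r`. The Potter
bounds dominate the integrand. -/
theorem tendsto_lintegral_cluster {d j : ℕ} {α : ℝ} (hα : (d : ℝ) < α) {F : ℝ → ℝ}
    (hF : IsRegularlyVarying α F) {h : (Fin (j + 1) → Rd d) → ℝ} (hh : IsClusterKernel h)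
    {φ : (Fin (j + 1) → Rd d) → ℝ} (hφ : IsTestFunction φ) :
    Tendsto (fun r : ℝ =>
        (∫⁻ y, ENNReal.ofReal (h y * φ (r⁻¹ • y) * ∏ i, F ‖y i‖)) /
          ENNReal.ofReal (r ^ d * F r ^ (j + 1))) atTop
      (𝓝 ((∫⁻ x : Rd d, ENNReal.ofReal (φ (fun _ => x) * ‖x‖ ^ (-(α * (j + 1 : ℕ))))) *
        ∫⁻ z : Fin j → Rd d, ENNReal.ofReal (h (Fin.cons 0 z)))) := by
  obtain ⟨L, hL, hhL⟩ := hh.dist_le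
  obtain ⟨B, hB⟩ := hφ.bounded
  obtain ⟨δ, hδ, hφδ⟩ := hφ.eq_zero
  obtain ⟨p, hdp, hpα⟩ := exists_between hα
  have hp0 : 0 < p := lt_of_le_of_lt (Nat.cast_nonneg d) hdp
  obtain ⟨K, X, hK, hX, hKX⟩ := hF.exists_div_le hpα hδ
  have hB0 : 0 ≤ B := (hφ.nonneg 0).trans (hB 0)
  -- the points of the cluster relative to the first one
  let w : (Fin j → Rd d) → Fin (j + 1) → Rd d := fun z => Fin.cons 0 z
  have hwm : Measurable w := by
    refine measurable_pi_lambda _ fun i => ?_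
    refine Fin.cases ?_ (fun i => ?_) i
    · simp [w]
    · simpa [w] using measurable_pi_apply i
  have hwL : ∀ z, h (w z) ≠ 0 → ∀ i, ‖w z i‖ ≤ L := by
    intro z hz i
    have := hhL _ hz i 0
    simpa [w] using this
  let Φ : ℝ → Rd d × (Fin j → Rd d) → ℝ≥0∞ := fun r q =>
    ENNReal.ofReal (h (w q.2) * φ (fun i => q.1 + r⁻¹ • w q.2 i) *
      ∏ i, (F ‖r • q.1 + w q.2 i‖ / F r))
  have hΦm : ∀ r, Measurable (Φ r) := by
    intro r
    refine ENNReal.measurable_ofReal.comp ?_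
    have h1 : Measurable fun q : Rd d × (Fin j → Rd d) => w q.2 := hwm.comp measurable_snd
    refine ((hh.measurable.comp h1).mul (hφ.measurable.comp ?_)).mul ?_
    · refine measurable_pi_lambda _ fun i => ?_
      have h2 : Measurable fun q : Rd d × (Fin j → Rd d) => w q.2 i :=
        (measurable_pi_apply i).comp h1
      exact measurable_fst.add (h2.const_smul r⁻¹)
    · refine Finset.measurable_fun_prod _ fun i _ => ?_
      exact (hF.measurable.comp ((measurable_fst.const_smul r).add
        ((measurable_pi_apply i).comp h1)).norm).div_const _
  -- reduction to the convergence of the integrals of `Φ`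
  have hred : ∀ᶠ r : ℝ in atTop, ∫⁻ q, Φ r q =
      (∫⁻ y, ENNReal.ofReal (h y * φ (r⁻¹ • y) * ∏ i, F ‖y i‖)) /
          ENNReal.ofReal (r ^ d * F r ^ (j + 1)) := by
    filter_upwards [eventually_gt_atTop (0 : ℝ), hF.eventually_pos] with r hr hFr
    have hGm : Measurable fun y : Fin (j + 1) → Rd d =>
        ENNReal.ofReal (h y * φ (r⁻¹ • y) * ∏ i, F ‖y i‖) := by
      refine ENNReal.measurable_ofReal.comp ?_
      refine (hh.measurable.mul (hφ.measurable.comp (measurable_const_smul _))).mul ?_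
      exact Finset.measurable_fun_prod _ fun i _ =>
        hF.measurable.comp (measurable_pi_apply i).norm
    rw [lintegral_eq_mul_lintegral_shift hGm hr, ENNReal.ofReal_mul (by positivity),
      ENNReal.mul_div_mul_left _ _ (by simpa using pow_pos hr d) ENNReal.ofReal_ne_top,
      ENNReal.eq_div_iff (by simpa using pow_pos hFr (j + 1)) ENNReal.ofReal_ne_top,
      ← lintegral_const_mul _ (hΦm r)]
    refine lintegral_congr fun q => ?_
    change _ * ENNReal.ofReal (h (w q.2) * φ (fun i => q.1 + r⁻¹ • w q.2 i) *
      ∏ i, (F ‖r • q.1 + w q.2 i‖ / F r)) = _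
    rw [← ENNReal.ofReal_mul (by positivity), hh.translation]
    have h1 : (r⁻¹ • fun i => r • q.1 + (Fin.cons 0 q.2 : Fin (j + 1) → Rd d) i) =
        fun i => q.1 + r⁻¹ • w q.2 i := by
      ext1 i
      simp [w, smul_smul, hr.ne']
    rw [h1, Finset.prod_div_distrib, Finset.prod_const, Finset.card_univ, Fintype.card_fin]
    congr 1
    have := pow_pos hFr (j + 1)
    rw [mul_div_assoc', mul_div_cancel₀ _ this.ne']
  refine Tendsto.congr' hred ?_
  -- the dominating function
  let b1 : Rd d → ℝ≥0∞ := fun x =>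
    {x : Rd d | δ ≤ ‖x‖}.indicator (fun x => ENNReal.ofReal (‖x‖ ^ (-(p * (j + 1 : ℕ))))) x
  let b2 : (Fin j → Rd d) → ℝ≥0∞ := (Metric.closedBall 0 L).indicator 1
  let C : ℝ≥0∞ := ENNReal.ofReal (B * (K * 2 ^ p) ^ (j + 1))
  have hSm : MeasurableSet {x : Rd d | δ ≤ ‖x‖} := measurableSet_le measurable_const measurable_norm
  have hb1m : Measurable b1 := by
    refine Measurable.indicator ?_ hSm
    fun_prop
  have hb2m : Measurable b2 := measurable_one.indicator Metric.isClosed_closedBall.measurableSet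
  have hbound : ∫⁻ q : Rd d × (Fin j → Rd d), C * (b1 q.1 * b2 q.2) ≠ ∞ := by
    have hbm : Measurable fun q : Rd d × (Fin j → Rd d) => b1 q.1 * b2 q.2 :=
      (hb1m.comp measurable_fst).mul (hb2m.comp measurable_snd)
    rw [lintegral_const_mul _ hbm, Measure.volume_eq_prod,
      lintegral_prod_mul hb1m.aemeasurable hb2m.aemeasurable]
    refine ENNReal.mul_ne_top ENNReal.ofReal_ne_top (ENNReal.mul_ne_top ?_ ?_)
    · rw [lintegral_indicator hSm]
      refine (lintegral_rpow_norm_lt_top ?_ hδ).ne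
      have h1 : (1 : ℝ) ≤ (j + 1 : ℕ) := by exact_mod_cast Nat.succ_le_succ (Nat.zero_le j)
      nlinarith
    · rw [lintegral_indicator_one Metric.isClosed_closedBall.measurableSet]
      exact measure_closedBall_lt_top.ne
  have hlim : ∫⁻ q : Rd d × (Fin j → Rd d),
      ENNReal.ofReal (φ (fun _ => q.1) * ‖q.1‖ ^ (-(α * (j + 1 : ℕ)))) *
        ENNReal.ofReal (h (w q.2)) =
      (∫⁻ x : Rd d, ENNReal.ofReal (φ (fun _ => x) * ‖x‖ ^ (-(α * (j + 1 : ℕ))))) *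
        ∫⁻ z : Fin j → Rd d, ENNReal.ofReal (h (Fin.cons 0 z)) := by
    rw [Measure.volume_eq_prod, lintegral_prod_mul (f := fun x : Rd d =>
      ENNReal.ofReal (φ (fun _ => x) * ‖x‖ ^ (-(α * (j + 1 : ℕ)))))
      (g := fun z => ENNReal.ofReal (h (w z)))]
    · refine (ENNReal.measurable_ofReal.comp
        ((hφ.measurable.comp (measurable_pi_lambda _ fun _ => measurable_id)).mul ?_)).aemeasurable
      fun_prop
    · exact (ENNReal.measurable_ofReal.comp (hh.measurable.comp hwm)).aemeasurable
  rw [← hlim]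
  refine tendsto_lintegral_filter_of_dominated_convergence
    (fun q : Rd d × (Fin j → Rd d) => C * (b1 q.1 * b2 q.2)) (Eventually.of_forall hΦm) ?_ hbound ?_
  · filter_upwards [eventually_ge_atTop X, eventually_ge_atTop (2 * L / δ),
      hF.eventually_pos] with r hrX hrL hFr
    refine ae_of_all _ fun q => ?_
    have hr : 0 < r := hX.trans_le hrX
    by_cases h1 : h (w q.2) = 0
    · simp [Φ, h1]
    by_cases h2 : φ (fun i => q.1 + r⁻¹ • w q.2 i) = 0
    · simp [Φ, h2]
    have hwq := hwL _ h1
    have hw0 : ∀ i, δ ≤ ‖q.1 + r⁻¹ • w q.2 i‖ := by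
      intro i
      by_contra! hlt
      exact h2 (hφδ _ i hlt)
    have hx : δ ≤ ‖q.1‖ := by simpa [w] using hw0 0
    have hx0 : 0 < ‖q.1‖ := hδ.trans_le hx
    have hz : q.2 ∈ Metric.closedBall (0 : Fin j → Rd d) L := by
      rw [mem_closedBall_zero_iff, pi_norm_le_iff_of_nonneg hL.le]
      intro i
      simpa [w] using hwq i.succ
    have hprod : ∏ i, (F ‖r • q.1 + w q.2 i‖ / F r) ≤
        (K * 2 ^ p) ^ (j + 1) * ‖q.1‖ ^ (-(p * (j + 1 : ℕ))) := by
      have h3 : ∀ i, F ‖r • q.1 + w q.2 i‖ / F r ≤ K * 2 ^ p * ‖q.1‖ ^ (-p) := by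
        intro i
        have h4 : ‖r • q.1 + w q.2 i‖ = ‖q.1 + r⁻¹ • w q.2 i‖ * r := by
          have : r • q.1 + w q.2 i = r • (q.1 + r⁻¹ • w q.2 i) := by
            rw [smul_add, smul_smul, mul_inv_cancel₀ hr.ne', one_smul]
          rw [this, norm_smul, Real.norm_of_nonneg hr.le, mul_comm]
        have h5 := hKX r ‖r • q.1 + w q.2 i‖ hrX
          (by rw [h4]; exact mul_le_mul_of_nonneg_right (hw0 i) hr.le)
        rw [h4, mul_div_cancel_right₀ _ hr.ne', ← h4] at h5
        have h6 : ‖q.1‖ / 2 ≤ ‖q.1 + r⁻¹ • w q.2 i‖ := by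
          have h7 : ‖r⁻¹ • w q.2 i‖ ≤ δ / 2 := by
            rw [norm_smul, norm_inv, Real.norm_of_nonneg hr.le, inv_mul_le_iff₀ hr]
            have := (div_le_iff₀ hδ).1 hrL
            linarith [hwq i]
          have h8 := norm_sub_norm_le q.1 (-(r⁻¹ • w q.2 i))
          rw [norm_neg, sub_neg_eq_add] at h8
          linarith
        calc F ‖r • q.1 + w q.2 i‖ / F r ≤ K * ‖q.1 + r⁻¹ • w q.2 i‖ ^ (-p) := h5
          _ ≤ K * (‖q.1‖ / 2) ^ (-p) := by
            refine mul_le_mul_of_nonneg_left ?_ hK.le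
            exact Real.rpow_le_rpow_of_nonpos (by positivity) h6 (by linarith)
          _ = K * 2 ^ p * ‖q.1‖ ^ (-p) := by
            rw [Real.div_rpow hx0.le (by norm_num), Real.rpow_neg (by norm_num : (0 : ℝ) ≤ 2)]
            field_simp
      calc ∏ i, (F ‖r • q.1 + w q.2 i‖ / F r) ≤
          ∏ _i : Fin (j + 1), (K * 2 ^ p * ‖q.1‖ ^ (-p)) :=
            Finset.prod_le_prod (fun i _ => div_nonneg (hF.nonneg _) hFr.le) fun i _ => h3 i
        _ = _ := by
          rw [Finset.prod_const, Finset.card_univ, Fintype.card_fin, mul_pow, ← Real.rpow_natCast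
            (‖q.1‖ ^ (-p)), ← Real.rpow_mul hx0.le, neg_mul]
    simp only [b1, b2, C, indicator_of_mem (show q.1 ∈ {x : Rd d | δ ≤ ‖x‖} from hx),
      indicator_of_mem hz, Pi.one_apply, mul_one, Φ]
    rw [← ENNReal.ofReal_mul (by positivity)]
    refine ENNReal.ofReal_le_ofReal ?_
    have h9 : h (w q.2) * φ (fun i => q.1 + r⁻¹ • w q.2 i) ≤ B := by
      calc _ ≤ 1 * B := mul_le_mul (hh.le_one _) (hB _) (hφ.nonneg _) zero_le_one
        _ = B := one_mul B
    calc _ ≤ B * ((K * 2 ^ p) ^ (j + 1) * ‖q.1‖ ^ (-(p * (j + 1 : ℕ)))) :=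
          mul_le_mul h9 hprod (Finset.prod_nonneg fun i _ => div_nonneg (hF.nonneg _) hFr.le) hB0
      _ = _ := by ring
  · have hae : ∀ᵐ q : Rd d × (Fin j → Rd d), ContinuousAt φ fun _ => q.1 := by
      rw [Measure.volume_eq_prod]
      exact Measure.quasiMeasurePreserving_fst.ae hφ.continuousAt
    filter_upwards [hae] with q hq
    rw [← ENNReal.ofReal_mul' (hh.nonneg _)]
    refine ENNReal.tendsto_ofReal ?_
    have hinv : ∀ i, Tendsto (fun r : ℝ => q.1 + r⁻¹ • w q.2 i) atTop (𝓝 q.1) := by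
      intro i
      have := (tendsto_inv_atTop_zero (𝕜 := ℝ).smul_const (w q.2 i)).const_add q.1
      rwa [zero_smul, add_zero] at this
    have hφlim : Tendsto (fun r : ℝ => φ fun i => q.1 + r⁻¹ • w q.2 i) atTop
        (𝓝 (φ fun _ => q.1)) :=
      hq.tendsto.comp (tendsto_pi_nhds.2 hinv)
    by_cases hx : ‖q.1‖ < δ
    · have h0 : ∀ᶠ r : ℝ in atTop, φ (fun i => q.1 + r⁻¹ • w q.2 i) = 0 := by
        filter_upwards [(hinv 0).norm.eventually_lt_const hx] with r hr
        exact hφδ _ 0 hr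
      rw [hφδ (fun _ => q.1) 0 hx]
      refine tendsto_const_nhds.congr' ?_
      filter_upwards [h0] with r hr
      simp [hr]
    · have hx0 : 0 < ‖q.1‖ := hδ.trans_le (not_lt.1 hx)
      have hprod : Tendsto (fun r : ℝ => ∏ i, (F ‖r • q.1 + w q.2 i‖ / F r)) atTop
          (𝓝 (∏ _i : Fin (j + 1), ‖q.1‖ ^ (-α))) := by
        refine tendsto_finsetProd _ fun i _ => hF.tendsto_div hx0 ?_
        refine (hinv i).norm.congr' ?_
        filter_upwards [eventually_gt_atTop (0 : ℝ)] with r hr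
        have : r • q.1 + w q.2 i = r • (q.1 + r⁻¹ • w q.2 i) := by
          rw [smul_add, smul_smul, mul_inv_cancel₀ hr.ne', one_smul]
        rw [this, norm_smul, Real.norm_of_nonneg hr.le, mul_div_cancel_left₀ _ hr.ne']
      convert (hφlim.const_mul (h (w q.2))).mul hprod using 2
      rw [Finset.prod_const, Finset.card_univ, Fintype.card_fin, ← Real.rpow_natCast
            (‖q.1‖ ^ (-α)), ← Real.rpow_mul hx0.le, neg_mul]
      ring

/-! ### Pairs of overlapping tuples -/

/-- The number of pairs of overlapping tuples in a cluster of `v` points is controlled by the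
numbers of tuples of `j + 1` and `2 j + 2` distinct points. -/
theorem pow_le_mul_descFactorial {j v : ℕ} (hv : j + 1 ≤ v) :
    v ^ (2 * j + 1) ≤ (4 * j + 2) ^ (2 * j + 1) *
      ((v - 1).descFactorial j + (v - 1).descFactorial (2 * j + 1)) := by
  rcases le_total v (4 * j + 2) with h | h
  · have h1 : 0 < (v - 1).descFactorial j := Nat.descFactorial_pos.2 (by omega)
    calc v ^ (2 * j + 1) ≤ (4 * j + 2) ^ (2 * j + 1) * 1 := by
          rw [mul_one]; exact Nat.pow_le_pow_left h _
      _ ≤ _ := Nat.mul_le_mul_left _ (by omega)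
  · have h1 := Nat.pow_sub_le_descFactorial (v - 1) (2 * j + 1)
    have h2 : v ≤ (4 * j + 2) * (v - 1 + 1 - (2 * j + 1)) := by
      have : v ≤ 2 * (v - 1 + 1 - (2 * j + 1)) := by omega
      exact this.trans (Nat.mul_le_mul_right _ (by omega))
    calc v ^ (2 * j + 1) ≤ ((4 * j + 2) * (v - 1 + 1 - (2 * j + 1))) ^ (2 * j + 1) :=
          Nat.pow_le_pow_left h2 _
      _ = (4 * j + 2) ^ (2 * j + 1) * (v - 1 + 1 - (2 * j + 1)) ^ (2 * j + 1) := mul_pow _ _ _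
      _ ≤ _ := Nat.mul_le_mul_left _ (h1.trans (Nat.le_add_left _ _))

/-- The tuples that start at their anchor `y 0` and stay in `U` and within distance `D` of the
anchor. -/
def anchoredTuples {X : Type*} [PseudoMetricSpace X] (j : ℕ) (U : Set X) (D : ℝ) :
    Set (Fin (j + 1) → X) :=
  {y | ∀ i, y i ∈ U ∧ dist (y i) (y 0) ≤ D}

open scoped Classical in
theorem descFactorial_le_card_anchoredTuples {X : Type*} [PseudoMetricSpace X] (M : Finset X)
    {U : Set X} {D : ℝ} (hD : 0 ≤ D) {p : X} (hpM : p ∈ M) (hpU : p ∈ U) (j : ℕ) :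
    ((M.filter fun x => x ∈ U ∧ dist x p ≤ D).card - 1).descFactorial j ≤
      (((injTuples (Fin (j + 1)) M).filter (· ∈ anchoredTuples j U D)).filter
        fun y => y 0 = p).card := by
  set V := M.filter fun x => x ∈ U ∧ dist x p ≤ D with hV
  have hpV : p ∈ V := by simp [hV, hpM, hpU, hD]
  have h1 : (V.card - 1).descFactorial j = Fintype.card (Fin j ↪ ↥(V.erase p)) := by
    rw [Fintype.card_embedding_eq, Fintype.card_coe, Finset.card_erase_of_mem hpV, Fintype.card_fin]
  rw [h1, ← Finset.card_univ]
  have hmem : ∀ (e : Fin j ↪ ↥(V.erase p)) i, (e i : X) ∈ V ∧ (e i : X) ≠ p := fun e i =>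
    ⟨Finset.mem_of_mem_erase (e i).2, Finset.ne_of_mem_erase (e i).2⟩
  refine Finset.card_le_card_of_injOn
    (fun e => (Fin.cons p fun i => (e i : X) : Fin (j + 1) → X)) (fun e _ => ?_) ?_
  · rw [Finset.mem_coe, Finset.mem_filter, Finset.mem_filter, mem_injTuples]
    have hall : ∀ i, (Fin.cons p fun i => (e i : X) : Fin (j + 1) → X) i ∈ V := by
      intro i
      refine Fin.cases ?_ (fun i => ?_) i
      · simpa using hpV
      · simpa using (hmem e i).1
    refine ⟨⟨⟨fun i => (Finset.mem_filter.1 (hall i)).1, ?_⟩, fun i => ?_⟩, by simp⟩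
    · rw [Fin.cons_injective_iff]
      refine ⟨?_, Subtype.val_injective.comp e.injective⟩
      rintro ⟨i, hi⟩
      exact (hmem e i).2 hi
    · simpa using (Finset.mem_filter.1 (hall i)).2
  · intro e _ e' _ hee
    ext i
    have := congrFun hee i.succ
    simpa using this

open scoped Classical in
/-- Pairs of overlapping clusters are rare: their number is bounded by the numbers of clusters of
`j + 1` and of `2 j + 2` points. -/
theorem card_overlap_le {X : Type*} [PseudoMetricSpace X] (M : Finset X) {U : Set X} {L : ℝ}
    (hL : 0 ≤ L) (j : ℕ) :
    ((injTuples (Fin (j + 1)) M ×ˢ injTuples (Fin (j + 1)) M).filter fun q =>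
        (∀ i, q.1 i ∈ U) ∧ (∀ i, q.2 i ∈ U) ∧ (∀ i i', dist (q.1 i) (q.1 i') ≤ L) ∧
          (∀ i i', dist (q.2 i) (q.2 i') ≤ L) ∧ ∃ i i', q.1 i = q.2 i').card ≤
      (4 * j + 2) ^ (2 * j + 1) *
        (((injTuples (Fin (j + 1)) M).filter (· ∈ anchoredTuples j U (2 * L))).card +
          ((injTuples (Fin (2 * j + 1 + 1)) M).filter
            (· ∈ anchoredTuples (2 * j + 1) U (2 * L))).card) := by
  set O := (injTuples (Fin (j + 1)) M ×ˢ injTuples (Fin (j + 1)) M).filter fun q =>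
        (∀ i, q.1 i ∈ U) ∧ (∀ i, q.2 i ∈ U) ∧ (∀ i i', dist (q.1 i) (q.1 i') ≤ L) ∧
          (∀ i i', dist (q.2 i) (q.2 i') ≤ L) ∧ ∃ i i', q.1 i = q.2 i' with hO
  have hfib : ∀ l : ℕ, ((injTuples (Fin (l + 1)) M).filter
      (· ∈ anchoredTuples l U (2 * L))).card = ∑ p ∈ M, (((injTuples (Fin (l + 1)) M).filter
        (· ∈ anchoredTuples l U (2 * L))).filter fun y => y 0 = p).card := fun l =>
    Finset.card_eq_sum_card_fiberwise fun y hy =>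
      (mem_injTuples.1 (Finset.mem_filter.1 hy).1).1 0
  have hfibO : O.card = ∑ p ∈ M, (O.filter fun q => q.1 0 = p).card :=
    Finset.card_eq_sum_card_fiberwise fun q hq =>
      (mem_injTuples.1 (Finset.mem_product.1 (Finset.mem_filter.1 hq).1).1).1 0
  rw [hfibO, hfib j, hfib (2 * j + 1), ← Finset.sum_add_distrib, Finset.mul_sum]
  refine Finset.sum_le_sum fun p hp => ?_
  rcases (O.filter fun q => q.1 0 = p).eq_empty_or_nonempty with hemp | ⟨q0, hq0⟩
  · simp [hemp]
  set V := M.filter fun x => x ∈ U ∧ dist x p ≤ 2 * L with hV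
  have hOV : ∀ q ∈ O.filter fun q => q.1 0 = p, (∀ i, q.1 i ∈ V) ∧ (∀ i, q.2 i ∈ V) ∧
      Function.Injective q.1 ∧ q.1 0 = p := by
    intro q hq
    rw [Finset.mem_filter, hO, Finset.mem_filter, Finset.mem_product, mem_injTuples,
      mem_injTuples] at hq
    obtain ⟨⟨⟨⟨hm1, hi1⟩, hm2, hi2⟩, hU1, hU2, hL1, hL2, i, i', hii⟩, h0⟩ := hq
    refine ⟨fun l => ?_, fun l => ?_, hi1, h0⟩
    · rw [hV, Finset.mem_filter, ← h0]
      exact ⟨hm1 l, hU1 l, (hL1 l 0).trans (by linarith)⟩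
    · rw [hV, Finset.mem_filter, ← h0]
      refine ⟨hm2 l, hU2 l, (dist_triangle _ (q.2 i') _).trans ?_⟩
      rw [← hii]
      have h3 := hL2 l i'
      rw [← hii] at h3
      have h4 := hL1 i 0
      linarith
  obtain ⟨h1, -, h3, h4⟩ := hOV q0 hq0
  have hpU : p ∈ U := by
    have := (Finset.mem_filter.1 (h1 0)).2.1
    rwa [h4] at this
  have hcard : j + 1 ≤ V.card := by
    have := Finset.card_le_card_of_injOn (s := Finset.univ) (t := V) q0.1 (fun i _ => h1 i)
      h3.injOn
    simpa using this
  calc (O.filter fun q => q.1 0 = p).card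
      ≤ ((Fintype.piFinset fun _ : Fin j => V) ×ˢ
          (Fintype.piFinset fun _ : Fin (j + 1) => V)).card := by
        refine Finset.card_le_card_of_injOn (fun q => (Fin.tail q.1, q.2)) (fun q hq => ?_) ?_
        · obtain ⟨ha, hb, -, -⟩ := hOV q hq
          rw [Finset.mem_coe, Finset.mem_product, Fintype.mem_piFinset, Fintype.mem_piFinset]
          exact ⟨fun i => ha i.succ, hb⟩
        · intro q hq q' hq' hqq
          have ha := (hOV q hq).2.2.2
          have hb := (hOV q' hq').2.2.2
          rw [Prod.mk.injEq] at hqq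
          refine Prod.ext ?_ hqq.2
          rw [← Fin.cons_self_tail q.1, ← Fin.cons_self_tail q'.1, hqq.1, ha, hb]
    _ = V.card ^ (2 * j + 1) := by
        rw [Finset.card_product, Fintype.card_piFinset, Fintype.card_piFinset, Finset.prod_const,
          Finset.prod_const, Finset.card_univ, Finset.card_univ, Fintype.card_fin,
          Fintype.card_fin, ← pow_add]
        congr 1
        ring
    _ ≤ _ := pow_le_mul_descFactorial hcard
    _ ≤ _ := Nat.mul_le_mul_left _ (Nat.add_le_add
        (descFactorial_le_card_anchoredTuples M (by linarith) hp hpU j)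
        (descFactorial_le_card_anchoredTuples M (by linarith) hp hpU (2 * j + 1)))

/-- The square of a sum over tuples of distinct points splits into pairs of disjoint tuples and
pairs of overlapping ones. -/
theorem sq_sum_injTuples_le {X : Type*} [PseudoMetricSpace X] (M : Finset X) {U : Set X} {L : ℝ}
    (hL : 0 ≤ L) {j : ℕ} {g : (Fin (j + 1) → X) → ℝ≥0∞} {B : ℝ≥0∞} (hB : ∀ y, g y ≤ B)
    (hg : ∀ y, g y ≠ 0 → (∀ i, y i ∈ U) ∧ ∀ i i', dist (y i) (y i') ≤ L) :
    (∑ y ∈ injTuples (Fin (j + 1)) M, g y) ^ 2 ≤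
      ∑ w ∈ injTuples (Fin (j + 1) ⊕ Fin (j + 1)) M, g (w ∘ Sum.inl) * g (w ∘ Sum.inr) +
        B ^ 2 * (4 * j + 2) ^ (2 * j + 1) *
          (∑ y ∈ injTuples (Fin (j + 1)) M, (anchoredTuples j U (2 * L)).indicator 1 y +
            ∑ y ∈ injTuples (Fin (2 * j + 1 + 1)) M,
              (anchoredTuples (2 * j + 1) U (2 * L)).indicator 1 y) := by
  classical
  have hind : ∀ l : ℕ, ∑ y ∈ injTuples (Fin (l + 1)) M,
      (anchoredTuples l U (2 * L)).indicator (1 : (Fin (l + 1) → X) → ℝ≥0∞) y =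
      ((injTuples (Fin (l + 1)) M).filter (· ∈ anchoredTuples l U (2 * L))).card := by
    intro l
    simp [indicator_apply]
  rw [sq, Finset.sum_mul_sum, ← Finset.sum_product',
    ← Finset.sum_filter_not_add_sum_filter _ fun q => ∃ i i', q.1 i = q.2 i']
  refine add_le_add (le_of_eq ?_) ?_
  · refine Finset.sum_nbij' (fun q => Sum.elim q.1 q.2) (fun w => (w ∘ Sum.inl, w ∘ Sum.inr))
      ?_ ?_ ?_ ?_ ?_
    · intro q hq
      rw [Finset.mem_filter, Finset.mem_product, mem_injTuples, mem_injTuples] at hq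
      obtain ⟨⟨⟨hm1, hi1⟩, hm2, hi2⟩, hne⟩ := hq
      push Not at hne
      rw [mem_injTuples]
      exact ⟨fun i => by cases i <;> simp [hm1, hm2], hi1.sumElim hi2 hne⟩
    · intro w hw
      rw [mem_injTuples] at hw
      rw [Finset.mem_filter, Finset.mem_product, mem_injTuples, mem_injTuples]
      refine ⟨⟨⟨fun i => hw.1 _, hw.2.comp Sum.inl_injective⟩, fun i => hw.1 _,
        hw.2.comp Sum.inr_injective⟩, ?_⟩
      rintro ⟨i, i', h⟩
      exact Sum.inl_ne_inr (hw.2 h)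
    · intro q _
      rfl
    · intro w _
      exact Sum.elim_comp_inl_inr w
    · intro q _
      rfl
  · rw [hind, hind]
    have h1 := card_overlap_le M (U := U) hL j
    set O := (injTuples (Fin (j + 1)) M ×ˢ injTuples (Fin (j + 1)) M).filter fun q =>
        (∀ i, q.1 i ∈ U) ∧ (∀ i, q.2 i ∈ U) ∧ (∀ i i', dist (q.1 i) (q.1 i') ≤ L) ∧
          (∀ i i', dist (q.2 i) (q.2 i') ≤ L) ∧ ∃ i i', q.1 i = q.2 i' with hO
    have h2 : ∑ q ∈ (injTuples (Fin (j + 1)) M ×ˢ injTuples (Fin (j + 1)) M).filter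
          (fun q => ∃ i i', q.1 i = q.2 i'), g q.1 * g q.2 ≤ ∑ q ∈ O, B ^ 2 := by
      rw [← Finset.sum_subset (s₁ := O)]
      · refine Finset.sum_le_sum fun q _ => ?_
        rw [sq]
        exact mul_le_mul' (hB _) (hB _)
      · intro q hq
        rw [hO, Finset.mem_filter] at hq
        rw [Finset.mem_filter]
        exact ⟨hq.1, hq.2.2.2.2.2⟩
      · intro q hq hqO
        by_contra hne
        rw [mul_eq_zero, not_or] at hne
        rw [Finset.mem_filter] at hq
        refine hqO ?_
        rw [hO, Finset.mem_filter]
        exact ⟨hq.1, (hg _ hne.1).1, (hg _ hne.2).1, (hg _ hne.1).2, (hg _ hne.2).2, hq.2⟩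
    refine h2.trans ?_
    rw [Finset.sum_const, nsmul_eq_mul, mul_comm, mul_assoc]
    gcongr
    exact_mod_cast h1

/-! ### First and second moments of cluster sums -/

section Moments

variable {Ω X : Type*} [MeasurableSpace Ω] [MeasurableSpace X] {P : Measure Ω} {Λ : Measure X}
  {N : Ω → Finset X}

theorem measurableSet_anchoredTuples [PseudoMetricSpace X] [SecondCountableTopology X]
    [OpensMeasurableSpace X] (j : ℕ) {U : Set X} (hU : MeasurableSet U) (D : ℝ) :
    MeasurableSet (anchoredTuples j U D) := by
  have : anchoredTuples j U D = ⋂ i, {y : Fin (j + 1) → X | y i ∈ U} ∩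
      {y | dist (y i) (y 0) ≤ D} := by
    ext y
    simp [anchoredTuples]
  rw [this]
  refine MeasurableSet.iInter fun i => (hU.preimage (measurable_pi_apply i)).inter ?_
  exact measurableSet_le ((measurable_pi_apply i).dist (measurable_pi_apply 0)) measurable_const

/-- Second moment bound for sums over clusters of points of a diffuse Poisson process. -/
theorem IsPoissonProcess.lintegral_sq_le [MetricSpace X] [SecondCountableTopology X]
    [OpensMeasurableSpace X] (hN : IsPoissonProcess P Λ N)
    (hΛ : ∀ (ι : Type) [Fintype ι], ∀ᵐ y ∂(Measure.pi fun _ : ι => Λ), Function.Injective y)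
    {U : Set X} (hU : MeasurableSet U) {L : ℝ}
    (hL : 0 ≤ L) {j : ℕ} {g : (Fin (j + 1) → X) → ℝ≥0∞} (hgm : Measurable g) {B : ℝ≥0∞}
    (hB : ∀ y, g y ≤ B) (hg : ∀ y, g y ≠ 0 → (∀ i, y i ∈ U) ∧ ∀ i i', dist (y i) (y i') ≤ L) :
    ∫⁻ ω, (∑ y ∈ injTuples (Fin (j + 1)) (N ω), g y) ^ 2 ∂P ≤
      (∫⁻ y, g y ∂(Measure.pi fun _ => Λ)) ^ 2 + B ^ 2 * (4 * j + 2) ^ (2 * j + 1) *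
        ((Measure.pi fun _ => Λ) (anchoredTuples j U (2 * L)) +
          (Measure.pi fun _ => Λ) (anchoredTuples (2 * j + 1) U (2 * L))) := by
  have := hN.isFiniteMeasure
  have hm : ∀ l, MeasurableSet (anchoredTuples l U (2 * L)) := fun l =>
    measurableSet_anchoredTuples l hU _
  have hm' : ∀ l, Measurable ((anchoredTuples l U (2 * L)).indicator
      (1 : (Fin (l + 1) → X) → ℝ≥0∞)) := fun l =>
    measurable_one.indicator (hm l)
  have hGm : Measurable fun w : Fin (j + 1) ⊕ Fin (j + 1) → X =>
      g (w ∘ Sum.inl) * g (w ∘ Sum.inr) := by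
    refine (hgm.comp ?_).mul (hgm.comp ?_) <;>
    exact measurable_pi_lambda _ fun i => measurable_pi_apply _
  have h1 := hN.campbellFormula (hΛ _) hGm
  have h2 := hN.campbellFormula (hΛ _) (hm' j)
  have h3 := hN.campbellFormula (hΛ _) (hm' (2 * j + 1))
  have h4 : ∫⁻ w : Fin (j + 1) ⊕ Fin (j + 1) → X, g (w ∘ Sum.inl) * g (w ∘ Sum.inr)
      ∂(Measure.pi fun _ => Λ) = (∫⁻ y, g y ∂(Measure.pi fun _ => Λ)) ^ 2 := by
    have hp := measurePreserving_sumPiEquivProdPi (ι := Fin (j + 1)) (ι' := Fin (j + 1))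
      fun _ => Λ
    have hm2 : Measurable fun z : (Fin (j + 1) → X) × (Fin (j + 1) → X) => g z.1 * g z.2 :=
      (hgm.comp measurable_fst).mul (hgm.comp measurable_snd)
    rw [sq, ← lintegral_prod_mul hgm.aemeasurable hgm.aemeasurable, ← hp.lintegral_comp hm2]
    rfl
  have h5 : Measurable fun ω =>
      ∑ y ∈ injTuples (Fin (j + 1)) (N ω), (anchoredTuples j U (2 * L)).indicator
        (1 : (Fin (j + 1) → X) → ℝ≥0∞) y +
      ∑ y ∈ injTuples (Fin (2 * j + 1 + 1)) (N ω), (anchoredTuples (2 * j + 1) U (2 * L)).indicator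
        (1 : (Fin (2 * j + 1 + 1) → X) → ℝ≥0∞) y := h2.1.add h3.1
  calc _ ≤ ∫⁻ ω, (∑ w ∈ injTuples (Fin (j + 1) ⊕ Fin (j + 1)) (N ω),
            g (w ∘ Sum.inl) * g (w ∘ Sum.inr) +
          B ^ 2 * (4 * j + 2) ^ (2 * j + 1) *
          (∑ y ∈ injTuples (Fin (j + 1)) (N ω), (anchoredTuples j U (2 * L)).indicator 1 y +
            ∑ y ∈ injTuples (Fin (2 * j + 1 + 1)) (N ω),
              (anchoredTuples (2 * j + 1) U (2 * L)).indicator 1 y)) ∂P :=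
        lintegral_mono fun ω => sq_sum_injTuples_le (N ω) hL hB hg
    _ = _ := by
      rw [lintegral_add_left h1.1, lintegral_const_mul _ h5,
        lintegral_add_left h2.1, h1.2, h2.2, h3.2, h4, lintegral_indicator_one (hm _),
        lintegral_indicator_one (hm _)]

end Moments

/-! ### Product measures with a density -/

theorem lintegral_fin_prod_eq_prod {E : Type*} [MeasurableSpace E] {μ : Measure E} [SigmaFinite μ]
    (n : ℕ) {g : Fin n → E → ℝ≥0∞} (hg : ∀ i, Measurable (g i)) :
    ∫⁻ x : Fin n → E, ∏ i, g i (x i) ∂(Measure.pi fun _ => μ) = ∏ i, ∫⁻ x, g i x ∂μ := by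
  induction n with
  | zero => simp
  | succ n ih =>
    have hm : Measurable fun x : Fin n → E => ∏ i, g (Fin.succ i) (x i) :=
      Finset.measurable_fun_prod _ fun i _ => (hg _).comp (measurable_pi_apply i)
    rw [← ((measurePreserving_piFinSuccAbove (fun _ : Fin (n + 1) => μ) 0).symm).lintegral_comp_emb
      (MeasurableEquiv.measurableEmbedding _)]
    simp_rw [MeasurableEquiv.piFinSuccAbove_symm_apply, Fin.insertNthEquiv,
      Fin.prod_univ_succ, Fin.insertNth_zero, Equiv.coe_fn_mk, Fin.cons_succ, Fin.cons_zero]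
    simp only [cast_eq]
    rw [lintegral_prod_mul (f := g 0) (g := fun x : Fin n → E => ∏ i, g (Fin.succ i) (x i))
      (hg 0).aemeasurable hm.aemeasurable, ih fun i => hg _]

theorem lintegral_fintype_prod_eq_prod {ι E : Type*} [Fintype ι] [MeasurableSpace E]
    {μ : Measure E} [SigmaFinite μ] {g : ι → E → ℝ≥0∞} (hg : ∀ i, Measurable (g i)) :
    ∫⁻ x : ι → E, ∏ i, g i (x i) ∂(Measure.pi fun _ => μ) = ∏ i, ∫⁻ x, g i x ∂μ := by
  let e := (Fintype.equivFin ι).symm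
  rw [← (measurePreserving_piCongrLeft (fun _ : ι => μ) e).lintegral_comp_emb
    (MeasurableEquiv.measurableEmbedding _)]
  simp_rw [← e.prod_comp, MeasurableEquiv.coe_piCongrLeft, Equiv.piCongrLeft_apply_apply]
  exact lintegral_fin_prod_eq_prod _ fun i => hg _

theorem pi_withDensity {ι E : Type*} [Fintype ι] [MeasurableSpace E] {μ : Measure E}
    [SigmaFinite μ] {g : E → ℝ≥0∞} (hg : Measurable g) [SigmaFinite (μ.withDensity g)] :
    (Measure.pi fun _ : ι => μ.withDensity g) =
      (Measure.pi fun _ : ι => μ).withDensity fun y => ∏ i, g (y i) := by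
  refine Measure.pi_eq fun s hs => ?_
  have h1 : ∀ y : ι → E, (univ.pi s).indicator (fun y => ∏ i, g (y i)) y =
      ∏ i, (s i).indicator g (y i) := by
    intro y
    by_cases hy : y ∈ univ.pi s
    · rw [indicator_of_mem hy]
      exact Finset.prod_congr rfl fun i _ => (indicator_of_mem (hy i (mem_univ i)) g).symm
    · rw [indicator_of_notMem hy]
      simp only [mem_univ_pi, not_forall] at hy
      obtain ⟨i, hi⟩ := hy
      exact (Finset.prod_eq_zero (Finset.mem_univ i) (indicator_of_notMem hi g)).symm
  rw [withDensity_apply _ (MeasurableSet.univ_pi hs),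
    ← lintegral_indicator (MeasurableSet.univ_pi hs)]
  simp_rw [h1]
  rw [lintegral_fintype_prod_eq_prod fun i => hg.indicator (hs i)]
  exact Finset.prod_congr rfl fun i _ => by
    rw [withDensity_apply _ (hs i), lintegral_indicator (hs i)]

/-- Measures on `ℝ^d` with a density have diffuse powers: the hyperplanes `y i = y i'` are null. -/
theorem ae_pi_injective {d : ℕ} (hd : 1 ≤ d) {g : Rd d → ℝ≥0∞} (hg : Measurable g)
    [SigmaFinite ((volume : Measure (Rd d)).withDensity g)] (ι : Type*) [Fintype ι] :
    ∀ᵐ y ∂(Measure.pi fun _ : ι => (volume : Measure (Rd d)).withDensity g),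
      Function.Injective y := by
  rw [pi_withDensity hg]
  refine (withDensity_absolutelyContinuous _ _).ae_le ?_
  have hnt : Nontrivial (Rd d) := by
    have : Nonempty (Fin d) := ⟨⟨0, hd⟩⟩
    infer_instance
  have h1 : ∀ i i' : ι, i ≠ i' → ∀ᵐ y : ι → Rd d, y i ≠ y i' := by
    intro i i' hii
    let p : (ι → Rd d) →ₗ[ℝ] Rd d :=
      LinearMap.proj (R := ℝ) (φ := fun _ : ι => Rd d) i -
        LinearMap.proj (R := ℝ) (φ := fun _ : ι => Rd d) i'
    have h2 : LinearMap.ker p ≠ ⊤ := by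
      classical
      obtain ⟨v, hv⟩ := exists_ne (0 : Rd d)
      intro htop
      have : Pi.single i v ∈ LinearMap.ker p := htop ▸ Submodule.mem_top
      simp [p, hii.symm, hv] at this
    have h3 := Measure.addHaar_submodule (volume : Measure (ι → Rd d)) _ h2
    rw [ae_iff]
    refine measure_mono_null (fun y hy => ?_) h3
    simp only [ne_eq, not_not, mem_ofPred_eq] at hy
    simp [p, hy]
  have h4 : ∀ᵐ y : ι → Rd d, ∀ i i', i ≠ i' → y i ≠ y i' := by
    rw [ae_all_iff]
    intro i
    rw [ae_all_iff]
    intro i'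
    by_cases h : i = i'
    · simp [h]
    · filter_upwards [h1 i i' h] with y hy _ using hy
  filter_upwards [h4] with y hy i i' hii
  by_contra hne
  exact hy i i' hne hii

/-! ### The law of large numbers for cluster sums -/

/-- Chebyshev's inequality: random variables with converging means and vanishing variances converge
in probability. -/
theorem tendstoInMeasure_of_lintegral_sq_le {Ω : Type*} [MeasurableSpace Ω] {P : Measure Ω}
    [IsProbabilityMeasure P] {X : ℕ → Ω → ℝ} (hX0 : ∀ n ω, 0 ≤ X n ω)
    (hXm : ∀ᶠ n in atTop, Measurable (X n)) {b : ℝ≥0∞} (hb : b ≠ ∞)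
    (hmean : Tendsto (fun n => ∫⁻ ω, ENNReal.ofReal (X n ω) ∂P) atTop (𝓝 b))
    {e : ℕ → ℝ≥0∞} (he : Tendsto e atTop (𝓝 0))
    (hsq : ∀ᶠ n in atTop, ∫⁻ ω, ENNReal.ofReal (X n ω) ^ 2 ∂P ≤
      (∫⁻ ω, ENNReal.ofReal (X n ω) ∂P) ^ 2 + e n) :
    TendstoInMeasure P X atTop fun _ => b.toReal := by
  rw [tendstoInMeasure_iff_norm]
  intro ε hε
  have hmean' := (ENNReal.tendsto_toReal hb).comp hmean
  have hclose : ∀ᶠ n in atTop, |(∫⁻ ω, ENNReal.ofReal (X n ω) ∂P).toReal - b.toReal| < ε / 2 := by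
    have := (Metric.tendsto_nhds.1 hmean') (ε / 2) (by positivity)
    simpa [Real.dist_eq] using this
  have hbound : ∀ᶠ n in atTop, P {ω | ε ≤ ‖X n ω - b.toReal‖} ≤
      ENNReal.ofReal ((e n).toReal / (ε / 2) ^ 2) := by
    filter_upwards [hclose, hsq, hXm, he.eventually_lt_const ENNReal.zero_lt_top,
      hmean.eventually_lt_const hb.lt_top] with n hn hsqn hm hen hEn
    have hsq2 : ∀ ω, ENNReal.ofReal (X n ω) ^ 2 = ENNReal.ofReal (X n ω ^ 2) := fun ω =>
      (ENNReal.ofReal_pow (hX0 n ω) 2).symm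
    simp_rw [hsq2] at hsqn
    have hfin : ∫⁻ ω, ENNReal.ofReal (X n ω ^ 2) ∂P < ∞ :=
      hsqn.trans_lt (ENNReal.add_lt_top.2 ⟨ENNReal.pow_lt_top hEn, hen⟩)
    have hint : Integrable (fun ω => X n ω ^ 2) P := by
      refine ⟨(hm.pow_const 2).aestronglyMeasurable, ?_⟩
      rw [hasFiniteIntegral_iff_ofReal (ae_of_all _ fun ω => sq_nonneg _)]
      exact hfin
    have hL2 : MemLp (X n) 2 P := (memLp_two_iff_integrable_sq hm.aestronglyMeasurable).2 hint
    have hEX : ∫ ω, X n ω ∂P = (∫⁻ ω, ENNReal.ofReal (X n ω) ∂P).toReal :=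
      integral_eq_lintegral_of_nonneg_ae (ae_of_all _ fun ω => hX0 n ω) hm.aestronglyMeasurable
    have hEX2 : ∫ ω, X n ω ^ 2 ∂P = (∫⁻ ω, ENNReal.ofReal (X n ω ^ 2) ∂P).toReal :=
      integral_eq_lintegral_of_nonneg_ae (ae_of_all _ fun ω => sq_nonneg _)
        (hm.pow_const 2).aestronglyMeasurable
    have hvar : Var[X n; P] ≤ (e n).toReal := by
      rw [variance_eq_sub hL2]
      simp only [Pi.pow_apply]
      rw [hEX, hEX2]
      have h1 := ENNReal.toReal_mono (ENNReal.add_lt_top.2 ⟨ENNReal.pow_lt_top hEn, hen⟩).ne hsqn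
      rw [ENNReal.toReal_add (ENNReal.pow_lt_top hEn).ne hen.ne, ENNReal.toReal_pow] at h1
      linarith
    calc P {ω | ε ≤ ‖X n ω - b.toReal‖} ≤ P {ω | ε / 2 ≤ |X n ω - ∫ ω, X n ω ∂P|} := by
          refine measure_mono fun ω (hω : ε ≤ ‖X n ω - b.toReal‖) => ?_
          rw [Real.norm_eq_abs] at hω
          change ε / 2 ≤ |X n ω - ∫ ω, X n ω ∂P|
          rw [hEX]
          have := abs_sub_le (X n ω) (∫⁻ ω, ENNReal.ofReal (X n ω) ∂P).toReal b.toReal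
          linarith
      _ ≤ ENNReal.ofReal (Var[X n; P] / (ε / 2) ^ 2) :=
          meas_ge_le_variance_div_sq hL2 (by positivity)
      _ ≤ _ := ENNReal.ofReal_le_ofReal (by gcongr)
  have hlim : Tendsto (fun n => ENNReal.ofReal ((e n).toReal / (ε / 2) ^ 2)) atTop (𝓝 0) := by
    have h1 := ((ENNReal.tendsto_toReal ENNReal.zero_ne_top).comp he).div_const ((ε / 2) ^ 2)
    rw [ENNReal.toReal_zero, zero_div] at h1
    simpa using ENNReal.tendsto_ofReal h1
  exact tendsto_of_tendsto_of_tendsto_of_le_of_le' tendsto_const_nhds hlim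
    (Eventually.of_forall fun _ => zero_le) hbound

theorem IsClusterKernel.lintegral_cons_ne_top {d j : ℕ} {h : (Fin (j + 1) → Rd d) → ℝ}
    (hh : IsClusterKernel h) :
    ∫⁻ z : Fin j → Rd d, ENNReal.ofReal (h (Fin.cons 0 z)) ≠ ∞ := by
  obtain ⟨L, hL, hhL⟩ := hh.dist_le
  refine ne_of_lt (lt_of_le_of_lt (b := volume (Metric.closedBall (0 : Fin j → Rd d) L)) ?_
    measure_closedBall_lt_top)
  rw [← lintegral_indicator_one Metric.isClosed_closedBall.measurableSet]
  refine lintegral_mono fun z => ?_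
  by_cases hz : h (Fin.cons 0 z) = 0
  · simp [hz]
  · have : z ∈ Metric.closedBall (0 : Fin j → Rd d) L := by
      rw [mem_closedBall_zero_iff, pi_norm_le_iff_of_nonneg hL.le]
      intro i
      simpa using hhL _ hz i.succ 0
    rw [indicator_of_mem this]
    exact ENNReal.ofReal_le_one.2 (hh.le_one _)

theorem IsTestFunction.lintegral_diag_ne_top {d : ℕ} {ι : Type*} [Nonempty ι]
    {φ : (ι → Rd d) → ℝ} (hφ : IsTestFunction φ) {p : ℝ} (hp : (d : ℝ) < p) :
    ∫⁻ x : Rd d, ENNReal.ofReal (φ (fun _ => x) * ‖x‖ ^ (-p)) ≠ ∞ := by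
  obtain ⟨B, hB⟩ := hφ.bounded
  obtain ⟨δ, hδ, hφδ⟩ := hφ.eq_zero
  have hS : MeasurableSet {x : Rd d | δ ≤ ‖x‖} := measurableSet_le measurable_const measurable_norm
  refine ne_of_lt (lt_of_le_of_lt (b := ENNReal.ofReal B *
    ∫⁻ x in {x : Rd d | δ ≤ ‖x‖}, ENNReal.ofReal (‖x‖ ^ (-p))) ?_
    (ENNReal.mul_lt_top ENNReal.ofReal_lt_top (lintegral_rpow_norm_lt_top hp hδ)))
  rw [← lintegral_indicator hS, ← lintegral_const_mul' _ _ ENNReal.ofReal_ne_top]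
  refine lintegral_mono fun x => ?_
  by_cases hx : δ ≤ ‖x‖
  · rw [indicator_of_mem (show x ∈ {x : Rd d | δ ≤ ‖x‖} from hx),
      ← ENNReal.ofReal_mul ((hφ.nonneg _).trans (hB fun _ => x))]
    exact ENNReal.ofReal_le_ofReal (mul_le_mul_of_nonneg_right (hB _) (by positivity))
  · rw [hφδ (fun _ => x) (Classical.arbitrary ι) (not_le.1 hx)]
    simp

/-- The indicator of `{min |y_i| ≥ a}`. -/
noncomputable def minIndicator {d : ℕ} {ι : Type*} (a : ℝ) : (ι → Rd d) → ℝ :=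
  {y | ∀ i, a ≤ ‖y i‖}.indicator 1

theorem minIndicator_eq_one {d : ℕ} {ι : Type*} {a : ℝ} {y : ι → Rd d} (h : ∀ i, a ≤ ‖y i‖) :
    minIndicator a y = 1 :=
  indicator_of_mem (show y ∈ {y : ι → Rd d | ∀ i, a ≤ ‖y i‖} from h) 1

theorem minIndicator_eq_zero {d : ℕ} {ι : Type*} {a : ℝ} {y : ι → Rd d} (h : ¬∀ i, a ≤ ‖y i‖) :
    minIndicator a y = 0 :=
  indicator_of_notMem (show y ∉ {y : ι → Rd d | ∀ i, a ≤ ‖y i‖} from h) 1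

theorem minIndicator_congr {d : ℕ} {ι : Type*} {a b : ℝ} {y z : ι → Rd d}
    (h : (∀ i, a ≤ ‖y i‖) ↔ ∀ i, b ≤ ‖z i‖) : minIndicator a y = minIndicator b z := by
  by_cases hz : ∀ i, b ≤ ‖z i‖
  · rw [minIndicator_eq_one hz, minIndicator_eq_one (h.2 hz)]
  · rw [minIndicator_eq_zero hz, minIndicator_eq_zero fun hy => hz (h.1 hy)]

theorem isTestFunction_minIndicator {d : ℕ} (hd : 1 ≤ d) {ι : Type*} [Fintype ι] {a : ℝ}
    (ha : 0 < a) : IsTestFunction (minIndicator (d := d) (ι := ι) a) where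
  measurable := by
    refine measurable_one.indicator ?_
    have : {y : ι → Rd d | ∀ i, a ≤ ‖y i‖} = ⋂ i, {y | a ≤ ‖y i‖} := by
      ext y
      simp
    rw [this]
    exact MeasurableSet.iInter fun i =>
      measurableSet_le measurable_const (measurable_pi_apply i).norm
  nonneg y := indicator_nonneg (fun _ _ => zero_le_one) y
  bounded := ⟨1, fun y => indicator_le_self' (fun _ _ => zero_le_one) y⟩
  eq_zero := ⟨a, ha, fun y i hi => minIndicator_eq_zero fun h => (h i).not_gt hi⟩
  continuousAt := by
    have hnt : Nontrivial (Rd d) := by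
      have : Nonempty (Fin d) := ⟨⟨0, hd⟩⟩
      infer_instance
    have h0 := Measure.addHaar_sphere (volume : Measure (Rd d)) 0 a
    have h1 : ∀ᵐ x : Rd d, ‖x‖ ≠ a := by
      rw [ae_iff]
      refine measure_mono_null (fun x hx => ?_) h0
      simpa using hx
    filter_upwards [h1] with x hx
    have hnorm : ∀ i : ι, Tendsto (fun y : ι → Rd d => ‖y i‖) (𝓝 fun _ => x) (𝓝 ‖x‖) := fun i =>
      ((continuous_apply i).norm.tendsto _)
    rcases lt_or_gt_of_ne hx with hlt | hgt
    · rcases isEmpty_or_nonempty ι with hι | ⟨⟨i⟩⟩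
      · exact continuous_of_discreteTopology.continuousAt
      · refine (continuousAt_const (y := (0 : ℝ))).congr ?_
        filter_upwards [(hnorm i).eventually_lt_const hlt] with y hy
        exact (minIndicator_eq_zero fun h => (h i).not_gt hy).symm
    · refine (continuousAt_const (y := (1 : ℝ))).congr ?_
      filter_upwards [eventually_all.2 fun i => (hnorm i).eventually_const_lt hgt] with y hy
      exact (minIndicator_eq_one fun i => (hy i).le).symm

open scoped Classical in
/-- The indicator that all the points are within distance `D` of the first one. -/
noncomputable def nearIndicator {d j : ℕ} (D : ℝ) (y : Fin (j + 1) → Rd d) : ℝ :=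
  if ∀ i, dist (y i) (y 0) ≤ D then 1 else 0

theorem isClusterKernel_nearIndicator {d j : ℕ} {D : ℝ} (hD : 0 < D) :
    IsClusterKernel (nearIndicator (d := d) (j := j) D) where
  measurable := by
    refine Measurable.ite ?_ measurable_const measurable_const
    have : {y : Fin (j + 1) → Rd d | ∀ i, dist (y i) (y 0) ≤ D} =
        ⋂ i, {y | dist (y i) (y 0) ≤ D} := by
      ext y
      simp
    rw [this]
    exact MeasurableSet.iInter fun i =>
      measurableSet_le ((measurable_pi_apply i).dist (measurable_pi_apply 0)) measurable_const
  nonneg y := by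
    unfold nearIndicator
    split_ifs <;> norm_num
  le_one y := by
    unfold nearIndicator
    split_ifs <;> norm_num
  translation x y := by simp [nearIndicator]
  dist_le := by
    refine ⟨2 * D, by linarith, fun y hy i i' => ?_⟩
    have h : ∀ i, dist (y i) (y 0) ≤ D := by
      by_contra hne
      exact hy (if_neg hne)
    have := dist_triangle_right (y i) (y i') (y 0)
    linarith [h i, h i']

section LLN

variable {d : ℕ} {α : ℝ} {f : Rd d → ℝ} {F : ℝ → ℝ}

/-- The integral of a cluster functional against the factorial moment measure of the Poisson
process. -/
theorem lintegral_pi_cluster (hF : IsRegularlyVarying α F) (hfF : ∀ x, f x = F ‖x‖) (n : ℕ)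
    [SigmaFinite ((volume : Measure (Rd d)).withDensity fun x => ENNReal.ofReal (n * f x))] {j : ℕ}
    {g : (Fin (j + 1) → Rd d) → ℝ} (hgm : Measurable g) :
    ∫⁻ y, ENNReal.ofReal (g y) ∂(Measure.pi fun _ : Fin (j + 1) =>
        (volume : Measure (Rd d)).withDensity fun x => ENNReal.ofReal (n * f x)) =
      ENNReal.ofReal ((n : ℝ) ^ (j + 1)) * ∫⁻ y, ENNReal.ofReal (g y * ∏ i, F ‖y i‖) := by
  have hf : Measurable f := by
    have : f = fun x => F ‖x‖ := funext hfF
    rw [this]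
    exact hF.measurable.comp measurable_norm
  have hd : Measurable fun x => ENNReal.ofReal (n * f x) :=
    ENNReal.measurable_ofReal.comp (hf.const_mul _)
  have hdm : Measurable fun y : Fin (j + 1) → Rd d => ∏ i, ENNReal.ofReal (n * f (y i)) :=
    Finset.measurable_fun_prod _ fun i _ => hd.comp (measurable_pi_apply i)
  have hpm : Measurable fun y : Fin (j + 1) → Rd d =>
      ENNReal.ofReal (g y * ∏ i, F ‖y i‖) := by
    refine ENNReal.measurable_ofReal.comp (hgm.mul ?_)
    exact Finset.measurable_fun_prod _ fun i _ => hF.measurable.comp (measurable_pi_apply i).norm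
  have hgm' : Measurable fun y => ENNReal.ofReal (g y) := ENNReal.measurable_ofReal.comp hgm
  rw [pi_withDensity hd, lintegral_withDensity_eq_lintegral_mul _ hdm hgm',
    ← lintegral_const_mul _ hpm]
  refine lintegral_congr fun y => ?_
  simp only [Pi.mul_apply]
  rw [← ENNReal.ofReal_prod_of_nonneg fun i _ => mul_nonneg n.cast_nonneg
    (by rw [hfF]; exact hF.nonneg _), ← ENNReal.ofReal_mul, ← ENNReal.ofReal_mul (by positivity)]
  · congr 1
    rw [Finset.prod_mul_distrib, Finset.prod_const, Finset.card_univ, Fintype.card_fin]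
    simp_rw [hfF]
    ring
  · exact Finset.prod_nonneg fun i _ => mul_nonneg n.cast_nonneg (by rw [hfF]; exact hF.nonneg _)

variable {Ω : Type*} [MeasurableSpace Ω] {P : Measure Ω} {N : ℕ → Ω → Finset (Rd d)}
  {r : ℕ → ℝ} {m : ℕ → ℕ}

/-- Asymptotics of the first moments of cluster sums, with a normalization `b`. -/
theorem tendsto_mul_lintegral_pi_cluster (hα : (d : ℝ) < α) (hF : IsRegularlyVarying α F)
    (hfF : ∀ x, f x = F ‖x‖)
    (hfin : ∀ n : ℕ, 1 ≤ n → IsFiniteMeasure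
      ((volume : Measure (Rd d)).withDensity fun x => ENNReal.ofReal (n * f x)))
    (hr : Tendsto r atTop atTop) {j : ℕ} {h : (Fin (j + 1) → Rd d) → ℝ} (hh : IsClusterKernel h)
    {φ : (Fin (j + 1) → Rd d) → ℝ} (hφ : IsTestFunction φ) {b : ℕ → ℝ} (hb : ∀ n, 0 ≤ b n) {c : ℝ}
    (hc : Tendsto (fun n => b n * ((n : ℝ) ^ (j + 1) * (r n ^ d * F (r n) ^ (j + 1)))) atTop
      (𝓝 c)) :
    Tendsto (fun n => ENNReal.ofReal (b n) * ∫⁻ y, ENNReal.ofReal (h y * φ ((r n)⁻¹ • y))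
        ∂(Measure.pi fun _ : Fin (j + 1) =>
          (volume : Measure (Rd d)).withDensity fun x => ENNReal.ofReal (n * f x))) atTop
      (𝓝 (ENNReal.ofReal c *
        ((∫⁻ x : Rd d, ENNReal.ofReal (φ (fun _ => x) * ‖x‖ ^ (-(α * (j + 1 : ℕ))))) *
          ∫⁻ z : Fin j → Rd d, ENNReal.ofReal (h (Fin.cons 0 z))))) := by
  have hp : (d : ℝ) < α * (j + 1 : ℕ) := by
    have h1 : (1 : ℝ) ≤ (j + 1 : ℕ) := by exact_mod_cast Nat.succ_le_succ (Nat.zero_le j)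
    have h0 : (0 : ℝ) ≤ d := Nat.cast_nonneg d
    nlinarith
  have h1 := (tendsto_lintegral_cluster hα hF hh hφ).comp hr
  have hfinite := ENNReal.mul_ne_top (hφ.lintegral_diag_ne_top hp) hh.lintegral_cons_ne_top
  have h2 := ENNReal.Tendsto.mul (ENNReal.tendsto_ofReal hc) (Or.inr hfinite) h1
    (Or.inr ENNReal.ofReal_ne_top)
  refine h2.congr' ?_
  filter_upwards [eventually_ge_atTop 1, hr.eventually_gt_atTop 0, hr.eventually hF.eventually_pos]
    with n hn hrn hFn
  have := hfin n hn
  have hgm : Measurable fun y => h y * φ ((r n)⁻¹ • y) :=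
    hh.measurable.mul (hφ.measurable.comp (measurable_const_smul _))
  rw [lintegral_pi_cluster hF hfF n hgm, ENNReal.ofReal_mul (hb n),
    ENNReal.ofReal_mul (by positivity), mul_assoc, mul_assoc]
  congr 2
  exact ENNReal.mul_div_cancel (by simpa using by positivity) ENNReal.ofReal_ne_top

theorem indicator_anchoredTuples_eq {j : ℕ} {δ D s : ℝ} (hs : 0 < s)
    (y : Fin (j + 1) → Rd d) :
    (anchoredTuples j {x : Rd d | δ * s ≤ ‖x‖} D).indicator
      (1 : (Fin (j + 1) → Rd d) → ℝ≥0∞) y =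
      ENNReal.ofReal (nearIndicator D y * minIndicator δ (s⁻¹ • y)) := by
  classical
  have h1 : (∀ i, δ ≤ ‖(s⁻¹ • y) i‖) ↔ ∀ i, δ * s ≤ ‖y i‖ := by
    refine forall_congr' fun i => ?_
    rw [Pi.smul_apply, norm_smul, norm_inv, Real.norm_of_nonneg hs.le, inv_mul_eq_div,
      le_div_iff₀ hs]
  have h2 : y ∈ anchoredTuples j {x : Rd d | δ * s ≤ ‖x‖} D ↔
      (∀ i, dist (y i) (y 0) ≤ D) ∧ ∀ i, δ * s ≤ ‖y i‖ := by
    simp only [anchoredTuples, mem_ofPred_eq, forall_and]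
    exact and_comm
  rw [indicator_apply, h2, nearIndicator, minIndicator_congr h1]
  by_cases hb : ∀ i, δ * s ≤ ‖y i‖
  · by_cases ha : ∀ i, dist (y i) (y 0) ≤ D <;> simp [ha, hb, minIndicator_eq_one hb]
  · simp [hb, minIndicator_eq_zero hb]

/-- The law of large numbers for cluster sums. -/
theorem tendstoInMeasure_clusterSum [IsProbabilityMeasure P] (hd : 1 ≤ d) (hα : (d : ℝ) < α)
    (hF : IsRegularlyVarying α F) (hfF : ∀ x, f x = F ‖x‖)
    (hN : ∀ n : ℕ, 1 ≤ n →
      IsPoissonProcess P (volume.withDensity fun x => ENNReal.ofReal (n * f x)) (N n))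
    (hm_pos : ∀ n, 0 < m n) (hm : Tendsto m atTop atTop) (hr : Tendsto r atTop atTop) {j : ℕ}
    {a : ℝ} (ha : Tendsto (fun n : ℕ => ((n : ℝ) / m n) ^ (j + 1) * r n ^ d * F (r n) ^ (j + 1))
      atTop (𝓝 a))
    {h : (Fin (j + 1) → Rd d) → ℝ} (hh : IsClusterKernel h)
    {φ : (Fin (j + 1) → Rd d) → ℝ} (hφ : IsTestFunction φ) :
    TendstoInMeasure P (fun n ω => ((m n : ℝ) ^ (j + 1))⁻¹ *
        ∑ y ∈ injTuples (Fin (j + 1)) (N n ω), h y * φ ((r n)⁻¹ • y)) atTop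
      fun _ => (ENNReal.ofReal a *
        ((∫⁻ x : Rd d, ENNReal.ofReal (φ (fun _ => x) * ‖x‖ ^ (-(α * (j + 1 : ℕ))))) *
          ∫⁻ z : Fin j → Rd d, ENNReal.ofReal (h (Fin.cons 0 z)))).toReal := by
  have hp : ∀ l : ℕ, (d : ℝ) < α * (l + 1 : ℕ) := by
    intro l
    have h1 : (1 : ℝ) ≤ (l + 1 : ℕ) := by exact_mod_cast Nat.succ_le_succ (Nat.zero_le l)
    have h0 : (0 : ℝ) ≤ d := Nat.cast_nonneg d
    nlinarith
  have hfin : ∀ n : ℕ, 1 ≤ n → IsFiniteMeasure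
      ((volume : Measure (Rd d)).withDensity fun x => ENNReal.ofReal (n * f x)) := fun n hn =>
    (hN n hn).isFiniteMeasure
  have hdm : ∀ n : ℕ, Measurable fun x : Rd d => ENNReal.ofReal (n * f x) := by
    intro n
    simp_rw [hfF]
    exact ENNReal.measurable_ofReal.comp ((hF.measurable.comp measurable_norm).const_mul _)
  obtain ⟨L, hL, hhL⟩ := hh.dist_le
  obtain ⟨B, hB⟩ := hφ.bounded
  obtain ⟨δ, hδ, hφδ⟩ := hφ.eq_zero
  have hmR : Tendsto (fun n => ((m n : ℝ) ^ (j + 1))⁻¹) atTop (𝓝 0) :=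
    ((tendsto_pow_atTop (Nat.succ_ne_zero j)).comp
      (tendsto_natCast_atTop_atTop.comp hm)).inv_tendsto_atTop
  have hmpos : ∀ n, 0 < (m n : ℝ) := fun n => by exact_mod_cast hm_pos n
  let g : ℕ → (Fin (j + 1) → Rd d) → ℝ := fun n y => h y * φ ((r n)⁻¹ • y)
  have hgm : ∀ n, Measurable (g n) := fun n =>
    hh.measurable.mul (hφ.measurable.comp (measurable_const_smul _))
  have hg0 : ∀ n y, 0 ≤ g n y := fun n y => mul_nonneg (hh.nonneg _) (hφ.nonneg _)
  let Λ : ℕ → Measure (Rd d) := fun n => volume.withDensity fun x => ENNReal.ofReal (n * f x)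
  have hcamp : ∀ n, 1 ≤ n → CampbellFormula P (Λ n) (N n) fun y => ENNReal.ofReal (g n y) := by
    intro n hn
    have := hfin n hn
    exact (hN n hn).campbellFormula (ae_pi_injective hd (hdm n) _)
      (ENNReal.measurable_ofReal.comp (hgm n))
  have hX : ∀ n ω, ENNReal.ofReal (((m n : ℝ) ^ (j + 1))⁻¹ *
      ∑ y ∈ injTuples (Fin (j + 1)) (N n ω), g n y) = ENNReal.ofReal (((m n : ℝ) ^ (j + 1))⁻¹) *
        ∑ y ∈ injTuples (Fin (j + 1)) (N n ω), ENNReal.ofReal (g n y) := by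
    intro n ω
    rw [ENNReal.ofReal_mul (by positivity), ENNReal.ofReal_sum_of_nonneg fun y _ => hg0 n y]
  have hmean : ∀ n, 1 ≤ n → ∫⁻ ω, ENNReal.ofReal (((m n : ℝ) ^ (j + 1))⁻¹ *
      ∑ y ∈ injTuples (Fin (j + 1)) (N n ω), g n y) ∂P = ENNReal.ofReal (((m n : ℝ) ^ (j + 1))⁻¹) *
        ∫⁻ y, ENNReal.ofReal (g n y) ∂(Measure.pi fun _ => Λ n) := by
    intro n hn
    simp_rw [hX]
    rw [lintegral_const_mul _ (hcamp n hn).1, (hcamp n hn).2]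
  -- the numbers of clusters of `l + 1` points that control the variance
  let κ : ∀ l : ℕ, ℕ → ℝ≥0∞ := fun l n =>
    (Measure.pi fun _ => Λ n) (anchoredTuples l {x : Rd d | δ * r n ≤ ‖x‖} (2 * L))
  have hU : ∀ n, MeasurableSet {x : Rd d | δ * r n ≤ ‖x‖} := fun n =>
    measurableSet_le measurable_const measurable_norm
  have hκ : ∀ l : ℕ, Tendsto (fun n => (((m n : ℝ) ^ (j + 1))⁻¹) ^ 2 *
      ((n : ℝ) ^ (l + 1) * (r n ^ d * F (r n) ^ (l + 1)))) atTop (𝓝 0) →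
      Tendsto (fun n => ENNReal.ofReal (((m n : ℝ) ^ (j + 1))⁻¹) ^ 2 * κ l n) atTop (𝓝 0) := by
    intro l hl
    have h1 := tendsto_mul_lintegral_pi_cluster hα hF hfF hfin hr
      (isClusterKernel_nearIndicator (d := d) (j := l) (D := 2 * L) (by linarith))
      (isTestFunction_minIndicator hd hδ) (fun n => by positivity) hl
    rw [ENNReal.ofReal_zero, zero_mul] at h1
    refine h1.congr' ?_
    filter_upwards [hr.eventually_gt_atTop 0] with n hrn
    rw [ENNReal.ofReal_pow (by positivity)]
    congr 1
    simp only [κ]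
    rw [← lintegral_indicator_one (measurableSet_anchoredTuples l (hU n) _)]
    exact lintegral_congr fun y => (indicator_anchoredTuples_eq hrn y).symm
  -- `n ^ (j + 1) r ^ d F(r) ^ (j + 1)` is of order `m ^ (j + 1)`
  have hκ1 := hκ j (by
    have h1 := hmR.mul ha
    rw [zero_mul] at h1
    refine h1.congr fun n => ?_
    have := hmpos n
    rw [div_pow]
    field_simp)
  -- squaring the hypothesis `ha` produces one factor `r ^ d` too many, which tends to infinity
  have hκ2 := hκ (2 * j + 1) (by
    have hrd : Tendsto (fun n => (r n ^ d)⁻¹) atTop (𝓝 0) :=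
      ((tendsto_pow_atTop (by omega)).comp hr).inv_tendsto_atTop
    have h1 := (ha.pow 2).mul hrd
    rw [mul_zero] at h1
    refine h1.congr' ?_
    filter_upwards [hr.eventually_gt_atTop 0] with n hrn
    have := hmpos n
    have h2 : 2 * j + 1 + 1 = (j + 1) * 2 := by ring
    rw [h2]
    simp only [pow_mul, div_pow]
    field_simp)
  let Cst : ℝ≥0∞ := ENNReal.ofReal B ^ 2 * (4 * j + 2) ^ (2 * j + 1)
  have hCst : Cst ≠ ∞ := ENNReal.mul_ne_top (ENNReal.pow_ne_top ENNReal.ofReal_ne_top)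
    (ENNReal.pow_ne_top (by finiteness))
  have he := ENNReal.Tendsto.const_mul (a := Cst) (hκ1.add hκ2) (Or.inr hCst)
  rw [add_zero, mul_zero] at he
  have hlim := tendsto_mul_lintegral_pi_cluster hα hF hfF hfin hr hh hφ
    (b := fun n => ((m n : ℝ) ^ (j + 1))⁻¹) (fun n => by positivity) (c := a) (by
      refine ha.congr fun n => ?_
      rw [div_pow]
      ring)
  refine tendstoInMeasure_of_lintegral_sq_le (fun n ω => mul_nonneg (by positivity)
    (Finset.sum_nonneg fun y _ => hg0 n y)) ?_ (ENNReal.mul_ne_top ENNReal.ofReal_ne_top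
      (ENNReal.mul_ne_top (hφ.lintegral_diag_ne_top (hp j)) hh.lintegral_cons_ne_top)) ?_ he ?_
  · filter_upwards [eventually_ge_atTop 1] with n hn
    refine Measurable.const_mul ?_ _
    have h1 : (fun ω => ∑ y ∈ injTuples (Fin (j + 1)) (N n ω), g n y) = fun ω =>
        (∑ y ∈ injTuples (Fin (j + 1)) (N n ω), ENNReal.ofReal (g n y)).toReal := by
      ext ω
      rw [← ENNReal.ofReal_sum_of_nonneg fun y _ => hg0 n y,
        ENNReal.toReal_ofReal (Finset.sum_nonneg fun y _ => hg0 n y)]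
    exact h1 ▸ (hcamp n hn).1.ennreal_toReal
  · refine hlim.congr' ?_
    filter_upwards [eventually_ge_atTop 1] with n hn
    exact (hmean n hn).symm
  · filter_upwards [eventually_ge_atTop 1, hr.eventually_gt_atTop 0] with n hn hrn
    have := hfin n hn
    have hgB : ∀ y, ENNReal.ofReal (g n y) ≤ ENNReal.ofReal B := by
      intro y
      refine ENNReal.ofReal_le_ofReal ?_
      calc g n y ≤ 1 * B := mul_le_mul (hh.le_one _) (hB _) (hφ.nonneg _) zero_le_one
        _ = B := one_mul B
    have hgsupp : ∀ y, ENNReal.ofReal (g n y) ≠ 0 →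
        (∀ i, y i ∈ {x : Rd d | δ * r n ≤ ‖x‖}) ∧ ∀ i i', dist (y i) (y i') ≤ L := by
      intro y hy
      have hy' : g n y ≠ 0 := fun h0 => hy (by rw [h0, ENNReal.ofReal_zero])
      obtain ⟨hy1, hy2⟩ := mul_ne_zero_iff.1 hy'
      refine ⟨fun i => ?_, hhL y hy1⟩
      by_contra hlt
      refine hy2 (hφδ _ i ?_)
      rw [mem_ofPred_eq, not_le] at hlt
      rwa [Pi.smul_apply, norm_smul, norm_inv, Real.norm_of_nonneg hrn.le, inv_mul_eq_div,
        div_lt_iff₀ hrn]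
    have hsq := (hN n hn).lintegral_sq_le (fun ι _ => ae_pi_injective hd (hdm n) ι) (hU n) hL.le
      (ENNReal.measurable_ofReal.comp (hgm n)) hgB hgsupp
    rw [hmean n hn]
    simp_rw [hX, mul_pow]
    rw [lintegral_const_mul _ ((hcamp n hn).1.pow_const 2)]
    refine (mul_le_mul_right hsq _).trans (le_of_eq ?_)
    simp only [Cst, κ, Function.comp, Λ]
    ring

end LLN

/-! ### Order statistics and counts of subsets -/

theorem le_getD_iff_lt_countP {l : List ℝ} (hl : l.Pairwise (· ≥ ·)) {a : ℝ} (ha : 0 < a) (i : ℕ) :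
    a ≤ l.getD i 0 ↔ i < l.countP (fun x => decide (a ≤ x)) := by
  induction l generalizing i with
  | nil => simpa using ha
  | cons x l ih =>
    rw [List.pairwise_cons] at hl
    by_cases hx : a ≤ x
    · rw [List.countP_cons_of_pos (by simpa using hx)]
      cases i with
      | zero => simp [hx]
      | succ i => rw [List.getD_cons_succ, ih hl.2]; omega
    · rw [List.countP_cons_of_neg (by simpa using hx)]
      have h0 : l.countP (fun x => decide (a ≤ x)) = 0 := by
        rw [List.countP_eq_zero]
        intro z hz hz'
        exact hx ((by simpa using hz' : a ≤ z).trans (hl.1 z hz))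
      cases i with
      | zero => simp [hx, h0]
      | succ i => rw [List.getD_cons_succ, ih hl.2]; omega

open scoped Classical in
theorem le_orderStat_iff {d k : ℕ} (h : (Fin k → Rd d) → ℝ) (M : Finset (Rd d)) {i : ℕ}
    (hi : 0 < i) {a : ℝ} (ha : 0 < a) :
    a ≤ orderStat h M i ↔ i ≤ ((M.powersetCard k).filter fun Y => a ≤ layerValue h Y).card := by
  have h1 : (((M.powersetCard k).val.map (layerValue h)).sort (· ≥ ·)).countP
      (fun x => decide (a ≤ x)) = ((M.powersetCard k).filter fun Y => a ≤ layerValue h Y).card := by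
    rw [← Multiset.coe_countP, Multiset.sort_eq, Multiset.countP_map, Finset.card_def,
      Finset.filter_val]
  rw [orderStat, le_getD_iff_lt_countP (Multiset.pairwise_sort _ _) ha, h1]
  omega

/-- A symmetric function of `k`-tuples takes each value `k!` times on the enumerations of a
`k`-point set. -/
theorem sum_injTuples_eq_factorial_mul {X : Type*} [DecidableEq X] (M : Finset X) {k : ℕ}
    {q : (Fin k → X) → ℝ} {c : Finset X → ℝ}
    (hq : ∀ (Y : Finset X) (hY : Y.card = k) (σ : Equiv.Perm (Fin k)),
      q (fun i => ((Y.equivFinOfCardEq hY).symm (σ i) : X)) = c Y) :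
    ∑ y ∈ injTuples (Fin k) M, q y = k.factorial * ∑ Y ∈ M.powersetCard k, c Y := by
  have hmaps : ∀ y ∈ injTuples (Fin k) M, Finset.univ.image y ∈ M.powersetCard k := by
    intro y hy
    rw [mem_injTuples] at hy
    rw [Finset.mem_powersetCard]
    refine ⟨fun x hx => ?_, ?_⟩
    · obtain ⟨i, -, rfl⟩ := Finset.mem_image.1 hx
      exact hy.1 i
    · rw [Finset.card_image_of_injective _ hy.2, Finset.card_univ, Fintype.card_fin]
  rw [← Finset.sum_fiberwise_of_maps_to hmaps, Finset.mul_sum]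
  refine Finset.sum_congr rfl fun Y hY => ?_
  obtain ⟨hYM, hYk⟩ := Finset.mem_powersetCard.1 hY
  let e := (Y.equivFinOfCardEq hYk).symm
  have hfib : (injTuples (Fin k) M).filter (fun y => Finset.univ.image y = Y) =
      Finset.univ.image fun σ : Equiv.Perm (Fin k) => fun i => (e (σ i) : X) := by
    ext y
    simp only [Finset.mem_filter, mem_injTuples, Finset.mem_image, Finset.mem_univ, true_and]
    constructor
    · rintro ⟨⟨-, hinj⟩, himg⟩
      have hmem : ∀ i, y i ∈ Y := fun i =>
        himg ▸ Finset.mem_image_of_mem y (Finset.mem_univ i)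
      have hσ : Function.Injective fun i => e.symm ⟨y i, hmem i⟩ := fun i i' hii =>
        hinj (congrArg Subtype.val (e.symm.injective hii))
      refine ⟨Equiv.ofBijective _ (Finite.injective_iff_bijective.1 hσ), ?_⟩
      ext i
      simp
    · rintro ⟨σ, rfl⟩
      have hinj : Function.Injective fun i => (e (σ i) : X) :=
        Subtype.val_injective.comp (e.injective.comp σ.injective)
      refine ⟨⟨fun i => hYM (e (σ i)).2, hinj⟩, ?_⟩
      refine Finset.eq_of_subset_of_card_le (fun x hx => ?_) ?_
      · obtain ⟨i, -, rfl⟩ := Finset.mem_image.1 hx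
        exact (e (σ i)).2
      · rw [Finset.card_image_of_injective _ hinj, Finset.card_univ, Fintype.card_fin, hYk]
  rw [hfib, Finset.sum_image]
  · rw [Finset.sum_congr rfl fun σ _ => hq Y hYk σ, Finset.sum_const, Finset.card_univ,
      Fintype.card_perm, Fintype.card_fin, nsmul_eq_mul]
  · intro σ _ τ _ hστ
    ext i
    exact congrArg Fin.val (e.injective (Subtype.val_injective (congrFun hστ i)))

open scoped Classical in
theorem factorial_mul_card_layerValue_ge {d k : ℕ} (hk : 1 ≤ k) {h : (Fin k → Rd d) → ℝ}
    (hh : IsGeometricConstraint d k h) (M : Finset (Rd d)) {a : ℝ} (ha : 0 < a) :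
    (k.factorial : ℝ) * ((M.powersetCard k).filter fun Y => a ≤ layerValue h Y).card =
      ∑ y ∈ injTuples (Fin k) M, h y * minIndicator a y := by
  have hne : Nonempty (Fin k) := ⟨⟨0, hk⟩⟩
  rw [sum_injTuples_eq_factorial_mul M (c := fun Y => if a ≤ layerValue h Y then 1 else 0)]
  · rw [Finset.sum_boole]
  · intro Y hY σ
    rw [layerValue, dif_pos hY]
    set y : Fin k → Rd d := fun i => ((Y.equivFinOfCardEq hY).symm i : Rd d) with hy
    have h1 : (fun i => ((Y.equivFinOfCardEq hY).symm (σ i) : Rd d)) = y ∘ σ := rfl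
    rw [h1, hh.perm]
    have h2 : minIndicator a (y ∘ σ) = minIndicator a y := by
      have : (∀ i, a ≤ ‖(y ∘ σ) i‖) ↔ ∀ i, a ≤ ‖y i‖ := σ.forall_congr_right (q := (a ≤ ‖y ·‖))
      exact minIndicator_congr this
    rw [h2]
    rcases hh.zero_or_one y with h0 | h0
    · simp [h0, ha]
    · have h3 : a ≤ ⨅ i, ‖y i‖ ↔ ∀ i, a ≤ ‖y i‖ :=
        le_ciInf_iff (Set.finite_range _).bddBelow
      rw [h0, one_mul, one_mul]
      by_cases hy : ∀ i, a ≤ ‖y i‖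
      · rw [minIndicator_eq_one hy, if_pos (h3.2 hy)]
      · rw [minIndicator_eq_zero hy, if_neg fun h => hy (h3.1 h)]

/-- The order statistic `U_k(i)` is at least `a r` exactly when the layered measure, scaled by `r`,
gives the set `{min |y_i| ≥ a}` mass at least `i`. -/
theorem le_orderStat_iff_le_sum {d k : ℕ} (hk : 1 ≤ k) {h : (Fin k → Rd d) → ℝ}
    (hh : IsGeometricConstraint d k h) (M : Finset (Rd d)) {i : ℕ} (hi : 0 < i) {a r : ℝ}
    (ha : 0 < a) (hr : 0 < r) :
    a * r ≤ orderStat h M i ↔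
      (k.factorial : ℝ) * i ≤ ∑ y ∈ injTuples (Fin k) M, h y * minIndicator a (r⁻¹ • y) := by
  have h1 : ∀ y : Fin k → Rd d, minIndicator a (r⁻¹ • y) = minIndicator (a * r) y := by
    intro y
    have : (∀ i, a ≤ ‖(r⁻¹ • y) i‖) ↔ ∀ i, a * r ≤ ‖y i‖ := by
      refine forall_congr' fun i => ?_
      rw [Pi.smul_apply, norm_smul, norm_inv, Real.norm_of_nonneg hr.le, inv_mul_eq_div,
        le_div_iff₀ hr]
    exact minIndicator_congr this
  simp_rw [h1]
  rw [le_orderStat_iff h M hi (mul_pos ha hr), ← factorial_mul_card_layerValue_ge hk hh M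
    (mul_pos ha hr), mul_le_mul_iff_right₀ (by positivity), Nat.cast_le]

/-! ### Normalization -/

theorem isClusterKernel_of_isGeometricConstraint {d j : ℕ} {h : (Fin (j + 1) → Rd d) → ℝ}
    (hh : IsGeometricConstraint d (j + 1) h) : IsClusterKernel h where
  measurable := hh.measurable
  nonneg y := by rcases hh.zero_or_one y with h | h <;> simp [h]
  le_one y := by rcases hh.zero_or_one y with h | h <;> simp [h]
  translation := hh.translation
  dist_le := by
    obtain ⟨L, hL, hdiam⟩ := hh.diam
    refine ⟨L, hL, fun y hy i i' => ?_⟩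
    by_contra! hlt
    exact hy (hdiam y (hlt.trans_le (Metric.dist_le_diam_of_mem (finite_range y).isBounded
      (mem_range_self i) (mem_range_self i'))))

theorem layerConst_pow {d j : ℕ} {h : (Fin (j + 1) → Rd d) → ℝ} (hh : IsClusterKernel h) :
    layerConst (j + 1) h ^ (j + 1) = sphereArea d / (j + 1).factorial *
      (∫⁻ z : Fin j → Rd d, ENNReal.ofReal (h (Fin.cons 0 z))).toReal := by
  have hm : Measurable fun z : Fin j → Rd d => (Fin.cons 0 z : Fin (j + 1) → Rd d) := by
    refine measurable_pi_lambda _ fun i => ?_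
    refine Fin.cases ?_ (fun i => ?_) i
    · simp
    · simpa using measurable_pi_apply i
  rw [layerConst, integral_eq_lintegral_of_nonneg_ae (ae_of_all _ fun z => hh.nonneg _)
    (hh.measurable.comp hm).aestronglyMeasurable, ← Real.rpow_natCast, ← Real.rpow_mul]
  · rw [one_div_mul_cancel (by positivity), Real.rpow_one]
  · have : 0 ≤ sphereArea d := measureReal_nonneg
    positivity

/-- The integral `((α k - d) / s_{d-1}) ∫ φ (x, …, x) |x|^{-α k} dx` of a test function against
the limit measure. -/
noncomputable def limitFunctional {d k : ℕ} (α : ℝ) (φ : (Fin k → Rd d) → ℝ) : ℝ :=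
  (α * k - d) / sphereArea d *
    (∫⁻ x : Rd d, ENNReal.ofReal (φ (fun _ => x) * ‖x‖ ^ (-(α * k)))).toReal

/-- The integral `(1/k!) ∑ h(y) φ(y/r)` of a test function against the layered measure. -/
noncomputable def layerSum {d k : ℕ} (h φ : (Fin k → Rd d) → ℝ) (M : Finset (Rd d)) (r : ℝ) : ℝ :=
  1 / (k.factorial : ℝ) * ∑ y ∈ injTuples (Fin k) M, h y * φ (r⁻¹ • y)

theorem sphereArea_pos {d : ℕ} (hd : 1 ≤ d) : 0 < sphereArea d := by
  have hd' : (0 : ℝ) < d := by exact_mod_cast hd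
  rw [sphereArea, Measure.toSphere_real_apply_univ, finrank_euclideanSpace_fin]
  exact mul_pos hd' (ENNReal.toReal_pos (Metric.measure_ball_pos _ _ one_pos).ne'
    measure_ball_lt_top.ne)

/-- The radial profile of a spherically symmetric density with regularly varying tail. -/
theorem IsRadialRVDensity.exists_profile {d : ℕ} (hd : 1 ≤ d) {α : ℝ} {f : Rd d → ℝ}
    (hf : IsRadialRVDensity d α f) :
    ∃ F, IsRegularlyVarying α F ∧ (∀ x, f x = F ‖x‖) ∧
      ∃ θ : Rd d, ‖θ‖ = 1 ∧ ∀ t, F t = f (t • θ) := by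
  let θ : Rd d := EuclideanSpace.single ⟨0, hd⟩ 1
  have hθ : ‖θ‖ = 1 := by simp [θ]
  refine ⟨fun t => f (t • θ), ⟨hf.measurable.comp (measurable_id.smul_const θ),
    fun t => hf.nonneg _,
    hf.regularlyVarying θ hθ⟩, fun x => hf.radial _ _ ?_, θ, hθ, fun t => rfl⟩
  rw [norm_smul, hθ, norm_norm, mul_one]

theorem tendsto_const_mul_div {m : ℕ → ℕ} (hm_pos : ∀ n, 0 < m n)
    (hmn : Tendsto (fun n : ℕ => (m n : ℝ) / n) atTop (𝓝 0)) {C : ℝ} (hC : 0 < C) :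
    Tendsto (fun n : ℕ => C * n / m n) atTop atTop := by
  have h1 : Tendsto (fun n : ℕ => (m n : ℝ) / n) atTop (𝓝[>] 0) := by
    refine tendsto_nhdsWithin_iff.2 ⟨hmn, ?_⟩
    filter_upwards [eventually_ge_atTop 1] with n hn
    have h2 : (0 : ℝ) < n := by exact_mod_cast hn
    have h3 : (0 : ℝ) < m n := by exact_mod_cast hm_pos n
    exact div_pos h3 h2
  refine (h1.inv_tendsto_nhdsGT_zero.const_mul_atTop hC).congr fun n => ?_
  rw [Pi.inv_apply, inv_div, mul_div_assoc]

/-- The law of large numbers for the layered measures, in the normalization of the theorem. -/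
theorem tendstoInMeasure_layerSum {d j : ℕ} (hd : 1 ≤ d) {α : ℝ} (hα : (d : ℝ) < α)
    {f : Rd d → ℝ} (hf : IsRadialRVDensity d α f)
    {h : (Fin (j + 1) → Rd d) → ℝ} (hh : IsGeometricConstraint d (j + 1) h)
    (hC : 0 < layerConst (j + 1) h) {R : ℝ → ℝ} (hR : IsRadius d (j + 1) α f R)
    {m : ℕ → ℕ} (hm_pos : ∀ n, 0 < m n) (hm : Tendsto m atTop atTop)
    (hmn : Tendsto (fun n : ℕ => (m n : ℝ) / n) atTop (𝓝 0))
    {Ω : Type*} [MeasurableSpace Ω] {P : Measure Ω} [IsProbabilityMeasure P]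
    {N : ℕ → Ω → Finset (Rd d)}
    (hN : ∀ n : ℕ, 1 ≤ n →
      IsPoissonProcess P (volume.withDensity fun x => ENNReal.ofReal (n * f x)) (N n))
    {φ : (Fin (j + 1) → Rd d) → ℝ} (hφ : IsTestFunction φ) :
    TendstoInMeasure P (fun n ω => ((m n : ℝ) ^ (j + 1))⁻¹ *
        layerSum h φ (N n ω) (R (layerConst (j + 1) h * n / m n))) atTop
      fun _ => limitFunctional α φ := by
  obtain ⟨F, hF, hfF, θ, hθ, hFθ⟩ := hf.exists_profile hd
  have hK := isClusterKernel_of_isGeometricConstraint hh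
  set C := layerConst (j + 1) h with hCdef
  have ht := tendsto_const_mul_div hm_pos hmn hC
  have hr : Tendsto (fun n : ℕ => R (C * n / m n)) atTop atTop := hR.tendsto_atTop.comp ht
  have hq : 0 ≤ α * (j + 1 : ℕ) - d := by
    have h1 : (1 : ℝ) ≤ (j + 1 : ℕ) := by exact_mod_cast Nat.succ_le_succ (Nat.zero_le j)
    have h0 : (0 : ℝ) ≤ d := Nat.cast_nonneg d
    nlinarith
  have ha : Tendsto (fun n : ℕ => ((n : ℝ) / m n) ^ (j + 1) * R (C * n / m n) ^ d *
      F (R (C * n / m n)) ^ (j + 1)) atTop (𝓝 ((α * (j + 1 : ℕ) - d) / C ^ (j + 1))) := by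
    refine (((hR.asymptotic θ hθ).comp ht).div_const (C ^ (j + 1))).congr fun n => ?_
    simp only [Function.comp, ← hFθ]
    have h1 : (C * n / m n) ^ (j + 1) = C ^ (j + 1) * ((n : ℝ) / m n) ^ (j + 1) := by
      rw [mul_div_assoc, mul_pow]
    rw [h1]
    field_simp
  have key := tendstoInMeasure_clusterSum hd hα hF hfF hN hm_pos hm hr ha hK hφ
  rw [tendstoInMeasure_iff_norm] at key ⊢
  intro ε hε
  have hfac : (0 : ℝ) < (j + 1).factorial := by positivity
  refine (key ((j + 1).factorial * ε) (by positivity)).congr fun n => ?_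
  congr 1
  ext ω
  have hs := sphereArea_pos hd
  have hH : 0 < (∫⁻ z : Fin j → Rd d, ENNReal.ofReal (h (Fin.cons 0 z))).toReal := by
    have h1 := pow_pos hC (j + 1)
    rw [layerConst_pow hK] at h1
    exact pos_of_mul_pos_right h1 (by positivity)
  have h2 : ((j + 1).factorial : ℝ) * limitFunctional α φ =
      (ENNReal.ofReal ((α * (j + 1 : ℕ) - d) / C ^ (j + 1)) *
        ((∫⁻ x : Rd d, ENNReal.ofReal (φ (fun _ => x) * ‖x‖ ^ (-(α * (j + 1 : ℕ))))) *
          ∫⁻ z : Fin j → Rd d, ENNReal.ofReal (h (Fin.cons 0 z)))).toReal := by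
    rw [ENNReal.toReal_mul, ENNReal.toReal_mul, ENNReal.toReal_ofReal (by positivity),
      limitFunctional, hCdef, layerConst_pow hK]
    field_simp
  have h3 : ((m n : ℝ) ^ (j + 1))⁻¹ *
      ∑ y ∈ injTuples (Fin (j + 1)) (N n ω), h y * φ ((R (C * n / m n))⁻¹ • y) =
      (j + 1).factorial * (((m n : ℝ) ^ (j + 1))⁻¹ * layerSum h φ (N n ω) (R (C * n / m n))) := by
    rw [layerSum]
    field_simp
  rw [mem_ofPred_eq, mem_ofPred_eq, h3, ← h2, ← mul_sub, norm_mul, Real.norm_of_nonneg hfac.le,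
    mul_le_mul_iff_right₀ hfac]

/-- The normalization of the limit measure: the set `{min |y_i| ≥ a}` has measure
`a^(d - α k)`, which is `1` for `a = 1`. -/
theorem limitFunctional_minIndicator {d j : ℕ} (hd : 1 ≤ d) {α : ℝ} (hα : (d : ℝ) < α) {a : ℝ}
    (ha : 0 < a) :
    limitFunctional (d := d) (k := j + 1) α (minIndicator a) = a ^ ((d : ℝ) - α * (j + 1 : ℕ)) := by
  have hnt : Nontrivial (Rd d) := by
    have : Nonempty (Fin d) := ⟨⟨0, hd⟩⟩
    infer_instance
  set q := α * (j + 1 : ℕ) with hq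
  have hqd : (d : ℝ) < q := by
    have h1 : (1 : ℝ) ≤ (j + 1 : ℕ) := by exact_mod_cast Nat.succ_le_succ (Nat.zero_le j)
    have h0 : (0 : ℝ) ≤ d := Nat.cast_nonneg d
    rw [hq]
    nlinarith
  let u : ℝ → ℝ := (Ici a).indicator fun t => t ^ (-q)
  have hu : ∀ x : Rd d, minIndicator a (fun _ : Fin (j + 1) => x) * ‖x‖ ^ (-q) = u ‖x‖ := by
    intro x
    by_cases hx : a ≤ ‖x‖
    · rw [minIndicator_eq_one (y := fun _ : Fin (j + 1) => x) fun _ => hx, one_mul]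
      exact (indicator_of_mem (show ‖x‖ ∈ Ici a from hx) fun t : ℝ => t ^ (-q)).symm
    · rw [minIndicator_eq_zero (y := fun _ : Fin (j + 1) => x) fun h => hx (h 0), zero_mul]
      exact (indicator_of_notMem (show ‖x‖ ∉ Ici a from hx) fun t : ℝ => t ^ (-q)).symm
  have hum : Measurable u := Measurable.indicator (by fun_prop) measurableSet_Ici
  have hu0 : ∀ t, 0 ≤ u t := by
    intro t
    refine indicator_nonneg (fun s hs => ?_) t
    exact Real.rpow_nonneg (ha.le.trans hs) _
  have h1 : (∫⁻ x : Rd d, ENNReal.ofReal (minIndicator a (fun _ : Fin (j + 1) => x) *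
      ‖x‖ ^ (-q))).toReal = ∫ x : Rd d, u ‖x‖ := by
    simp_rw [hu]
    exact (integral_eq_lintegral_of_nonneg_ae (ae_of_all _ fun x => hu0 _)
      (hum.comp measurable_norm).aestronglyMeasurable).symm
  have h2 : ∫ y in Ioi (0 : ℝ), y ^ (d - 1) • u y = a ^ ((d : ℝ) - q) / (q - d) := by
    have h3 : ∀ y ∈ Ioi (0 : ℝ), y ^ (d - 1) • u y =
        (Ici a).indicator (fun t => t ^ ((d : ℝ) - 1 - q)) y := by
      intro y hy
      have hy' : 0 < y := hy
      by_cases hya : y ∈ Ici a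
      · simp only [u]
        rw [indicator_of_mem hya, indicator_of_mem hya, smul_eq_mul, ← Real.rpow_natCast,
          ← Real.rpow_add hy', Nat.cast_sub hd, Nat.cast_one]
        rfl
      · simp only [u]
        rw [indicator_of_notMem hya, indicator_of_notMem hya, smul_zero]
    rw [setIntegral_congr_fun measurableSet_Ioi h3, setIntegral_indicator measurableSet_Ici,
      inter_eq_right.2 (Ici_subset_Ioi.2 ha), integral_Ici_eq_integral_Ioi,
      integral_Ioi_rpow_of_lt (by linarith) ha]
    have h4 : (d : ℝ) - 1 - q + 1 = d - q := by ring
    rw [h4, ← neg_sub (d : ℝ) q, neg_div, div_neg]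
  have hs := sphereArea_pos hd
  have h5 : sphereArea d = d * (volume : Measure (Rd d)).real (Metric.ball 0 1) := by
    rw [sphereArea, Measure.toSphere_real_apply_univ, finrank_euclideanSpace_fin]
  rw [limitFunctional, ← hq, h1, integral_fun_norm_addHaar, finrank_euclideanSpace_fin, h2,
    smul_eq_mul, nsmul_eq_mul, ← mul_assoc (d : ℝ), ← h5]
  have : 0 < q - d := by linarith
  field_simp

/-! ### Vague convergence in probability -/

/-- Convergence in probability in the vague topology follows from convergence in probability of
the integrals of test functions, since a vague neighbourhood restricts finitely many integrals. -/
theorem tendstoInProbability_of_forall_integral {Ω X : Type*} [MeasurableSpace Ω]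
    [TopologicalSpace X] [MeasurableSpace X] {P : Measure Ω} {Y : ℕ → Ω → RadonMeasure X}
    {μ : RadonMeasure X}
    (h : ∀ φ : C_c(X, ℝ≥0), TendstoInMeasure P (fun n ω => ∫ x, (φ x : ℝ) ∂(Y n ω).1) atTop
      fun _ => ∫ x, (φ x : ℝ) ∂μ.1) :
    TendstoInProbability P Y μ := by
  intro U hU
  rw [nhds_induced, mem_comap] at hU
  obtain ⟨t, ht, htU⟩ := hU
  rw [nhds_pi, Filter.mem_pi] at ht
  obtain ⟨I, hI, s, hs, hst⟩ := ht
  have h1 : ∀ φ, Tendsto (fun n => P {ω | ∫ x, (φ x : ℝ) ∂(Y n ω).1 ∉ s φ}) atTop (𝓝 0) := by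
    intro φ
    obtain ⟨ε, hε, hball⟩ := Metric.mem_nhds_iff.1 (hs φ)
    refine tendsto_of_tendsto_of_tendsto_of_le_of_le tendsto_const_nhds
      (tendstoInMeasure_iff_dist.1 (h φ) ε hε) (fun _ => zero_le) fun n => ?_
    refine measure_mono fun ω hω => ?_
    by_contra hlt
    exact hω (hball (by simpa using hlt))
  have h2 : Tendsto (fun n => ∑ φ ∈ hI.toFinset, P {ω | ∫ x, (φ x : ℝ) ∂(Y n ω).1 ∉ s φ}) atTop
      (𝓝 0) := by
    simpa using tendsto_finsetSum hI.toFinset fun φ _ => h1 φ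
  refine tendsto_of_tendsto_of_tendsto_of_le_of_le tendsto_const_nhds h2 (fun _ => zero_le)
    fun n => ?_
  refine (measure_mono fun ω hω => ?_).trans (measure_biUnion_finset_le hI.toFinset _)
  simp only [mem_iUnion, Set.Finite.mem_toFinset]
  by_contra! hne
  refine hω (htU (hst fun φ hφ => ?_))
  have := hne φ hφ
  simpa using this

/-! ### Compactly supported functions as test functions -/

open scoped Classical in
/-- The restriction to `(ℝ^d)^k` of a compactly supported function on `E_k`; it vanishes on the
tuples that contain the origin. -/
noncomputable def restrictRd {d k : ℕ} (φ : C_c(ExtSpace d k, ℝ≥0)) (y : Fin k → Rd d) : ℝ :=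
  if hy : ∀ i, y i ≠ 0 then (φ fun i => toPunctured ⟨y i, hy i⟩ : ℝ) else 0

section Restrict

variable {d k : ℕ} (φ : C_c(ExtSpace d k, ℝ≥0))

theorem restrictRd_nonneg (y : Fin k → Rd d) : 0 ≤ restrictRd φ y := by
  unfold restrictRd
  split_ifs
  · exact NNReal.coe_nonneg _
  · exact le_rfl

/-- A compact subset of `E_k` stays away from the origin in each of its components. -/
theorem exists_restrictRd_eq_zero :
    ∃ δ, 0 < δ ∧ ∀ (y : Fin k → Rd d) i, ‖y i‖ < δ → restrictRd φ y = 0 := by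
  let K : Set (Fin d → EReal) := ⋃ i, (fun y : ExtSpace d k => (y i).1) '' tsupport φ
  have hK : IsCompact K := isCompact_iUnion fun i =>
    φ.hasCompactSupport.isCompact.image (by fun_prop)
  have hopen : IsOpen (toExt (d := d) ⁻¹' Kᶜ) :=
    hK.isClosed.isOpen_compl.preimage continuous_toExt
  have h0 : (0 : Rd d) ∈ toExt (d := d) ⁻¹' Kᶜ := by
    intro h
    obtain ⟨i, y, -, hy⟩ := mem_iUnion.1 h
    apply (y i).2
    rw [show (y i).1 = toExt 0 from hy]
    ext l
    simp [toExt]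
  obtain ⟨δ, hδ, hball⟩ := Metric.isOpen_iff.1 hopen 0 h0
  refine ⟨δ, hδ, fun y i hi => ?_⟩
  unfold restrictRd
  split_ifs with hy
  · by_contra hne
    have h1 : toExt (y i) ∈ Kᶜ := hball (by simpa using hi)
    refine h1 (mem_iUnion.2 ⟨i, fun i => toPunctured ⟨y i, hy i⟩, subset_tsupport _ ?_, rfl⟩)
    exact fun h => hne (by rw [h]; rfl)
  · rfl

theorem continuous_restrictRd : Continuous (restrictRd φ) := by
  obtain ⟨δ, hδ, hφδ⟩ := exists_restrictRd_eq_zero φ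
  rw [continuous_iff_continuousAt]
  intro y
  by_cases hy : ∀ i, y i ≠ 0
  · let U : Set (Fin k → Rd d) := {y | ∀ i, y i ≠ 0}
    have hU : IsOpen U := by
      have : U = ⋂ i, {y | y i ≠ 0} := by
        ext y
        simp [U]
      rw [this]
      exact isOpen_iInter_of_finite fun i =>
        isOpen_compl_singleton.preimage (continuous_apply (A := fun _ : Fin k => Rd d) i)
    have hcont : ContinuousOn (restrictRd φ) U := by
      rw [continuousOn_iff_continuous_domRestrict]
      have h1 : U.domRestrict (restrictRd φ) =
          fun u : U => (φ fun i => toPunctured ⟨u.1 i, u.2 i⟩ : ℝ) := by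
        ext u
        exact dif_pos u.2
      rw [h1]
      refine NNReal.continuous_coe.comp (φ.continuous.comp (continuous_pi fun i => ?_))
      exact continuous_toPunctured.comp
        (((continuous_apply i).comp continuous_subtype_val).subtype_mk _)
    exact hcont.continuousAt (hU.mem_nhds hy)
  · push Not at hy
    obtain ⟨i, hi⟩ := hy
    have h1 : ∀ᶠ z in 𝓝 y, ‖z i‖ < δ := by
      have h2 : Tendsto (fun z : Fin k → Rd d => ‖z i‖) (𝓝 y) (𝓝 ‖y i‖) :=
        (continuous_apply i).norm.tendsto _
      rw [hi, norm_zero] at h2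
      exact h2.eventually_lt_const hδ
    refine (continuousAt_const (y := (0 : ℝ))).congr ?_
    filter_upwards [h1] with z hz
    exact (hφδ z i hz).symm

theorem isTestFunction_restrictRd : IsTestFunction (restrictRd φ) where
  measurable := (continuous_restrictRd φ).measurable
  nonneg := restrictRd_nonneg φ
  bounded := by
    have hc : Continuous fun y : ExtSpace d k => (φ y : ℝ) :=
      NNReal.continuous_coe.comp φ.continuous
    have hs : HasCompactSupport fun y : ExtSpace d k => (φ y : ℝ) :=
      φ.hasCompactSupport.comp_left NNReal.coe_zero
    obtain ⟨B, hB⟩ := hs.exists_bound_of_continuous hc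
    refine ⟨max B 0, fun y => ?_⟩
    unfold restrictRd
    split_ifs with hy
    · exact ((le_abs_self _).trans (hB _)).trans (le_max_left _ _)
    · exact le_max_right _ _
  eq_zero := exists_restrictRd_eq_zero φ
  continuousAt := ae_of_all _ fun _ => (continuous_restrictRd φ).continuousAt

theorem integral_diracAt (x : Fin k → Rd d) : ∫ y, (φ y : ℝ) ∂(diracAt x) = restrictRd φ x := by
  unfold diracAt restrictRd
  split_ifs with hx
  · exact integral_dirac' _ _ (NNReal.continuous_coe.comp φ.continuous).stronglyMeasurable
  · simp

theorem integral_layeredMeasure (h : (Fin k → Rd d) → ℝ) (h0 : ∀ y, 0 ≤ h y) (M : Finset (Rd d))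
    (r : ℝ) : ∫ y, (φ y : ℝ) ∂(layeredMeasure h M r).1 = layerSum h (restrictRd φ) M r := by
  have hc : Continuous fun y : ExtSpace d k => (φ y : ℝ) :=
    NNReal.continuous_coe.comp φ.continuous
  have hs : HasCompactSupport fun y : ExtSpace d k => (φ y : ℝ) :=
    φ.hasCompactSupport.comp_left NNReal.coe_zero
  have h1 : distinctTuples k M = injTuples (Fin k) M := by
    ext y
    classical
    simp [distinctTuples, mem_injTuples, Fintype.mem_piFinset]
  have h2 : ∀ y : Fin k → Rd d, Integrable (fun y : ExtSpace d k => (φ y : ℝ))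
      (ENNReal.ofReal (h y) • diracAt (r⁻¹ • y)) := fun y =>
    (hc.integrable_of_hasCompactSupport hs).smul_measure ENNReal.ofReal_ne_top
  rw [layerSum, layeredMeasure, integral_smul_measure, ENNReal.toReal_ofReal (by positivity),
    integral_finsetSum_measure fun y _ => h2 y, h1, smul_eq_mul]
  congr 1
  refine Finset.sum_congr rfl fun y _ => ?_
  rw [integral_smul_measure, ENNReal.toReal_ofReal (h0 y), integral_diracAt, smul_eq_mul]

theorem integral_limitMeasure_eq_limitFunctional {α : ℝ} (hk : 1 ≤ k) (hα : (d : ℝ) < α) :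
    ∫ y, (φ y : ℝ) ∂(limitMeasure hk hα).1 = limitFunctional α (restrictRd φ) := by
  have hm : Measurable fun x : Rd d => restrictRd φ (fun _ => x) * ‖x‖ ^ (-(α * k)) := by
    refine Measurable.mul ?_ (by fun_prop)
    exact ((continuous_restrictRd φ).comp (continuous_pi fun _ => continuous_id)).measurable
  have h1 : ∀ x : PuncturedRd d, (φ (diag k x) : ℝ) * ‖x.1‖ ^ (-(α * k)) =
      restrictRd φ (fun _ => x.1) * ‖x.1‖ ^ (-(α * k)) := by
    intro x
    have hx : ∀ _ : Fin k, x.1 ≠ 0 := fun _ => x.2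
    rw [restrictRd, dif_pos hx]
    rfl
  have h2 : ∀ x : Rd d, x ∉ ({0}ᶜ : Set (Rd d)) →
      restrictRd φ (fun _ => x) * ‖x‖ ^ (-(α * k)) = 0 := by
    intro x hx
    have hx0 : x = 0 := by simpa using hx
    rw [restrictRd, dif_neg (fun h => h ⟨0, hk⟩ hx0), zero_mul]
  rw [integral_limitMeasure, limitFunctional]
  simp_rw [h1]
  rw [integral_subtype_comap (measurableSet_singleton (0 : Rd d)).compl
    (fun x : Rd d => restrictRd φ (fun _ => x) * ‖x‖ ^ (-(α * k))),
    setIntegral_eq_integral_of_forall_compl_eq_zero h2,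
    integral_eq_lintegral_of_nonneg_ae (ae_of_all _ fun x => mul_nonneg (restrictRd_nonneg φ _)
      (by positivity)) hm.aestronglyMeasurable]

end Restrict

/-! ### Oscillation under rescaling -/

/-- The largest change of `φ` at `y` when `y` is rescaled by a factor in `[1 - η, 1 + η]`.
The supremum is over a bounded set as long as `φ` is bounded. -/
noncomputable def oscillation {d : ℕ} {ι : Type*} (φ : (ι → Rd d) → ℝ) (η : ℝ)
    (y : ι → Rd d) : ℝ :=
  sSup ((fun σ : ℝ => |φ (σ • y) - φ y|) '' Icc (1 - η) (1 + η))

section Oscillation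

variable {d : ℕ} {ι : Type*} {φ : (ι → Rd d) → ℝ}

theorem abs_sub_le_oscillation (hφ : IsTestFunction φ) {η σ : ℝ} (hσ : σ ∈ Icc (1 - η) (1 + η))
    (y : ι → Rd d) : |φ (σ • y) - φ y| ≤ oscillation φ η y := by
  obtain ⟨B, hB⟩ := hφ.bounded
  refine le_csSup ⟨B, ?_⟩ (mem_image_of_mem _ hσ)
  rintro _ ⟨τ, -, rfl⟩
  exact abs_sub_le_of_nonneg_of_le (hφ.nonneg _) (hB _) (hφ.nonneg _) (hB _)

theorem oscillation_le {η b : ℝ} (hη : 0 ≤ η) {y : ι → Rd d}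
    (h : ∀ σ ∈ Icc (1 - η) (1 + η), |φ (σ • y) - φ y| ≤ b) : oscillation φ η y ≤ b := by
  refine csSup_le (Set.Nonempty.image _ ⟨1, by constructor <;> linarith⟩) ?_
  rintro _ ⟨τ, hτ, rfl⟩
  exact h τ hτ

theorem oscillation_nonneg (η : ℝ) (y : ι → Rd d) : 0 ≤ oscillation φ η y :=
  Real.sSup_nonneg (by rintro _ ⟨τ, -, rfl⟩; exact abs_nonneg _)

theorem oscillation_le_mul_minIndicator (hφ : IsTestFunction φ) {B δ : ℝ} (hB : ∀ y, φ y ≤ B)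
    (hδ : ∀ y i, ‖y i‖ < δ → φ y = 0) {η : ℝ} (hη0 : 0 ≤ η) (hη : η ≤ 1 / 2) (y : ι → Rd d) :
    oscillation φ η y ≤ B * minIndicator (δ / 2) y := by
  refine oscillation_le hη0 fun σ hσ => ?_
  by_cases hy : ∀ i, δ / 2 ≤ ‖y i‖
  · rw [minIndicator_eq_one hy, mul_one]
    exact abs_sub_le_of_nonneg_of_le (hφ.nonneg _) (hB _) (hφ.nonneg _) (hB _)
  · rw [minIndicator_eq_zero hy, mul_zero]
    push Not at hy
    obtain ⟨i, hi⟩ := hy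
    have h0 : (0 : ℝ) ≤ ‖y i‖ := norm_nonneg _
    have hσ0 : 0 ≤ σ := by linarith [hσ.1]
    have hσ2 : σ ≤ 2 := by linarith [hσ.2]
    have h1 : ‖(σ • y) i‖ < δ := by
      rw [Pi.smul_apply, norm_smul, Real.norm_of_nonneg hσ0]
      nlinarith
    rw [hδ _ i h1, hδ y i (by linarith), sub_zero, abs_zero]

theorem isTestFunction_oscillation [Fintype ι] (hφ : IsTestFunction φ) (hc : Continuous φ) {η : ℝ}
    (hη0 : 0 ≤ η) (hη : η ≤ 1 / 2) : IsTestFunction (oscillation φ η) := by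
  obtain ⟨B, hB⟩ := hφ.bounded
  obtain ⟨δ, hδ, hφδ⟩ := hφ.eq_zero
  have hB0 : 0 ≤ B := (hφ.nonneg 0).trans (hB 0)
  have hle := oscillation_le_mul_minIndicator hφ hB hφδ hη0 hη
  have hcont : Continuous (oscillation φ η) :=
    isCompact_Icc.continuous_sSup (f := fun (y : ι → Rd d) (σ : ℝ) => |φ (σ • y) - φ y|)
      (by simp only [Function.HasUncurry.uncurry]; fun_prop)
  refine ⟨hcont.measurable, oscillation_nonneg η, ⟨B, fun y => (hle y).trans ?_⟩,
    ⟨δ / 2, by positivity, fun y i hi => ?_⟩, ae_of_all _ fun _ => hcont.continuousAt⟩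
  · exact mul_le_of_le_one_right hB0 (indicator_le_self' (fun _ _ => zero_le_one) y)
  · have h1 := hle y
    rw [minIndicator_eq_zero fun h => (h i).not_gt hi, mul_zero] at h1
    exact le_antisymm h1 (oscillation_nonneg η y)

theorem tendsto_oscillation (hc : Continuous φ) (y : ι → Rd d) :
    Tendsto (fun η => oscillation φ η y) (𝓝[>] 0) (𝓝 0) := by
  rw [Metric.tendsto_nhds]
  intro ε hε
  have h1 : ContinuousAt (fun σ : ℝ => φ (σ • y)) 1 := by fun_prop
  obtain ⟨ρ, hρ, h2⟩ := Metric.continuousAt_iff.1 h1 (ε / 2) (by positivity)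
  filter_upwards [Ioo_mem_nhdsGT hρ] with η hη
  rw [Real.dist_eq, sub_zero, abs_of_nonneg (oscillation_nonneg η y)]
  refine (oscillation_le hη.1.le fun σ hσ => ?_).trans_lt (by linarith : ε / 2 < ε)
  have h3 := h2 (x := σ) (by
    rw [Real.dist_eq, abs_lt]
    constructor <;> linarith [hσ.1, hσ.2, hη.2])
  rw [one_smul, Real.dist_eq] at h3
  exact h3.le

end Oscillation

theorem tendsto_limitFunctional_oscillation {d j : ℕ} (hd : 1 ≤ d) {α : ℝ} (hα : (d : ℝ) < α)
    {φ : (Fin (j + 1) → Rd d) → ℝ} (hφ : IsTestFunction φ) (hc : Continuous φ) :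
    Tendsto (fun η => limitFunctional α (oscillation φ η)) (𝓝[>] 0) (𝓝 0) := by
  obtain ⟨B, hB⟩ := hφ.bounded
  obtain ⟨δ, hδ, hφδ⟩ := hφ.eq_zero
  have hB0 : 0 ≤ B := (hφ.nonneg 0).trans (hB 0)
  have hq : (d : ℝ) < α * (j + 1 : ℕ) := by
    have h1 : (1 : ℝ) ≤ (j + 1 : ℕ) := by exact_mod_cast Nat.succ_le_succ (Nat.zero_le j)
    have h0 : (0 : ℝ) ≤ d := Nat.cast_nonneg d
    nlinarith
  have hη : ∀ᶠ η in 𝓝[>] (0 : ℝ), 0 ≤ η ∧ η ≤ 1 / 2 := by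
    filter_upwards [Ioo_mem_nhdsGT (show (0 : ℝ) < 1 / 2 by norm_num)] with η hη
    exact ⟨hη.1.le, hη.2.le⟩
  have hdiag : Measurable fun x : Rd d => (fun _ : Fin (j + 1) => x) :=
    measurable_pi_lambda _ fun _ => measurable_id
  have hbound : ∫⁻ x : Rd d, ENNReal.ofReal B * ENNReal.ofReal (minIndicator (δ / 2)
      (fun _ : Fin (j + 1) => x) * ‖x‖ ^ (-(α * (j + 1 : ℕ)))) ≠ ∞ := by
    rw [lintegral_const_mul' _ _ ENNReal.ofReal_ne_top]
    exact ENNReal.mul_ne_top ENNReal.ofReal_ne_top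
      ((isTestFunction_minIndicator hd (by positivity)).lintegral_diag_ne_top hq)
  have h1 : Tendsto (fun η => ∫⁻ x : Rd d, ENNReal.ofReal (oscillation φ η (fun _ => x) *
      ‖x‖ ^ (-(α * (j + 1 : ℕ))))) (𝓝[>] 0) (𝓝 (∫⁻ _ : Rd d, 0)) := by
    refine tendsto_lintegral_filter_of_dominated_convergence _ ?_ ?_ hbound ?_
    · filter_upwards [hη] with η hη
      refine ENNReal.measurable_ofReal.comp (Measurable.mul ?_ (by fun_prop))
      exact (isTestFunction_oscillation hφ hc hη.1 hη.2).measurable.comp hdiag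
    · filter_upwards [hη] with η hη
      refine ae_of_all _ fun x => ?_
      rw [← ENNReal.ofReal_mul hB0, ← mul_assoc]
      exact ENNReal.ofReal_le_ofReal (mul_le_mul_of_nonneg_right
        (oscillation_le_mul_minIndicator hφ hB hφδ hη.1 hη.2 _) (by positivity))
    · refine ae_of_all _ fun x => ?_
      have h2 := (tendsto_oscillation hc fun _ : Fin (j + 1) => x).mul_const
        (‖x‖ ^ (-(α * (j + 1 : ℕ))))
      rw [zero_mul] at h2
      simpa using ENNReal.tendsto_ofReal h2
  rw [lintegral_zero] at h1
  have h2 := ((ENNReal.tendsto_toReal ENNReal.zero_ne_top).comp h1).const_mul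
    ((α * (j + 1 : ℕ) - d) / sphereArea d)
  rw [ENNReal.toReal_zero, mul_zero] at h2
  exact h2

/-! ### The order statistic and the estimated measure -/

section Estimated

variable {d j : ℕ} {α : ℝ} {h : (Fin (j + 1) → Rd d) → ℝ} {Ω : Type*} [MeasurableSpace Ω]
  {P : Measure Ω} {N : ℕ → Ω → Finset (Rd d)} {m : ℕ → ℕ} {r : ℕ → ℝ}

theorem le_orderStat_div_iff (hh : IsGeometricConstraint d (j + 1) h) (M : Finset (Rd d)) {l : ℕ}
    (hl : 0 < l) {a s : ℝ} (ha : 0 < a) (hs : 0 < s) :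
    a ≤ orderStat h M (l ^ (j + 1)) / s ↔
      1 ≤ ((l : ℝ) ^ (j + 1))⁻¹ * layerSum h (minIndicator a) M s := by
  have hl' : (0 : ℝ) < l := by exact_mod_cast hl
  rw [le_div_iff₀ hs, le_orderStat_iff_le_sum (Nat.succ_pos j) hh M (by positivity) ha hs, layerSum,
    one_div, ← div_eq_inv_mul, ← div_eq_inv_mul, div_div, le_div_iff₀ (by positivity), one_mul]
  push_cast
  rfl

/-- The order statistic is asymptotically equal to the scaling radius: the limit measure of
`{min |y_i| ≥ a}` is `a^(d - α k)`, which crosses the level `1` exactly at `a = 1`. -/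
theorem tendstoInMeasure_orderStat_div (hd : 1 ≤ d) (hα : (d : ℝ) < α)
    (hh : IsGeometricConstraint d (j + 1) h) (hm_pos : ∀ n, 0 < m n) (hr : ∀ᶠ n in atTop, 0 < r n)
    (hLLN : ∀ φ : (Fin (j + 1) → Rd d) → ℝ, IsTestFunction φ →
      TendstoInMeasure P (fun n ω => ((m n : ℝ) ^ (j + 1))⁻¹ * layerSum h φ (N n ω) (r n)) atTop
        fun _ => limitFunctional α φ) :
    TendstoInMeasure P (fun n ω => orderStat h (N n ω) (m n ^ (j + 1)) / r n) atTop
      fun _ => (1 : ℝ) := by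
  rw [tendstoInMeasure_iff_norm]
  intro ε' hε'
  set ε := min ε' 1 with hεdef
  have hε : 0 < ε := lt_min hε' one_pos
  have hε1 : ε ≤ 1 := min_le_right _ _
  have hq : (d : ℝ) - α * (j + 1 : ℕ) < 0 := by
    have h1 : (1 : ℝ) ≤ (j + 1 : ℕ) := by exact_mod_cast Nat.succ_le_succ (Nat.zero_le j)
    have h0 : (0 : ℝ) ≤ d := Nat.cast_nonneg d
    nlinarith
  have ha : 0 < 1 + ε := by linarith
  have hb : 0 < 1 - ε / 2 := by linarith
  have hA : (1 + ε) ^ ((d : ℝ) - α * (j + 1 : ℕ)) < 1 :=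
    Real.rpow_lt_one_of_one_lt_of_neg (by linarith) hq
  have hB : 1 < (1 - ε / 2) ^ ((d : ℝ) - α * (j + 1 : ℕ)) :=
    Real.one_lt_rpow_of_pos_of_lt_one_of_neg hb (by linarith) hq
  have h1 := tendstoInMeasure_iff_norm.1 (hLLN _ (isTestFunction_minIndicator hd ha)) _
    (sub_pos.2 hA)
  have h2 := tendstoInMeasure_iff_norm.1 (hLLN _ (isTestFunction_minIndicator hd hb)) _
    (sub_pos.2 hB)
  have h3 := h1.add h2
  rw [add_zero] at h3
  refine tendsto_of_tendsto_of_tendsto_of_le_of_le' tendsto_const_nhds h3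
    (Eventually.of_forall fun _ => zero_le) ?_
  filter_upwards [hr] with n hrn
  refine (measure_mono fun ω hω => ?_).trans (measure_union_le _ _)
  have hω' : ε ≤ |orderStat h (N n ω) (m n ^ (j + 1)) / r n - 1| := (min_le_left _ _).trans hω
  rcases le_abs.1 hω' with hω' | hω'
  · left
    have h4 := (le_orderStat_div_iff hh (N n ω) (hm_pos n) ha hrn).1 (by linarith)
    rw [mem_ofPred_eq, limitFunctional_minIndicator hd hα ha, Real.norm_eq_abs]
    exact (sub_le_sub_right h4 _).trans (le_abs_self _)
  · right
    have h4 := (le_orderStat_div_iff hh (N n ω) (hm_pos n) hb hrn).not.1 (by linarith)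
    rw [mem_ofPred_eq, limitFunctional_minIndicator hd hα hb, Real.norm_eq_abs, abs_sub_comm]
    refine le_trans ?_ (le_abs_self _)
    linarith

/-- Changing the scale of a layered sum by a factor close to `1` changes it by at most the sum of
the oscillations. -/
theorem abs_layerSum_sub_le (h0 : ∀ y, 0 ≤ h y) {φ : (Fin (j + 1) → Rd d) → ℝ}
    (hφ : IsTestFunction φ) (M : Finset (Rd d)) {η s u : ℝ} (hs : 0 < s)
    (hu : s / u ∈ Icc (1 - η) (1 + η)) :
    |layerSum h φ M u - layerSum h φ M s| ≤ layerSum h (oscillation φ η) M s := by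
  have h1 : ∀ y : Fin (j + 1) → Rd d, u⁻¹ • y = (s / u) • s⁻¹ • y := by
    intro y
    rw [smul_smul, div_eq_mul_inv, mul_right_comm, mul_inv_cancel₀ hs.ne', one_mul]
  rw [layerSum, layerSum, layerSum, ← mul_sub, ← Finset.sum_sub_distrib, abs_mul,
    abs_of_nonneg (by positivity : (0 : ℝ) ≤ 1 / ((j + 1).factorial : ℝ))]
  refine mul_le_mul_of_nonneg_left ?_ (by positivity)
  refine (Finset.abs_sum_le_sum_abs _ _).trans (Finset.sum_le_sum fun y _ => ?_)
  rw [← mul_sub, abs_mul, abs_of_nonneg (h0 y), h1]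
  exact mul_le_mul_of_nonneg_left (abs_sub_le_oscillation hφ hu _) (h0 y)

/-- Replacing the scaling radius by an asymptotically equivalent random one does not change the
limit of the layered sums. -/
theorem tendstoInMeasure_layerSum_orderStat (hd : 1 ≤ d) (hα : (d : ℝ) < α)
    (h0 : ∀ y, 0 ≤ h y) (hr : ∀ᶠ n in atTop, 0 < r n)
    (hLLN : ∀ φ : (Fin (j + 1) → Rd d) → ℝ, IsTestFunction φ →
      TendstoInMeasure P (fun n ω => ((m n : ℝ) ^ (j + 1))⁻¹ * layerSum h φ (N n ω) (r n)) atTop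
        fun _ => limitFunctional α φ)
    {U : ℕ → Ω → ℝ}
    (hU : TendstoInMeasure P (fun n ω => U n ω / r n) atTop fun _ => (1 : ℝ))
    {φ : (Fin (j + 1) → Rd d) → ℝ} (hφ : IsTestFunction φ) (hc : Continuous φ) :
    TendstoInMeasure P (fun n ω => if U n ω = 0 then 0 else
      ((m n : ℝ) ^ (j + 1))⁻¹ * layerSum h φ (N n ω) (U n ω)) atTop
        fun _ => limitFunctional α φ := by
  rw [tendstoInMeasure_iff_norm]
  intro ε hε
  obtain ⟨η, hηε, hη0, hη1⟩ :=
    (((tendsto_limitFunctional_oscillation hd hα hφ hc).eventually_lt_const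
      (show 0 < ε / 4 by positivity)).and
      (Ioo_mem_nhdsGT (show (0 : ℝ) < 1 / 2 by norm_num))).exists
  have h1 := tendstoInMeasure_iff_norm.1 hU (η / 2) (by positivity)
  have h2 := tendstoInMeasure_iff_norm.1 (hLLN φ hφ) (ε / 2) (by positivity)
  have h3 := tendstoInMeasure_iff_norm.1 (hLLN _ (isTestFunction_oscillation hφ hc hη0.le hη1.le))
    (ε / 4) (by positivity)
  have h4 := (h1.add h2).add h3
  rw [add_zero, add_zero] at h4
  refine tendsto_of_tendsto_of_tendsto_of_le_of_le' tendsto_const_nhds h4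
    (Eventually.of_forall fun _ => zero_le) ?_
  filter_upwards [hr] with n hrn
  refine (measure_mono fun ω hω => ?_).trans
    ((measure_union_le _ _).trans (add_le_add_left (measure_union_le _ _) _))
  by_contra hcon
  rw [mem_union, mem_union, not_or, not_or] at hcon
  obtain ⟨⟨hc1, hc2⟩, hc3⟩ := hcon
  rw [mem_ofPred_eq, not_le, Real.norm_eq_abs, abs_lt] at hc1 hc2 hc3
  have hw : 1 / 2 < U n ω / r n := by linarith [hc1.1]
  have hU0 : 0 < U n ω := by
    have := (lt_div_iff₀ hrn).1 hw
    linarith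
  -- `φ (y / U)` is `φ` at `y / r` rescaled by `r / U`, which lies in the range of the oscillation
  have hmem : r n / U n ω ∈ Icc (1 - η) (1 + η) := by
    have h5 : (1 - η) * U n ω ≤ r n := by
      have := (div_lt_iff₀ hrn).1 (show U n ω / r n < 1 + η / 2 by linarith [hc1.2])
      calc (1 - η) * U n ω ≤ (1 - η) * ((1 + η / 2) * r n) :=
            mul_le_mul_of_nonneg_left this.le (by linarith)
        _ ≤ r n := by nlinarith [mul_pos hη0 hrn, mul_pos (mul_pos hη0 hη0) hrn]
    have h6 : r n ≤ (1 + η) * U n ω := by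
      have := (lt_div_iff₀ hrn).1 (show 1 - η / 2 < U n ω / r n by linarith [hc1.1])
      nlinarith
    exact ⟨(le_div_iff₀ hU0).2 h5, (div_le_iff₀ hU0).2 h6⟩
  have h7 := mul_le_mul_of_nonneg_left (abs_layerSum_sub_le h0 hφ (N n ω) hrn hmem)
    (show 0 ≤ ((m n : ℝ) ^ (j + 1))⁻¹ by positivity)
  rw [← abs_of_nonneg (show 0 ≤ ((m n : ℝ) ^ (j + 1))⁻¹ by positivity), ← abs_mul, mul_sub,
    abs_of_nonneg (show 0 ≤ ((m n : ℝ) ^ (j + 1))⁻¹ by positivity), abs_le] at h7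
  rw [mem_ofPred_eq, if_neg hU0.ne', Real.norm_eq_abs, le_abs] at hω
  rcases hω with hω | hω <;> linarith [h7.1, h7.2, hc2.1, hc2.2, hc3.2]

theorem integral_smul_radonMeasure {X : Type*} [TopologicalSpace X] [MeasurableSpace X] (c : ℝ≥0)
    (μ : RadonMeasure X) (g : X → ℝ) : ∫ x, g x ∂(c • μ).1 = c * ∫ x, g x ∂μ.1 := by
  change ∫ x, g x ∂((c : ℝ≥0∞) • μ.1) = _
  rw [integral_smul_measure, ENNReal.coe_toReal, smul_eq_mul]

end Estimated

end LayeredHill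

theorem propositionp
    {d k : ℕ} (hd : 1 ≤ d) (hk : 1 ≤ k) {α : ℝ} (hα : (d : ℝ) < α)
    {f : Rd d → ℝ} (hf : IsRadialRVDensity d α f)
    {h : (Fin k → Rd d) → ℝ} (hh : IsGeometricConstraint d k h) (hC : 0 < layerConst k h)
    {R : ℝ → ℝ} (hR : IsRadius d k α f R)
    {m : ℕ → ℕ} (hm_pos : ∀ n, 0 < m n) (hm : Tendsto m atTop atTop)
    (hmn : Tendsto (fun n : ℕ => (m n : ℝ) / n) atTop (𝓝 0))
    {Ω : Type*} [MeasurableSpace Ω] (P : Measure Ω) [IsProbabilityMeasure P]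
    {N : ℕ → Ω → Finset (Rd d)}
    (hN : ∀ n : ℕ, 1 ≤ n →
      IsPoissonProcess P (volume.withDensity fun x => ENNReal.ofReal (n * f x)) (N n)) :
    TendstoInProbability P
        (fun n ω => (((m n : ℝ≥0) ^ k)⁻¹ : ℝ≥0) •
          layeredMeasure h (N n ω) (R (layerConst k h * n / m n)))
        (limitMeasure hk hα) ∧
      TendstoInMeasure P
        (fun n ω => orderStat h (N n ω) (m n ^ k) / R (layerConst k h * n / m n))
        atTop (fun _ => (1 : ℝ)) ∧
      TendstoInProbability P
        (fun n ω => (((m n : ℝ≥0) ^ k)⁻¹ : ℝ≥0) • estimatedMeasure h (N n ω) (m n ^ k))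
        (limitMeasure hk hα) := by
  obtain ⟨j, rfl⟩ : ∃ j, k = j + 1 := ⟨k - 1, by omega⟩
  have h0 : ∀ y, 0 ≤ h y := fun y => by rcases hh.zero_or_one y with h | h <;> simp [h]
  have hr : ∀ᶠ n : ℕ in atTop, 0 < R (layerConst (j + 1) h * n / m n) :=
    (hR.tendsto_atTop.comp (tendsto_const_mul_div hm_pos hmn hC)).eventually_gt_atTop 0
  have hLLN := fun (φ : (Fin (j + 1) → Rd d) → ℝ) (hφ : IsTestFunction φ) =>
    tendstoInMeasure_layerSum hd hα hf hh hC hR hm_pos hm hmn hN hφ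
  have hU := tendstoInMeasure_orderStat_div hd hα hh hm_pos hr hLLN
  refine ⟨tendstoInProbability_of_forall_integral fun φ => ?_, hU,
    tendstoInProbability_of_forall_integral fun φ => ?_⟩
  · rw [integral_limitMeasure_eq_limitFunctional]
    simp_rw [integral_smul_radonMeasure, integral_layeredMeasure φ h h0]
    simpa using hLLN _ (isTestFunction_restrictRd φ)
  · rw [integral_limitMeasure_eq_limitFunctional]
    have key := tendstoInMeasure_layerSum_orderStat hd hα h0 hr hLLN hU
      (isTestFunction_restrictRd φ) (continuous_restrictRd φ)
    refine key.congr_left fun n => ae_of_all _ fun ω => ?_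
    simp only [integral_smul_radonMeasure, estimatedMeasure]
    split_ifs with hz
    · change 0 = _ * ∫ x, (φ x : ℝ) ∂(0 : Measure (ExtSpace d (j + 1)))
      simp
    · rw [integral_layeredMeasure φ h h0]
      simp
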